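/- **Theorem (Inner Tree Theorem).** Let $T$ be a finite loose tree, that is, a finite connected graph without cycles in which, besides ordinary edges (with two vertices), also loose edges (with exactly one vertex) are allowed. The degree of a vertex is the number of ordinary and loose edges incident with it, and a vertex is *inner* if its degree is at least $2$. Let $I$ be the set of inner vertices, suppose $|I|\ge 2$, and let $T(I)$ be the subtree of $T$ induced on $I$. Let $k$ be any field. Let $\overline{T}$ be the graph obtained from $T$ by adding to each loose edge a new second vertex, let $m$ be the number of vertices of $\overline T$, and let $\mathbb{P}^{m-1}_k$ be the projective space with homogeneous coordinates $X_a$ indexed by the vertices $a$ of $\overline T$. For a vertex $v$ of $T$ let $\mathbb{A}_v\subseteq\mathbb{P}^{m-1}_k$ be the locally closed subset given by $X_v\ne 0$ and $X_a=0$ for all $a\neq v$ not adjacent to $v$ in $\overline T$ (an affine space of dimension $\deg v$). Put $\mathcal{X}_k=\mathcal F(T)\otimes_{\mathbb F_1}k=\bigcup_{v}\mathbb{A}_v$, the union over the vertices $v$ of $T$, taken as a set of scheme points, with the subspace topology and with the restriction of the structure sheaf of its reduced closure in $\mathbb{P}^{m-1}_k$. The embedding $\iota$ sends a vertex $v$ of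 $T$ to the coordinate point $e_v$, and an edge with vertices $u,v$ to the projective line through $e_u$ and $e_v$. Let $\mathrm{Aut}(\mathcal{X}_k)$ be any of the following groups. * Combinatorial: pairs of a permutation of the $k$-rational points of $\mathcal{X}_k$ and a permutation of the lines of $\mathcal{X}_k$ that preserve incidence. Here the lines are the lines of $\mathbb{P}^{m-1}_k$ that, as schemes, are contained in $\mathcal{X}_k$ or meet $\mathcal{X}_k$ in the whole line minus exactly one point. * Projective: permutations of $\mathcal{X}_k$ induced by elements of $\mathbf{P\Gamma L}_m(k)$ that stabilize $\mathcal{X}_k$. * Topological: homeomorphisms of $\mathcal{X}_k$. * Scheme-theoretic: automorphisms of $\mathcal{X}_k$ as a locally ringed space. Let $\mathrm{Aut}(\iota(T(I)))$ be the group of those automorphisms of the tree $T(I)$ that extend to an automorphism of the loose tree $T$. Then every element of $\mathrm{Aut}(\mathcal{X}_k)$ stabilizes $\iota(T(I))$: it permutes the points $\iota(v)$, $v\in I$, and the projective lines $\iota(uv)$, $uv$ an edge of $T(I)$, and acts on these as an element of $\mathrm{Aut}(\iota(T(I)))$. Moreover, every element of $\mathrm{Aut}(\iota(T(I)))$ is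 induced in this way by an element of $\mathrm{Aut}(\mathcal{X}_k)$. -/

import Mathlib

open CategoryTheory AlgebraicGeometry TopologicalSpace

attribute [local instance] MvPolynomial.gradedAlgebra

/-! ### Loose graphs and loose trees -/

/-- A loose graph with vertex set `V` and edge set `E`: every edge is incident with at most two
vertices (so edges with one or with no vertex are allowed). -/
structure LooseGraph (V E : Type*) where
  /-- The vertices incident with an edge. -/
  ends : E → Finset V
  card_ends_le : ∀ e, (ends e).card ≤ 2

namespace LooseGraph

variable {V E : Type*} (T : LooseGraph V E)

/-- The graph on the vertices of `T` whose edges are the edges of `T` with two vertices. -/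
def graph : SimpleGraph V where
  Adj u v := u ≠ v ∧ ∃ e, u ∈ T.ends e ∧ v ∈ T.ends e
  symm := ⟨fun _ _ h => ⟨h.1.symm, h.2.imp fun _ he => ⟨he.2, he.1⟩⟩⟩
  loopless := ⟨fun _ h => h.1 rfl⟩

/-- A loose tree: connected and without cycles. There are no multiple edges (these would form a
cycle) and no edges without vertices (these would be separate components); a vertex may carry any
number of loose edges, that is, edges whose only vertex it is. -/
structure IsLooseTree : Prop where
  isTree : T.graph.IsTree
  ends_nonempty : ∀ e, (T.ends e).Nonempty
  eq_of_ends_eq : ∀ e e', (T.ends e).card = 2 → T.ends e = T.ends e' → e = e'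

/-- The degree of a vertex: the number of edges (loose or not) incident with it. -/
noncomputable def degree (v : V) : ℕ := {e | v ∈ T.ends e}.ncard

/-- The set of inner vertices. -/
def inner : Set V := {v | 2 ≤ T.degree v}

/-- The subtree `T(I)` induced on the set `I` of inner vertices. -/
abbrev innerTree : SimpleGraph T.inner := T.graph.induce T.inner

/-- Automorphisms of a loose graph: permutations of the vertices and of the edges that preserve
incidence. -/
structure Auto where
  onVert : Equiv.Perm V
  onEdge : Equiv.Perm E
  mem_ends_iff : ∀ v e, onVert v ∈ T.ends (onEdge e) ↔ v ∈ T.ends e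

/-- The automorphisms of the embedded inner tree: those automorphisms of `T(I)` that are
compatible with the way `T(I)` sits in `T`, i.e. that extend to an automorphism of `T`. -/
def embeddedInnerAut : Set (T.innerTree ≃g T.innerTree) :=
  {α | ∃ φ : T.Auto, ∀ v : T.inner, φ.onVert v = α v}

/-- The vertices of the completion of `T`: every missing end of an edge is replaced by a new
vertex. -/
abbrev CompVert := V ⊕ (Σ e : E, Fin (2 - (T.ends e).card))

/-- Incidence between vertices of the completion and edges. -/
def Inc : T.CompVert → E → Prop
  | .inl v, e => v ∈ T.ends e
  | .inr a, e => a.1 = e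

/-- The completion of `T`, a graph. -/
def completion : SimpleGraph T.CompVert where
  Adj a b := a ≠ b ∧ ∃ e, T.Inc a e ∧ T.Inc b e
  symm := ⟨fun _ _ h => ⟨h.1.symm, h.2.imp fun _ he => ⟨he.2, he.1⟩⟩⟩
  loopless := ⟨fun _ h => h.1 rfl⟩

end LooseGraph

/-! ### Projective space over `k` with coordinates indexed by `σ` -/

section ProjectiveSpace

variable (σ k : Type*) [Field k]

/-- The grading of `k[X_a : a ∈ σ]` by total degree. -/
abbrev polyGrading : ℕ → Submodule k (MvPolynomial σ k) := MvPolynomial.homogeneousSubmodule σ k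

/-- The projective space with homogeneous coordinates `X_a`, `a ∈ σ`, as a scheme. Its points
are the homogeneous prime ideals that do not contain all `X_a`. -/
noncomputable abbrev projSpace : Scheme := Proj (polyGrading σ k)

variable {σ k}

/-- The ring homomorphism `k[X_a] → k[t]`, `X_a ↦ x_a t`. -/
noncomputable def evalLine (x : σ → k) : MvPolynomial σ k →ₐ[k] Polynomial k :=
  MvPolynomial.aeval fun a => Polynomial.C (x a) * Polynomial.X

theorem evalLine_of_isHomogeneous (x : σ → k) {f : MvPolynomial σ k} {n : ℕ}
    (hf : f.IsHomogeneous n) :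
    evalLine x f = Polynomial.C (MvPolynomial.eval x f) * Polynomial.X ^ n := by
  rw [evalLine, MvPolynomial.aeval_def, MvPolynomial.eval₂_eq, MvPolynomial.eval_eq, map_sum,
    Finset.sum_mul]
  refine Finset.sum_congr rfl fun s hs => ?_
  have hn : ∑ i ∈ s.support, s i = n := by
    rw [← hf (MvPolynomial.mem_support_iff.mp hs), Finsupp.weight_apply, Finsupp.sum]
    simp
  simp only [mul_pow, Finset.prod_mul_distrib, Finset.prod_pow_eq_pow_sum, hn, map_mul, map_prod,
    map_pow, Polynomial.algebraMap_eq]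
  ring

/-- The scheme point of projective space given by a `k`-rational point `[x]`: the ideal
generated by the homogeneous polynomials that vanish at `x`. -/
noncomputable def ratPoint (x : σ → k) (hx : x ≠ 0) : ProjectiveSpectrum (polyGrading σ k) where
  asHomogeneousIdeal := ⟨RingHom.ker (evalLine x), by
    intro n f hf
    have hc : ∀ m, (evalLine x f).coeff m
        = MvPolynomial.eval x (MvPolynomial.homogeneousComponent m f) := by
      intro m
      conv_lhs => rw [← MvPolynomial.sum_homogeneousComponent f, map_sum]
      simp_rw [evalLine_of_isHomogeneous x (MvPolynomial.homogeneousComponent_isHomogeneous _ f)]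
      simp only [Polynomial.finsetSum_coeff, Polynomial.coeff_C_mul_X_pow]
      rw [Finset.sum_ite_eq]
      split_ifs with h
      · rfl
      · rw [MvPolynomial.homogeneousComponent_eq_zero, map_zero]
        simpa using h
    have hd : (DirectSum.decompose (polyGrading σ k) f n : MvPolynomial σ k)
        = MvPolynomial.homogeneousComponent n f :=
      MvPolynomial.decomposition.decompose'_apply f n
    change evalLine x _ = 0
    rw [hd, evalLine_of_isHomogeneous x (MvPolynomial.homogeneousComponent_isHomogeneous n f),
      ← hc n, show evalLine x f = 0 from hf]
    simp⟩
  isPrime := RingHom.ker_isPrime _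
  not_irrelevant_le := by
    obtain ⟨a, ha⟩ := Function.ne_iff.mp hx
    intro h
    have hX : (MvPolynomial.X a : MvPolynomial σ k) ∈
        HomogeneousIdeal.irrelevant (polyGrading σ k) :=
      HomogeneousIdeal.mem_irrelevant_of_mem _ one_pos (MvPolynomial.isHomogeneous_X k a)
    have h0 : evalLine x (MvPolynomial.X a) = 0 := h hX
    simp [evalLine] at h0
    exact ha h0

theorem X_mem_ratPoint_iff (x : σ → k) (hx : x ≠ 0) (a : σ) :
    MvPolynomial.X a ∈ (ratPoint x hx).asHomogeneousIdeal ↔ x a = 0 := by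
  change evalLine x (MvPolynomial.X a) = 0 ↔ _
  simp [evalLine]

/-- The closed linear subspace of projective space that belongs to a linear subspace `W` of
`σ → k`: the set of scheme points at which all linear forms vanishing on `W` vanish. -/
def linSpace [Fintype σ] (W : Submodule k (σ → k)) : Set (ProjectiveSpectrum (polyGrading σ k)) :=
  {p | ∀ c : σ → k, (∀ x ∈ W, ∑ a, c a * x a = 0) →
    (∑ a, MvPolynomial.C (c a) * MvPolynomial.X a : MvPolynomial σ k) ∈ p.asHomogeneousIdeal}

/-- The semilinear substitution with companion field automorphism `τ` and matrix `A`. -/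
noncomputable def semilinSubst [Fintype σ] (τ : k ≃+* k) (A : Matrix σ σ k) :
    MvPolynomial σ k →+* MvPolynomial σ k :=
  MvPolynomial.eval₂Hom (MvPolynomial.C.comp τ.toRingHom)
    fun a => ∑ b, MvPolynomial.C (A a b) * MvPolynomial.X b

end ProjectiveSpace

/-! ### The space `X_k` of a loose tree -/

namespace LooseGraph

variable {V E : Type*} (T : LooseGraph V E) (k : Type*) [Field k]

/-- The scheme points of the ambient projective space of `T`; its homogeneous coordinates are
indexed by the vertices of the completion of `T`. -/
abbrev Ambient := ProjectiveSpectrum (polyGrading T.CompVert k)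

/-- The local affine space `𝔸_v` at a vertex `v` of `T`, whose directions are the edges incident
with `v`: inside the coordinate subspace spanned by `v` and its neighbours in the completion, the
complement of the hyperplane `X_v = 0`. -/
def localAffine (v : V) : Set (T.Ambient k) :=
  {p | MvPolynomial.X (Sum.inl v) ∉ p.asHomogeneousIdeal ∧
    ∀ a, a ≠ Sum.inl v → ¬ T.completion.Adj (Sum.inl v) a →
      MvPolynomial.X a ∈ p.asHomogeneousIdeal}

/-- The set of scheme points of `X_k = F(T) ⊗ k`: the union of the local affine spaces inside
the ambient projective space. It carries the subspace topology. -/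
def points : Set (T.Ambient k) := ⋃ v, T.localAffine k v

/-- The reduced closed subscheme of the ambient projective space on the closure of `X_k`. -/
noncomputable def closureScheme : Scheme :=
  (Scheme.IdealSheafData.vanishingIdeal (X := projSpace T.CompVert k)
    ⟨closure (T.points k), isClosed_closure⟩).subscheme

/-- The closed immersion of the closure of `X_k`. -/
noncomputable def closureι : T.closureScheme k ⟶ projSpace T.CompVert k :=
  Scheme.IdealSheafData.subschemeι _

/-- The inclusion of `X_k`, as a topological space, in the ambient projective space. -/
noncomputable def incl : TopCat.of (T.points k) ⟶ (projSpace T.CompVert k).toTopCat :=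
  TopCat.ofHom ⟨Subtype.val, continuous_subtype_val⟩

/-- `X_k` as a ringed space: the structure sheaf is the restriction to `X_k` (inverse image along
the inclusion) of the structure sheaf of its closure with the reduced structure. The stalks are
local rings, and hence every automorphism of this ringed space is one of locally ringed spaces. -/
noncomputable def ringedSpace : SheafedSpace CommRingCat where
  carrier := TopCat.of (T.points k)
  presheaf := ((TopCat.Sheaf.pullback CommRingCat (T.incl k)).obj
    ((TopCat.Sheaf.pushforward CommRingCat (T.closureι k).base).obj (T.closureScheme k).sheaf)).obj
  IsSheaf := ((TopCat.Sheaf.pullback CommRingCat (T.incl k)).obj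
    ((TopCat.Sheaf.pushforward CommRingCat (T.closureι k).base).obj
      (T.closureScheme k).sheaf)).property

/-! ### Rational points, and the embedding `ι` of the vertices of `T` in `X_k` -/

variable {k}

/-- The scheme point of the ambient space that belongs to a `k`-rational point. -/
noncomputable def toAmbient (x : Projectivization k (T.CompVert → k)) : T.Ambient k :=
  ratPoint x.rep x.rep_nonzero

variable (k)

/-- The `k`-rational points of `X_k`. -/
abbrev RatPoints := {x : Projectivization k (T.CompVert → k) // T.toAmbient x ∈ T.points k}

section Embedding

variable [DecidableEq V] [DecidableEq E]

/-- The coordinate vector that belongs to a vertex of `T`. -/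
abbrev vertVec (v : V) : T.CompVert → k := Pi.single (Sum.inl v) 1

theorem vertVec_ne_zero (v : V) : T.vertVec k v ≠ 0 := by
  simp [vertVec]

theorem ratPoint_mem_points (v : V) {x : T.CompVert → k} (hx : x ≠ 0) (c : k)
    (h : x = c • T.vertVec k v) : ratPoint x hx ∈ T.points k := by
  subst h
  have hc : c ≠ 0 := fun h0 => hx (by simp [h0])
  refine Set.mem_iUnion.mpr ⟨v, ?_, fun a ha _ => ?_⟩
  · rw [X_mem_ratPoint_iff]
    simpa using hc
  · rw [X_mem_ratPoint_iff]
    simp [ha]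

/-- The embedding of the vertices of `T` in the set of scheme points of `X_k`. -/
noncomputable def vertPoint (v : V) : T.points k :=
  ⟨ratPoint (T.vertVec k v) (T.vertVec_ne_zero k v),
    T.ratPoint_mem_points k v _ 1 (one_smul _ _).symm⟩

/-- The embedding of the vertices of `T` in the set of `k`-rational points of `X_k`. -/
noncomputable def vertRatPoint (v : V) : T.RatPoints k :=
  ⟨Projectivization.mk k (T.vertVec k v) (T.vertVec_ne_zero k v), by
    obtain ⟨c, hc⟩ := Projectivization.exists_smul_eq_mk_rep k (T.vertVec k v)
      (T.vertVec_ne_zero k v)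
    exact T.ratPoint_mem_points k v _ c hc.symm⟩

end Embedding

/-! ### `X_k` as an incidence geometry -/

variable [Fintype V] [Fintype E]

/-- The lines of `X_k`: lines of the ambient projective space that are contained in `X_k`
(projective lines), or meet `X_k` in the whole line minus one point (complete affine lines).
Both are conditions on all points of the scheme `X_k`. -/
abbrev Lines := {W : Submodule k (T.CompVert → k) // Module.finrank k W = 2 ∧
  (linSpace W ⊆ T.points k ∨ ∃ p, linSpace W \ T.points k = {p})}

/-- Combinatorial automorphisms of `X_k`: permutations of the points and of the lines that
preserve incidence. -/
structure CombAuto where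
  onPoints : Equiv.Perm (T.RatPoints k)
  onLines : Equiv.Perm (T.Lines k)
  incident_iff : ∀ x L, (onPoints x).1.submodule ≤ (onLines L).1 ↔ x.1.submodule ≤ L.1

/-! ### The other automorphisms of `X_k`, as permutations of its scheme points -/

/-- A permutation of the points of `X_k` is projective if it is induced by an automorphism of the
ambient projective space, i.e. by an invertible semilinear substitution of the coordinates. -/
def IsProjective [DecidableEq V] [DecidableEq E] (g : Equiv.Perm (T.points k)) : Prop :=
  ∃ (τ : k ≃+* k) (A : GL T.CompVert k), ∀ (p : T.points k) (f : MvPolynomial T.CompVert k),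
    f ∈ (g p).1.asHomogeneousIdeal ↔ semilinSubst τ A.1 f ∈ p.1.asHomogeneousIdeal

/-- A permutation of the points of `X_k` is topological if it is a homeomorphism. -/
def IsTopological (g : Equiv.Perm (T.points k)) : Prop :=
  Continuous g ∧ Continuous g.symm

/-- A permutation of the points of `X_k` is scheme-theoretic if it is the map on points of an
automorphism of `X_k` as a ringed space. -/
def IsSchemeTheoretic (g : Equiv.Perm (T.points k)) : Prop :=
  ∃ γ : T.ringedSpace k ≅ T.ringedSpace k, ∀ p, γ.hom.hom.base p = g p

/-! ### The embedded inner tree -/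

section InnerTree

variable [DecidableEq V] [DecidableEq E]

/-- The linear subspace spanned by the coordinate vectors of two vertices. -/
def edgeSpan (u v : V) : Submodule k (T.CompVert → k) :=
  Submodule.span k {T.vertVec k u, T.vertVec k v}

/-- The projective line in `X_k` that belongs to an edge with vertices `u` and `v`, as a set of
scheme points. -/
def edgeLine (u v : V) : Set (T.points k) := {p | p.1 ∈ linSpace (T.edgeSpan k u v)}

variable {T k}

/-- A permutation `g` of the points of `X_k` stabilizes the embedded inner tree `ι(T(I))`, and its
action on the vertices and the edges of `ι(T(I))` is given by the automorphism `α` of `T(I)`. -/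
def Induces (g : Equiv.Perm (T.points k)) (α : T.innerTree ≃g T.innerTree) : Prop :=
  (∀ v : T.inner, g (T.vertPoint k v) = T.vertPoint k (α v)) ∧
  ∀ u v : T.inner, T.innerTree.Adj u v → g '' T.edgeLine k u v = T.edgeLine k (α u) (α v)

/-- The same for a combinatorial automorphism. -/
def CombAuto.Induces (g : T.CombAuto k) (α : T.innerTree ≃g T.innerTree) : Prop :=
  (∀ v : T.inner, g.onPoints (T.vertRatPoint k v) = T.vertRatPoint k (α v)) ∧
  ∀ u v : T.inner, T.innerTree.Adj u v → ∃ L : T.Lines k,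
    L.1 = T.edgeSpan k u v ∧ (g.onLines L).1 = T.edgeSpan k (α u) (α v)

end InnerTree

end LooseGraph

/-!
Every automorphism `φ` of `T` permutes the vertices of the completion, and so acts on projective
space by a permutation of the coordinates. This action stabilizes `X_k` and gives automorphisms of
all four kinds (`Auto.combAuto`, `Auto.isProjective_perm`, `Auto.isSchemeTheoretic_perm`). For the
structure sheaf, `φ` acts on the closure of `X_k` with its reduced structure, and the inverse
image to `X_k` is compatible with the two homeomorphisms because both composites are left adjoint
to the same pushforward (`TopCat.Sheaf.pullbackPushforwardIso`). It remains to show that an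
automorphism of `X_k` permutes the vertices of `T` and preserves adjacency and degrees: since a
vertex of degree `d` with `n` neighbours in the tree has `d - n` loose edges, such a permutation
extends to the edges of `T` (`exists_auto_of_degree_eq`).

Projective and scheme-theoretic automorphisms are homeomorphisms, so for them and for the
homeomorphisms only the order of specialization of `X_k` is used. As `T` has two inner vertices,
every vertex is adjacent to an inner one, and the minimal points are the generic points of the
irreducible components, one for each inner vertex. The component of `u` consists of the affine
space at `u`, of dimension `deg u`, and of the coordinate points `e_w` at infinity for the
vertices `w` of `T` adjacent to `u`; all other points at infinity are missing. These `e_w` are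
recognized as follows. An irreducible closed subset through some `e_w` may meet every hypersurface
of the component; for the lines in direction `w` it does, as the equation of a hypersurface that
avoids `e_w` is not constant on them (`meetsHypersurfaces_lineGen`). A closed subset that contains
no `e_w` is disjoint from some hypersurface, namely from a component of `F = -1` where `F`
vanishes on the subset (`exists_le_vertPoint_of_meetsHypersurfaces`). There are infinitely many
lines in direction `w`, and a finite set without `e_w` misses one of them
(`exists_lineGen_avoiding`). Hence the `e_w` are the elements common to all finite sets that meet
every irreducible closed subset meeting all hypersurfaces (`mem_hub_gen_iff`). This also singles out the
affine space at `u`, whose Krull dimension is the degree of `u`. Finally, the components of two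
vertices have several points in common exactly if the vertices are adjacent, and then intersect in
the line of the edge.

For combinatorial automorphisms, the lines of `X_k` are the lines of the projective spaces spanned
by the stars of the vertices that meet the affine spaces at these vertices (`isLine_iff`). Such a
line misses at most its point at infinity, and it misses none if and only if this point is some
`e_w`. The lines of this second kind are characterized by the axiom of Veblen and Young together
with the existence of three points (`FullAt.isFull`, `exists_fullAt`). Two of them are joined,
that is, any two of their points are collinear, if they are lines in the affine space at the same
vertex through the same `e_w`. Consequently the points `e_w` are the points on two joined lines of
this kind (`isVertexLike_iff`), adjacency is collinearity, and the rational points of the affine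
space at `u` are recognized from `e_u` and one `e_v` with `v` adjacent to `u`
(`localPart_vertRatPoint`). The dimension of this affine space is determined by its number of
points if `k` is finite, and otherwise by the least number of points that generate it with respect
to the lines (`degree_eq_of_image_ratCell`).
-/

/-! ### Neighbourhoods in the completion, degrees and automorphisms -/

namespace LooseGraph

variable {V E : Type*} {T : LooseGraph V E}

theorem completion_adj_inl_inl {u v : V} :
    T.completion.Adj (.inl u) (.inl v) ↔ T.graph.Adj u v := by
  simp [completion, graph, Inc]

theorem completion_adj_inl_inr {u : V} {a : Σ e : E, Fin (2 - (T.ends e).card)} :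
    T.completion.Adj (.inl u) (.inr a) ↔ u ∈ T.ends a.1 := by
  simp [completion, Inc]

/-- The edges with the same ends are interchangeable, so only their number has to be preserved. -/
theorem exists_auto_of_card_fibers_eq [Finite E] {β : Equiv.Perm V}
    (h : ∀ s : Finset V, Nat.card {e // T.ends e = s} = Nat.card {e // T.ends e = s.map β}) :
    ∃ φ : T.Auto, φ.onVert = β := by
  classical
  have hs : ∀ s : Finset V, Nonempty ({e // T.ends e = s} ≃ {e // T.ends e = s.map β}) :=
    fun s => by
      have := Fintype.ofFinite {e // T.ends e = s}
      have := Fintype.ofFinite {e // T.ends e = s.map β}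
      exact ⟨Fintype.equivOfCardEq (by simpa only [Nat.card_eq_fintype_card] using h s)⟩
  have F := fun s => (hs s).some
  let ψ : E ≃ E := (Equiv.sigmaFiberEquiv T.ends).symm.trans
    ((Equiv.sigmaCongr (Equiv.finsetCongr β) fun s => F s).trans (Equiv.sigmaFiberEquiv T.ends))
  have hψ : ∀ e, T.ends (ψ e) = (T.ends e).map β := fun e => (F (T.ends e) ⟨e, rfl⟩).2
  refine ⟨⟨β, ψ, fun v e => ?_⟩, rfl⟩
  rw [hψ]
  simp

namespace IsLooseTree

variable (hT : T.IsLooseTree)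
include hT

theorem card_eq_one (a : Σ e : E, Fin (2 - (T.ends e).card)) : (T.ends a.1).card = 1 := by
  have h1 := (hT.ends_nonempty a.1).card_pos
  have h2 := a.2.2
  omega

theorem not_triangle {u v w : V} (h1 : T.graph.Adj u v) (h2 : T.graph.Adj v w)
    (h3 : T.graph.Adj u w) : False := by
  have hp := (SimpleGraph.isAcyclic_iff_subsingleton_path.mp hT.isTree.isAcyclic u w).elim
    (⟨.cons h1 (.cons h2 .nil), by simp [h1.ne, h2.ne, h3.ne]⟩ : T.graph.Path u w)
    ⟨.cons h3 .nil, by simp [h3.ne]⟩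
  have := congrArg (fun p : T.graph.Path u w => p.1.length) hp
  simp at this

theorem eq_of_common_adj {u w a b : V} (huw : u ≠ w) (h1 : T.graph.Adj u a)
    (h2 : T.graph.Adj w a) (h3 : T.graph.Adj u b) (h4 : T.graph.Adj w b) : a = b := by
  have hp := (SimpleGraph.isAcyclic_iff_subsingleton_path.mp hT.isTree.isAcyclic u w).elim
    (⟨.cons h1 (.cons h2.symm .nil), by simp [h1.ne, h2.ne', huw]⟩ : T.graph.Path u w)
    ⟨.cons h3 (.cons h4.symm .nil), by simp [h3.ne, h4.ne', huw]⟩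
  have := congrArg (fun p : T.graph.Path u w => p.1.support) hp
  simpa using this

theorem eq_of_adj_inr {u v : V} {a : Σ e : E, Fin (2 - (T.ends e).card)}
    (h1 : T.completion.Adj (.inl u) (.inr a)) (h2 : T.completion.Adj (.inl v) (.inr a)) :
    u = v :=
  Finset.card_le_one.mp (hT.card_eq_one a).le _ (completion_adj_inl_inr.mp h1) _
    (completion_adj_inl_inr.mp h2)

/-- Adjacent vertices have no common neighbour in the completion. -/
theorem not_common_adj {u v : V} (huv : T.graph.Adj u v) {a : T.CompVert}
    (h1 : T.completion.Adj (.inl u) a) (h2 : T.completion.Adj (.inl v) a) : False := by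
  rcases a with w | a
  · exact hT.not_triangle huv (completion_adj_inl_inl.mp h2) (completion_adj_inl_inl.mp h1)
  · exact huv.ne (hT.eq_of_adj_inr h1 h2)

/-- Distinct vertices have at most one common neighbour in the completion, and it is a vertex. -/
theorem eq_inl_of_common_adj {u w : V} (huw : u ≠ w) {a : T.CompVert}
    (h1 : T.completion.Adj (.inl u) a) (h2 : T.completion.Adj (.inl w) a) :
    ∃ v, a = .inl v ∧ T.graph.Adj u v ∧ T.graph.Adj w v := by
  rcases a with v | a
  · exact ⟨v, rfl, completion_adj_inl_inl.mp h1, completion_adj_inl_inl.mp h2⟩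
  · exact absurd (hT.eq_of_adj_inr h1 h2) huw

end IsLooseTree

/-- The closed neighbourhood of a vertex of `T` in the completion. -/
def star (T : LooseGraph V E) (u : V) : Set T.CompVert :=
  {a | a = .inl u ∨ T.completion.Adj (.inl u) a}

theorem inl_mem_star_self (u : V) : Sum.inl u ∈ T.star u := Or.inl rfl

theorem inl_mem_star {u v : V} : Sum.inl v ∈ T.star u ↔ v = u ∨ T.graph.Adj u v := by
  simp [star, completion_adj_inl_inl]

namespace IsLooseTree

variable (hT : T.IsLooseTree)
include hT

theorem mem_star_inter_of_adj {u v : V} (huv : T.graph.Adj u v) {a : T.CompVert}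
    (h1 : a ∈ T.star u) (h2 : a ∈ T.star v) : a = .inl u ∨ a = .inl v := by
  rcases h1 with h1 | h1
  · exact .inl h1
  rcases h2 with h2 | h2
  · exact .inr h2
  exact (hT.not_common_adj huv h1 h2).elim

theorem mem_star_inter_of_not_adj {u w : V} (huw : u ≠ w) (hn : ¬ T.graph.Adj u w)
    {a : T.CompVert} (h1 : a ∈ T.star u) (h2 : a ∈ T.star w) :
    ∃ v, a = .inl v ∧ T.graph.Adj u v ∧ T.graph.Adj w v := by
  rcases h1 with rfl | h1
  · rcases inl_mem_star.mp h2 with h2 | h2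
    · exact absurd h2 huw
    · exact absurd h2.symm hn
  rcases h2 with rfl | h2
  · exact absurd (completion_adj_inl_inl.mp h1) hn
  exact hT.eq_inl_of_common_adj huw h1 h2

/-- The degree of a vertex is the number of its neighbours in the completion. -/
theorem degree_eq (u : V) :
    T.degree u = {a | T.completion.Adj (Sum.inl u) a}.ncard := by
  symm
  have key : ∀ a b : T.CompVert, ∀ e, a ≠ .inl u → b ≠ .inl u → u ∈ T.ends e →
      T.Inc a e → T.Inc b e → a = b := by
    classical
    rintro (v | ⟨e', i⟩) (w | ⟨e'', j⟩) e ha hb hu hae hbe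
    · have hc := T.card_ends_le e
      by_contra hne
      have h3 : ({u, v, w} : Finset V).card = 3 := by
        rw [Finset.card_eq_three]
        exact ⟨u, v, w, fun h => ha (by rw [h]), fun h => hb (by rw [h]),
          fun h => hne (by rw [h]), rfl⟩
      have : ({u, v, w} : Finset V) ⊆ T.ends e := by
        intro x hx
        simp only [Finset.mem_insert, Finset.mem_singleton] at hx
        rcases hx with rfl | rfl | rfl
        exacts [hu, hae, hbe]
      have := Finset.card_le_card this
      omega
    · obtain rfl : e'' = e := hbe
      exact absurd (Finset.card_le_one.mp (hT.card_eq_one ⟨e'', j⟩).le _ hae _ hu)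
        fun h => ha (by rw [h])
    · obtain rfl : e' = e := hae
      exact absurd (Finset.card_le_one.mp (hT.card_eq_one ⟨e', i⟩).le _ hbe _ hu)
        fun h => hb (by rw [h])
    · obtain rfl : e' = e := hae
      obtain rfl : e'' = e' := hbe
      have := hT.card_eq_one ⟨e'', i⟩
      have h1 := i.2
      have h2 := j.2
      simp only at this
      congr 2
      ext
      omega
  refine Set.ncard_congr (fun a ha => ha.2.choose) (fun a ha => ha.2.choose_spec.1) ?_ ?_
  · intro a b ha hb hab
    refine key a b _ ha.1.symm hb.1.symm ha.2.choose_spec.1 ha.2.choose_spec.2 ?_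
    rw [hab]
    exact hb.2.choose_spec.2
  · intro e he
    change u ∈ T.ends e at he
    rcases Nat.lt_or_ge (T.ends e).card 2 with h | h
    · have ha : T.completion.Adj (.inl u) (.inr ⟨e, ⟨0, by omega⟩⟩) :=
        completion_adj_inl_inr.mpr he
      exact ⟨_, ha, ha.2.choose_spec.2.symm⟩
    · obtain ⟨v, hv, hvu⟩ := Finset.exists_mem_ne h u
      have ha : T.completion.Adj (.inl u) (.inl v) :=
        completion_adj_inl_inl.mpr ⟨hvu.symm, e, he, hv⟩
      refine ⟨_, ha, (hT.eq_of_ends_eq _ _ (le_antisymm (T.card_ends_le e) h) ?_).symm⟩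
      classical
      have h1 : ({u, v} : Finset V) = T.ends e :=
        Finset.eq_of_subset_of_card_le (by
          intro x hx
          simp only [Finset.mem_insert, Finset.mem_singleton] at hx
          rcases hx with rfl | rfl
          exacts [he, hv]) (by rw [Finset.card_pair hvu.symm]; exact T.card_ends_le e)
      have h2 : ({u, v} : Finset V) = T.ends ha.2.choose :=
        Finset.eq_of_subset_of_card_le (by
          intro x hx
          simp only [Finset.mem_insert, Finset.mem_singleton] at hx
          rcases hx with rfl | rfl
          exacts [ha.2.choose_spec.1, ha.2.choose_spec.2])
          (by rw [Finset.card_pair hvu.symm]; exact T.card_ends_le _)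
      rw [← h1, h2]

variable [Finite V] [Finite E]

theorem mem_inner_iff {u : V} :
    u ∈ T.inner ↔ ∃ a b, a ≠ b ∧ T.completion.Adj (.inl u) a ∧ T.completion.Adj (.inl u) b := by
  rw [inner, Set.mem_ofPred_eq, hT.degree_eq u, ← Nat.lt_iff_add_one_le,
    Set.one_lt_ncard_iff]
  constructor
  · rintro ⟨a, b, ha, hb, hab⟩; exact ⟨a, b, hab, ha, hb⟩
  · rintro ⟨a, b, hab, ha, hb⟩; exact ⟨a, b, ha, hb, hab⟩

theorem exists_ne_adj {u : V} (hu : u ∈ T.inner) (w : T.CompVert) :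
    ∃ a, a ≠ w ∧ T.completion.Adj (.inl u) a := by
  obtain ⟨a, b, hab, ha, hb⟩ := hT.mem_inner_iff.mp hu
  by_cases h : a = w
  · exact ⟨b, fun h' => hab (h.trans h'.symm), hb⟩
  · exact ⟨a, h, ha⟩

theorem exists_inner_adj (hI : 2 ≤ T.inner.ncard) (v : V) : ∃ u ∈ T.inner, T.graph.Adj v u := by
  obtain ⟨w, hw, hwv⟩ : ∃ w ∈ T.inner, w ≠ v :=
    Set.exists_ne_of_one_lt_ncard (by omega) v
  obtain ⟨p, hp⟩ := hT.isTree.connected.preconnected.exists_isPath v w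
  cases p with
  | nil => exact absurd rfl hwv
  | cons h q =>
    rename_i u
    refine ⟨u, ?_, h⟩
    cases q with
    | nil => exact hw
    | cons h' q' =>
      rename_i x
      refine hT.mem_inner_iff.mpr ⟨.inl v, .inl x, ?_, completion_adj_inl_inl.mpr h.symm,
        completion_adj_inl_inl.mpr h'⟩
      rintro h0
      obtain rfl := Sum.inl.inj h0
      simp at hp

theorem eq_of_not_inner {u : V} (hu : u ∉ T.inner) {a b : T.CompVert}
    (ha : T.completion.Adj (.inl u) a) (hb : T.completion.Adj (.inl u) b) : a = b := by
  by_contra hab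
  exact hu (hT.mem_inner_iff.mpr ⟨a, b, hab, ha, hb⟩)

/-- The star of a vertex that is not inner lies in the star of an inner vertex. -/
theorem exists_star_subset (hI : 2 ≤ T.inner.ncard) (v : V) :
    ∃ u ∈ T.inner, T.star v ⊆ T.star u ∧ (u = v ∨ T.graph.Adj u v) := by
  by_cases hv : v ∈ T.inner
  · exact ⟨v, hv, subset_rfl, .inl rfl⟩
  obtain ⟨u, hu, hvu⟩ := hT.exists_inner_adj hI v
  refine ⟨u, hu, ?_, .inr hvu.symm⟩
  rintro a (rfl | ha)
  · exact inl_mem_star.mpr (.inr hvu.symm)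
  · rw [hT.eq_of_not_inner hv ha (completion_adj_inl_inl.mpr hvu)]
    exact inl_mem_star_self u

theorem eq_of_star_subset {u w : V} (hw : w ∈ T.inner) (h : T.star w ⊆ T.star u) : u = w := by
  by_contra huw
  obtain ⟨a, b, hab, ha, hb⟩ := hT.mem_inner_iff.mp hw
  by_cases hadj : T.graph.Adj u w
  · have h1 := hT.mem_star_inter_of_adj hadj (h (.inr ha)) (.inr ha)
    have h2 := hT.mem_star_inter_of_adj hadj (h (.inr hb)) (.inr hb)
    grind [SimpleGraph.irrefl]
  · obtain ⟨x, h1, -, -⟩ := hT.mem_star_inter_of_not_adj huw hadj (h (.inl rfl)) (.inl rfl)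
    obtain ⟨_, h2, h3, -⟩ := hT.mem_star_inter_of_not_adj huw hadj (h (.inl rfl)) (.inl rfl)
    rw [← Sum.inl.inj h2] at h3
    exact hadj h3

omit [Finite V] in
/-- An automorphism of the underlying graph that preserves the degrees in `T` preserves the number
of loose edges at each vertex, and so extends to the edges of `T`. -/
theorem exists_auto_of_degree_eq {β : Equiv.Perm V}
    (hadj : ∀ u v, T.graph.Adj (β u) (β v) ↔ T.graph.Adj u v)
    (hdeg : ∀ v, T.degree (β v) = T.degree v) : ∃ φ : T.Auto, φ.onVert = β := by
  classical
  have hpair : ∀ {u e}, (T.ends e).card = 2 → u ∈ T.ends e →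
      ∃ v, u ≠ v ∧ T.ends e = {u, v} := by
    intro u e h hu
    obtain ⟨x, y, hxy, hxe⟩ := Finset.card_eq_two.mp h
    rw [hxe] at hu
    simp only [Finset.mem_insert, Finset.mem_singleton] at hu
    rcases hu with rfl | rfl
    · exact ⟨y, hxy, hxe⟩
    · exact ⟨x, hxy.symm, by rw [hxe, Finset.pair_comm]⟩
  have hends : ∀ {u v e}, u ≠ v → u ∈ T.ends e → v ∈ T.ends e → T.ends e = {u, v} := by
    intro u v e huv hu hv
    refine (Finset.eq_of_subset_of_card_le (fun x hx => ?_) ?_).symm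
    · simp only [Finset.mem_insert, Finset.mem_singleton] at hx
      rcases hx with rfl | rfl
      exacts [hu, hv]
    · rw [Finset.card_pair huv]; exact T.card_ends_le _
  have hcard2 : ∀ u v, u ≠ v → Nat.card {e // T.ends e = {u, v}} =
      if T.graph.Adj u v then 1 else 0 := by
    intro u v huv
    split_ifs with h
    · obtain ⟨-, e, hu, hv⟩ := h
      rw [Nat.card_eq_one_iff_unique]
      refine ⟨⟨fun e₁ e₂ => Subtype.ext (hT.eq_of_ends_eq _ _ ?_ (e₁.2.trans e₂.2.symm))⟩,
        ⟨e, hends huv hu hv⟩⟩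
      rw [e₁.2, Finset.card_pair huv]
    · rw [Nat.card_eq_zero]
      left
      refine ⟨fun e => h ⟨huv, e.1, ?_, ?_⟩⟩ <;> rw [e.2] <;> simp
  have hcard1 : ∀ u, Nat.card {e // T.ends e = {u}} + {v | T.graph.Adj u v}.ncard
      = T.degree u := by
    intro u
    have h1 : {v | T.graph.Adj u v}.ncard = {e | u ∈ T.ends e ∧ (T.ends e).card = 2}.ncard := by
      refine Set.ncard_congr (fun v hv => hv.2.choose) ?_ ?_ ?_
      · intro v hv
        refine ⟨hv.2.choose_spec.1, ?_⟩
        rw [hends hv.1 hv.2.choose_spec.1 hv.2.choose_spec.2, Finset.card_pair hv.1]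
      · intro v w hv hw hvw
        have a1 := hends hv.1 hv.2.choose_spec.1 hv.2.choose_spec.2
        have a2 := hw.2.choose_spec.2
        rw [← hvw, a1] at a2
        simp only [Finset.mem_insert, Finset.mem_singleton] at a2
        exact (a2.resolve_left hw.1.symm).symm
      · rintro e ⟨hu, he⟩
        obtain ⟨v, huv, hev⟩ := hpair he hu
        have hv : T.graph.Adj u v := ⟨huv, e, hu, by rw [hev]; simp⟩
        refine ⟨v, hv, (hT.eq_of_ends_eq _ _ he ?_).symm⟩
        rw [hev, hends huv hv.2.choose_spec.1 hv.2.choose_spec.2]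
    have h2 : Nat.card {e // T.ends e = {u}} = {e | T.ends e = {u}}.ncard := rfl
    rw [h1, h2, degree, ← Set.ncard_union_eq]
    · congr 1
      ext e
      simp only [Set.mem_union, Set.mem_ofPred_eq]
      constructor
      · rintro (h | h)
        · rw [h]; simp
        · exact h.1
      · intro h
        have h1 := T.card_ends_le e
        have h3 := Finset.card_pos.mpr ⟨u, h⟩
        rcases Nat.lt_or_ge (T.ends e).card 2 with h2 | h2
        · left
          rw [Finset.card_eq_one.mp (by omega : (T.ends e).card = 1) |>.choose_spec] at h ⊢
          rw [Finset.mem_singleton.mp h]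
        · exact .inr ⟨h, by omega⟩
    · rw [Set.disjoint_left]
      rintro e h1 ⟨-, h2⟩
      rw [Set.mem_ofPred_eq] at h1
      rw [h1] at h2
      simp at h2
  apply exists_auto_of_card_fibers_eq
  intro s
  have hs : s.card = (s.map (β : V ↪ V)).card := by simp
  rcases Nat.lt_or_ge s.card 3 with h3 | h3
  · obtain h0 | h1 | h2 : s.card = 0 ∨ s.card = 1 ∨ s.card = 2 := by omega
    · have : ∀ s : Finset V, s.card = 0 → Nat.card {e // T.ends e = s} = 0 := by
        intro s hs
        rw [Nat.card_eq_zero]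
        left
        refine ⟨fun e => ?_⟩
        have := (hT.ends_nonempty e.1).card_pos
        rw [e.2, hs] at this
        omega
      rw [this _ h0, this _ (hs ▸ h0)]
    · obtain ⟨u, rfl⟩ := Finset.card_eq_one.mp h1
      have h1 := hcard1 u
      have h2 := hcard1 (β u)
      have h3 : {v | T.graph.Adj (β u) v} = β '' {v | T.graph.Adj u v} := by
        ext v
        simp only [Set.mem_ofPred_eq, Equiv.image_eq_preimage_symm, Set.mem_preimage]
        rw [← hadj u, Equiv.apply_symm_apply]
      rw [h3, Set.ncard_image_of_injective _ β.injective, hdeg] at h2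
      simp only [Finset.map_singleton, Equiv.coe_toEmbedding]
      omega
    · obtain ⟨u, v, huv, rfl⟩ := Finset.card_eq_two.mp h2
      simp only [Finset.map_insert, Finset.map_singleton, Equiv.coe_toEmbedding]
      rw [hcard2 _ _ huv, hcard2 _ _ (β.injective.ne huv)]
      simp [hadj]
  · have : ∀ s : Finset V, 3 ≤ s.card → Nat.card {e // T.ends e = s} = 0 := by
      intro s hs
      rw [Nat.card_eq_zero]
      left
      refine ⟨fun e => ?_⟩
      have := T.card_ends_le e.1
      rw [e.2] at this
      omega
    rw [this _ h3, this _ (hs ▸ h3)]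

end IsLooseTree

end LooseGraph

/-! ### Points of projective space with coordinates in a domain -/

section ProjectivePoints

variable {σ k : Type*} [Field k]

namespace ProjectiveSpectrum

theorem le_iff_forall_isHomogeneous {p q : ProjectiveSpectrum (polyGrading σ k)} :
    p ≤ q ↔ ∀ (n : ℕ) (f : MvPolynomial σ k), f.IsHomogeneous n →
      f ∈ p.asHomogeneousIdeal → f ∈ q.asHomogeneousIdeal := by
  refine ⟨fun h n f _ hf => h hf, fun h f hf => ?_⟩
  rw [← MvPolynomial.sum_homogeneousComponent f]
  refine sum_mem fun n _ => h n _ (MvPolynomial.homogeneousComponent_isHomogeneous n f) ?_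
  have := p.asHomogeneousIdeal.isHomogeneous n hf
  rwa [show (DirectSum.decompose (polyGrading σ k) f n : MvPolynomial σ k)
        = MvPolynomial.homogeneousComponent n f from
      MvPolynomial.decomposition.decompose'_apply f n] at this

theorem eq_of_forall_isHomogeneous {p q : ProjectiveSpectrum (polyGrading σ k)}
    (h : ∀ (n : ℕ) (f : MvPolynomial σ k), f.IsHomogeneous n →
      (f ∈ p.asHomogeneousIdeal ↔ f ∈ q.asHomogeneousIdeal)) : p = q :=
  le_antisymm (le_iff_forall_isHomogeneous.mpr fun n f hf => (h n f hf).mp)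
    (le_iff_forall_isHomogeneous.mpr fun n f hf => (h n f hf).mpr)

/-- The variables generate the irrelevant ideal. -/
theorem exists_X_notMem (p : ProjectiveSpectrum (polyGrading σ k)) :
    ∃ a, MvPolynomial.X a ∉ p.asHomogeneousIdeal := by
  by_contra! h
  refine p.not_irrelevant_le fun f hf => ?_
  rw [HomogeneousIdeal.mem_irrelevant_iff, GradedRing.proj_apply,
    show (DirectSum.decompose (polyGrading σ k) f 0 : MvPolynomial σ k)
        = MvPolynomial.homogeneousComponent 0 f from
      MvPolynomial.decomposition.decompose'_apply f 0,
    MvPolynomial.homogeneousComponent_zero, MvPolynomial.C_eq_zero] at hf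
  change f ∈ p.asHomogeneousIdeal.toIdeal
  have h1 : MvPolynomial.idealOfVars σ k ≤ p.asHomogeneousIdeal.toIdeal := by
    rw [MvPolynomial.idealOfVars, Ideal.span_le]
    rintro _ ⟨a, rfl⟩
    exact h a
  refine h1 ?_
  rw [← pow_one (MvPolynomial.idealOfVars σ k), MvPolynomial.mem_pow_idealOfVars_iff]
  intro x hx
  by_contra h0
  have : x = 0 := by
    have : Finsupp.degree x = 0 := by omega
    exact (Finsupp.degree_eq_zero_iff x).mp this
  subst this
  simp at hx
  exact hx hf

end ProjectiveSpectrum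

variable {B : Type*} [CommRing B] [IsDomain B] [Algebra k B]

/-- The ring homomorphism `k[X_a] → B[t]`, `X_a ↦ x_a t`, of a tuple `x` with entries in a
`k`-algebra `B`. -/
noncomputable def evalCone (x : σ → B) : MvPolynomial σ k →ₐ[k] Polynomial B :=
  MvPolynomial.aeval fun a => Polynomial.C (x a) * Polynomial.X

omit [IsDomain B] in
theorem evalCone_of_isHomogeneous (x : σ → B) {f : MvPolynomial σ k} {n : ℕ}
    (hf : f.IsHomogeneous n) :
    evalCone x f = Polynomial.C (MvPolynomial.aeval x f) * Polynomial.X ^ n := by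
  rw [evalCone, MvPolynomial.aeval_def, MvPolynomial.eval₂_eq, MvPolynomial.aeval_def,
    MvPolynomial.eval₂_eq, map_sum, Finset.sum_mul]
  refine Finset.sum_congr rfl fun s hs => ?_
  have hn : ∑ i ∈ s.support, s i = n := by
    rw [← hf (MvPolynomial.mem_support_iff.mp hs), Finsupp.weight_apply, Finsupp.sum]
    simp
  simp only [mul_pow, Finset.prod_mul_distrib, Finset.prod_pow_eq_pow_sum, hn, map_mul, map_prod,
    map_pow, Polynomial.algebraMap_apply]
  ring

omit [IsDomain B] in
theorem MvPolynomial.IsHomogeneous.aeval_mul {f : MvPolynomial σ k} {n : ℕ}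
    (hf : f.IsHomogeneous n) (x : σ → B) (c : B) :
    MvPolynomial.aeval (fun a => c * x a) f = c ^ n * MvPolynomial.aeval x f := by
  have h := congrArg (Polynomial.evalRingHom c) (evalCone_of_isHomogeneous x hf)
  have h2 : (Polynomial.evalRingHom c) (evalCone x f) =
      MvPolynomial.aeval (fun a => c * x a) f := by
    rw [evalCone, MvPolynomial.aeval_def, MvPolynomial.aeval_def, MvPolynomial.hom_eval₂]
    congr 1
    · ext; simp [Polynomial.algebraMap_apply]
    · ext a
      rw [Polynomial.coe_evalRingHom, Polynomial.eval_mul, Polynomial.eval_C, Polynomial.eval_X,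
        mul_comm]
  rw [← h2, h]
  rw [Polynomial.coe_evalRingHom, Polynomial.eval_mul, Polynomial.eval_C, Polynomial.eval_pow,
    Polynomial.eval_X, mul_comm]

/-- The scheme point of projective space given by a point with coordinates `x` in a domain `B`: the
ideal generated by the homogeneous polynomials that vanish at `x`. -/
noncomputable def domPoint (x : σ → B) (hx : x ≠ 0) : ProjectiveSpectrum (polyGrading σ k) where
  asHomogeneousIdeal := ⟨RingHom.ker (evalCone x), by
    intro n f hf
    have hc : ∀ m, (evalCone x f).coeff m
        = MvPolynomial.aeval x (MvPolynomial.homogeneousComponent m f) := by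
      intro m
      conv_lhs => rw [← MvPolynomial.sum_homogeneousComponent f, map_sum]
      simp_rw [evalCone_of_isHomogeneous x (MvPolynomial.homogeneousComponent_isHomogeneous _ f)]
      simp only [Polynomial.finsetSum_coeff, Polynomial.coeff_C_mul_X_pow]
      rw [Finset.sum_ite_eq]
      split_ifs with h
      · rfl
      · rw [MvPolynomial.homogeneousComponent_eq_zero, map_zero]
        simpa using h
    have hd : (DirectSum.decompose (polyGrading σ k) f n : MvPolynomial σ k)
        = MvPolynomial.homogeneousComponent n f :=
      MvPolynomial.decomposition.decompose'_apply f n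
    change evalCone x _ = 0
    rw [hd, evalCone_of_isHomogeneous x (MvPolynomial.homogeneousComponent_isHomogeneous n f),
      ← hc n, show evalCone x f = 0 from hf]
    simp⟩
  isPrime := RingHom.ker_isPrime _
  not_irrelevant_le := by
    obtain ⟨a, ha⟩ := Function.ne_iff.mp hx
    intro h
    have hX : (MvPolynomial.X a : MvPolynomial σ k) ∈
        HomogeneousIdeal.irrelevant (polyGrading σ k) :=
      HomogeneousIdeal.mem_irrelevant_of_mem _ one_pos (MvPolynomial.isHomogeneous_X k a)
    have h0 : evalCone x (MvPolynomial.X a) = 0 := h hX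
    simp [evalCone] at h0
    exact ha h0

theorem mem_domPoint_iff {x : σ → B} {hx : x ≠ 0} {f : MvPolynomial σ k} {n : ℕ}
    (hf : f.IsHomogeneous n) :
    f ∈ (domPoint x hx : ProjectiveSpectrum (polyGrading σ k)).asHomogeneousIdeal ↔
      MvPolynomial.aeval x f = 0 := by
  change evalCone x f = 0 ↔ _
  rw [evalCone_of_isHomogeneous x hf]
  generalize MvPolynomial.aeval x f = b
  simp [(Polynomial.monic_X_pow n).mul_left_eq_zero_iff]

theorem X_mem_domPoint_iff {x : σ → B} {hx : x ≠ 0} {a : σ} :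
    MvPolynomial.X a ∈ (domPoint x hx : ProjectiveSpectrum (polyGrading σ k)).asHomogeneousIdeal
      ↔ x a = 0 := by
  rw [mem_domPoint_iff (MvPolynomial.isHomogeneous_X k a), MvPolynomial.aeval_X]

theorem mem_ratPoint_iff {x : σ → k} {hx : x ≠ 0} {f : MvPolynomial σ k} {n : ℕ}
    (hf : f.IsHomogeneous n) :
    f ∈ (ratPoint x hx).asHomogeneousIdeal ↔ MvPolynomial.eval x f = 0 := by
  change evalLine x f = 0 ↔ _
  rw [evalLine_of_isHomogeneous x hf]
  simp [(Polynomial.monic_X_pow n).mul_left_eq_zero_iff]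

theorem aeval_mk_X (p : ProjectiveSpectrum (polyGrading σ k)) (f : MvPolynomial σ k) :
    MvPolynomial.aeval
      (fun a => Ideal.Quotient.mk p.asHomogeneousIdeal.toIdeal (MvPolynomial.X a)) f =
      Ideal.Quotient.mk p.asHomogeneousIdeal.toIdeal f := by
  have : (MvPolynomial.aeval
      (fun a => Ideal.Quotient.mk p.asHomogeneousIdeal.toIdeal (MvPolynomial.X a))) =
      Ideal.Quotient.mkₐ k p.asHomogeneousIdeal.toIdeal := by
    ext a; simp
  rw [this]; rfl

/-- The only point at which all linear forms vanishing at `b` vanish is the point `[b]`. -/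
theorem eq_ratPoint {p : ProjectiveSpectrum (polyGrading σ k)} {b : σ → k} (hb : b ≠ 0)
    (h : ∀ a i, MvPolynomial.C (b i) * MvPolynomial.X a - MvPolynomial.C (b a) * MvPolynomial.X i
      ∈ p.asHomogeneousIdeal) : p = ratPoint b hb := by
  have := p.isPrime
  obtain ⟨i, hi⟩ := Function.ne_iff.mp hb
  set m := Ideal.Quotient.mk p.asHomogeneousIdeal.toIdeal with hm
  set c := algebraMap k _ (b i)⁻¹ * m (MvPolynomial.X i) with hcdef
  have hC : ∀ t : k, m (MvPolynomial.C t) = algebraMap k _ t := fun t => rfl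
  have hx : ∀ a, m (MvPolynomial.X a) = c * algebraMap k _ (b a) := by
    intro a
    have h1 : m (MvPolynomial.C (b i) * MvPolynomial.X a
        - MvPolynomial.C (b a) * MvPolynomial.X i) = 0 :=
      Ideal.Quotient.eq_zero_iff_mem.mpr (h a i)
    rw [map_sub, map_mul, map_mul, hC, hC, sub_eq_zero] at h1
    have h2 := congrArg (algebraMap k _ (b i)⁻¹ * ·) h1
    simp only [← mul_assoc, ← map_mul, inv_mul_cancel₀ hi, map_one, one_mul] at h2
    rw [h2, hcdef, map_mul]; ring
  have hc : c ≠ 0 := by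
    intro hc
    obtain ⟨a, ha⟩ := p.exists_X_notMem
    apply ha
    have := hx a
    rw [hc, zero_mul] at this
    exact Ideal.Quotient.eq_zero_iff_mem.mp this
  refine ProjectiveSpectrum.eq_of_forall_isHomogeneous fun n f hf => ?_
  rw [mem_ratPoint_iff hf]
  have h1 := aeval_mk_X p f
  rw [← hm] at h1
  simp only [hx] at h1
  rw [hf.aeval_mul] at h1
  have h2 : MvPolynomial.aeval (fun a => algebraMap k (_ ⧸ p.asHomogeneousIdeal.toIdeal) (b a)) f
      = algebraMap k _ (MvPolynomial.eval b f) := by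
    rw [← MvPolynomial.coe_aeval_eq_eval]
    exact (MvPolynomial.aeval_algebraMap_apply _ _ _)
  rw [h2] at h1
  rw [← (algebraMap k (_ ⧸ p.asHomogeneousIdeal.toIdeal)).injective.eq_iff, map_zero]
  have h3 : f ∈ p.asHomogeneousIdeal ↔ m f = 0 := Ideal.Quotient.eq_zero_iff_mem.symm
  rw [h3, ← h1]
  simp [hc]

end ProjectivePoints

/-! ### Affine cells of projective space -/

section AffineCell

open MvPolynomial

variable {σ k : Type*} [Field k] {u : σ} {N : Set σ}

/-- The points of projective space at which the coordinate `X_u` does not vanish, and at which all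
other coordinates with an index outside `N` vanish. -/
def affineCell (k : Type*) [Field k] (u : σ) (N : Set σ) :
    Set (ProjectiveSpectrum (polyGrading σ k)) :=
  {p | X u ∉ p.asHomogeneousIdeal ∧ ∀ a, a ≠ u → a ∉ N → X a ∈ p.asHomogeneousIdeal}

open Classical in
/-- The affine coordinate functions on `affineCell k u N`: `X_a / X_u` on that cell. -/
noncomputable def dehomVal (k : Type*) [Field k] (u : σ) (N : Set σ) (a : σ) : MvPolynomial N k :=
  if a = u then 1 else if h : a ∈ N then X ⟨a, h⟩ else 0

/-- Dehomogenization on `affineCell k u N`. -/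
noncomputable def dehom (k : Type*) [Field k] (u : σ) (N : Set σ) :
    MvPolynomial σ k →ₐ[k] MvPolynomial N k :=
  aeval (dehomVal k u N)

theorem dehom_X_self : dehom k u N (X u) = 1 := by simp [dehom, dehomVal]

theorem dehom_X_of_mem (hu : u ∉ N) (a : N) : dehom k u N (X a) = X a := by
  have : (a : σ) ≠ u := fun h => hu (h ▸ a.2)
  simp [dehom, dehomVal, this]

theorem dehom_X_of_notMem {a : σ} (h1 : a ≠ u) (h2 : a ∉ N) : dehom k u N (X a) = 0 := by
  simp [dehom, dehomVal, h1, h2]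

theorem exists_dehom_eq (hu : u ∉ N) (F : MvPolynomial N k) :
    ∃ (n : ℕ) (f : MvPolynomial σ k), f.IsHomogeneous n ∧ dehom k u N f = F := by
  induction F using MvPolynomial.induction_on with
  | C c => exact ⟨0, C c, isHomogeneous_C _ _, by simp [dehom]⟩
  | add F G hF hG =>
    obtain ⟨n, f, hf, rfl⟩ := hF
    obtain ⟨m, g, hg, rfl⟩ := hG
    refine ⟨m + n, X u ^ m * f + X u ^ n * g, ?_, by simp [dehom_X_self]⟩
    have h1 := ((isHomogeneous_X k u).pow m).mul hf
    have h2 := ((isHomogeneous_X k u).pow n).mul hg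
    rw [one_mul] at h1 h2
    exact h1.add (add_comm n m ▸ h2)
  | mul_X F a hF =>
    obtain ⟨n, f, hf, rfl⟩ := hF
    exact ⟨n + 1, f * X (a : σ), hf.mul (isHomogeneous_X k _), by rw [map_mul, dehom_X_of_mem hu]⟩

theorem totalDegree_dehom_le {f : MvPolynomial σ k} {n : ℕ} (hf : f.IsHomogeneous n) :
    (dehom k u N f).totalDegree ≤ n := by
  rw [dehom, aeval_def, eval₂_eq]
  refine totalDegree_finsetSum_le fun s hs => ?_
  have hn : ∑ i ∈ s.support, s i = n := by
    rw [← hf (mem_support_iff.mp hs), Finsupp.weight_apply, Finsupp.sum]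
    simp
  refine (totalDegree_mul _ _).trans ?_
  rw [algebraMap_eq, totalDegree_C, zero_add, ← hn]
  refine (totalDegree_finsetProd _ _).trans (Finset.sum_le_sum fun i _ => ?_)
  refine (totalDegree_pow _ _).trans ?_
  have : (dehomVal k u N i).totalDegree ≤ 1 := by
    unfold dehomVal
    split_ifs <;> simp
  simpa using Nat.mul_le_mul_left (s i) this

theorem dehomVal_quotient_ne_zero (Q : PrimeSpectrum (MvPolynomial N k)) :
    (fun a => Ideal.Quotient.mk Q.asIdeal (dehomVal k u N a)) ≠ 0 := by
  intro h
  have := congrFun h u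
  simp [dehomVal] at this

/-- The point of the cell that belongs to a prime ideal of its coordinate ring. -/
noncomputable def cellPoint (u : σ) (Q : PrimeSpectrum (MvPolynomial N k)) :
    ProjectiveSpectrum (polyGrading σ k) :=
  domPoint (B := MvPolynomial N k ⧸ Q.asIdeal) _ (dehomVal_quotient_ne_zero (u := u) Q)

theorem mem_cellPoint_iff {Q : PrimeSpectrum (MvPolynomial N k)} {f : MvPolynomial σ k} {n : ℕ}
    (hf : f.IsHomogeneous n) :
    f ∈ (cellPoint u Q).asHomogeneousIdeal ↔ dehom k u N f ∈ Q.asIdeal := by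
  rw [cellPoint, mem_domPoint_iff hf, ← Ideal.Quotient.eq_zero_iff_mem]
  have : (aeval fun a => Ideal.Quotient.mk Q.asIdeal (dehomVal k u N a)) =
      (Ideal.Quotient.mkₐ k Q.asIdeal).comp (dehom k u N) := by
    ext a; simp [dehom]
  rw [this]; rfl

theorem cellPoint_mem (Q : PrimeSpectrum (MvPolynomial N k)) :
    cellPoint u Q ∈ affineCell k u N := by
  refine ⟨?_, fun a h1 h2 => ?_⟩
  · rw [mem_cellPoint_iff (isHomogeneous_X k u), dehom_X_self, ← Ideal.eq_top_iff_one]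
    exact Q.2.ne_top
  · rw [mem_cellPoint_iff (isHomogeneous_X k a), dehom_X_of_notMem h1 h2]
    exact zero_mem _

/-- The residue class of `X_a / X_u` in the residue field at a point of projective space. -/
noncomputable def ratio (p : ProjectiveSpectrum (polyGrading σ k)) (u a : σ) :
    FractionRing (MvPolynomial σ k ⧸ p.asHomogeneousIdeal.toIdeal) :=
  algebraMap _ _ (Ideal.Quotient.mk p.asHomogeneousIdeal.toIdeal (X a)) /
    algebraMap _ _ (Ideal.Quotient.mk p.asHomogeneousIdeal.toIdeal (X u))

/-- The prime ideal of the coordinate ring of the cell that belongs to a point of the cell. -/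
noncomputable def cellPrime (N : Set σ) (u : σ) (p : ProjectiveSpectrum (polyGrading σ k)) :
    PrimeSpectrum (MvPolynomial N k) :=
  have := p.isPrime
  ⟨RingHom.ker (aeval (R := k) fun a : N => ratio p u a), RingHom.ker_isPrime _⟩

theorem dehom_mem_cellPrime_iff {p : ProjectiveSpectrum (polyGrading σ k)}
    (hp : p ∈ affineCell k u N) (hu : u ∉ N) {f : MvPolynomial σ k} {n : ℕ}
    (hf : f.IsHomogeneous n) :
    dehom k u N f ∈ (cellPrime N u p).asIdeal ↔ f ∈ p.asHomogeneousIdeal := by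
  have := p.isPrime
  set K := FractionRing (MvPolynomial σ k ⧸ p.asHomogeneousIdeal.toIdeal)
  set m := Ideal.Quotient.mk p.asHomogeneousIdeal.toIdeal with hm
  have hmem : ∀ g : MvPolynomial σ k, g ∈ p.asHomogeneousIdeal ↔ algebraMap _ K (m g) = 0 := by
    intro g
    rw [(IsFractionRing.injective _ K).eq_iff' (map_zero _)]
    exact Ideal.Quotient.eq_zero_iff_mem.symm
  have hXu : algebraMap _ K (m (X u)) ≠ 0 := fun h => hp.1 ((hmem _).mpr h)
  have h1 : aeval (R := k) (fun a : N => ratio p u a) (dehom k u N f) =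
      aeval (R := k) (fun a => ratio p u a) f := by
    have : (aeval (R := k) (fun a : N => ratio p u a)).comp (dehom k u N) =
        aeval (R := k) (fun a => ratio p u a) := by
      ext a
      rw [AlgHom.comp_apply, aeval_X]
      by_cases h1 : a = u
      · subst h1
        rw [dehom_X_self, map_one, ratio, div_self hXu]
      by_cases h2 : a ∈ N
      · rw [dehom_X_of_mem hu ⟨a, h2⟩, aeval_X]
      · rw [dehom_X_of_notMem h1 h2, map_zero, ratio, (hmem _).mp (hp.2 a h1 h2), zero_div]
    rw [← this]; rfl
  have h2 : algebraMap _ K (m f) = (algebraMap _ K (m (X u))) ^ n *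
      aeval (R := k) (fun a => ratio p u a) f := by
    rw [← hf.aeval_mul, ← aeval_mk_X]
    rw [← aeval_algebraMap_apply]
    congr 2
    ext a
    rw [ratio, mul_div_cancel₀ _ hXu]
    rfl
  change aeval (R := k) (fun a : N => ratio p u a) (dehom k u N f) = 0 ↔ _
  rw [h1, hmem, h2]
  simp [hXu]

theorem cellPrime_le_iff {p q : ProjectiveSpectrum (polyGrading σ k)}
    (hp : p ∈ affineCell k u N) (hq : q ∈ affineCell k u N) (hu : u ∉ N) :
    cellPrime N u p ≤ cellPrime N u q ↔ p ≤ q := by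
  rw [ProjectiveSpectrum.le_iff_forall_isHomogeneous]
  constructor
  · intro h n f hf hfp
    rw [← dehom_mem_cellPrime_iff hq hu hf]
    exact h ((dehom_mem_cellPrime_iff hp hu hf).mpr hfp)
  · intro h F hF
    obtain ⟨n, f, hf, rfl⟩ := exists_dehom_eq hu F
    exact (dehom_mem_cellPrime_iff hq hu hf).mpr
      (h n f hf ((dehom_mem_cellPrime_iff hp hu hf).mp hF))

theorem cellPrime_cellPoint (hu : u ∉ N) (Q : PrimeSpectrum (MvPolynomial N k)) :
    cellPrime N u (cellPoint u Q) = Q := by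
  ext F
  obtain ⟨n, f, hf, rfl⟩ := exists_dehom_eq hu F
  rw [dehom_mem_cellPrime_iff (cellPoint_mem Q) hu hf, mem_cellPoint_iff hf]

theorem cellPoint_cellPrime (hu : u ∉ N) {p : ProjectiveSpectrum (polyGrading σ k)}
    (hp : p ∈ affineCell k u N) : cellPoint u (cellPrime N u p) = p :=
  ProjectiveSpectrum.eq_of_forall_isHomogeneous fun n f hf => by
    rw [mem_cellPoint_iff hf, dehom_mem_cellPrime_iff hp hu hf]

theorem cellPoint_le_iff (hu : u ∉ N) {Q : PrimeSpectrum (MvPolynomial N k)}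
    {q : ProjectiveSpectrum (polyGrading σ k)} (hq : q ∈ affineCell k u N) :
    cellPoint u Q ≤ q ↔ Q ≤ cellPrime N u q := by
  rw [← cellPrime_le_iff (cellPoint_mem Q) hq hu, cellPrime_cellPoint hu]

end AffineCell

/-! ### Lines in affine space and their points at infinity -/

section Curves

open MvPolynomial

/-- There are infinitely many irreducible polynomials over any field, finite or not. -/
theorem Polynomial.exists_irreducible_isCoprime {k : Type*} [Field k] {P : Polynomial k}
    (hP : P ≠ 0) : ∃ μ : Polynomial k, Irreducible μ ∧ IsCoprime μ P := by
  -- Euclid's argument, with an irreducible factor of `X * P + 1`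
  have hnu : ¬ IsUnit (Polynomial.X * P + 1) := by
    intro h
    have h1 := Polynomial.natDegree_eq_zero_of_isUnit h
    rw [Polynomial.natDegree_add_eq_left_of_natDegree_lt] at h1
    · rw [Polynomial.natDegree_X_mul hP] at h1
      omega
    · rw [Polynomial.natDegree_X_mul hP]
      simp
  have h0 : Polynomial.X * P + 1 ≠ 0 := by
    intro h
    have h1 : IsUnit (Polynomial.X : Polynomial k) :=
      IsUnit.of_mul_eq_one (-P) (by linear_combination -h)
    exact Polynomial.not_isUnit_X h1
  obtain ⟨μ, hμ, g, hg⟩ := WfDvdMonoid.exists_irreducible_factor hnu h0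
  exact ⟨μ, hμ, g, -Polynomial.X, by linear_combination -hg⟩

variable {σ k : Type*} [Field k]

theorem natDegree_prod_pow_le {B : Type*} [CommRing B] {x : σ → Polynomial B}
    (hx : ∀ a, (x a).natDegree ≤ 1) (t : Finset σ) (s : σ → ℕ) :
    (∏ i ∈ t, x i ^ s i).natDegree ≤ ∑ i ∈ t, s i := by
  refine (Polynomial.natDegree_prod_le _ _).trans (Finset.sum_le_sum fun i _ => ?_)
  refine Polynomial.natDegree_pow_le.trans ?_
  simpa using Nat.mul_le_mul_left (s i) (hx i)

theorem coeff_prod_pow {B : Type*} [CommRing B] {x : σ → Polynomial B}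
    (hx : ∀ a, (x a).natDegree ≤ 1) (t : Finset σ) (s : σ → ℕ) :
    (∏ i ∈ t, x i ^ s i).coeff (∑ i ∈ t, s i) = ∏ i ∈ t, (x i).coeff 1 ^ s i := by
  classical
  induction t using Finset.induction_on with
  | empty => simp
  | insert a t ha ih =>
    rw [Finset.prod_insert ha, Finset.prod_insert ha, Finset.sum_insert ha,
      Polynomial.coeff_mul_add_eq_of_natDegree_le _ (natDegree_prod_pow_le hx t s), ih]
    · congr 1
      simpa using Polynomial.coeff_pow_of_natDegree_le (m := s a) (hx a)
    · refine Polynomial.natDegree_pow_le.trans ?_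
      simpa using Nat.mul_le_mul_left (s a) (hx a)

variable {B : Type*} [CommRing B] [Algebra k B]

theorem natDegree_aeval_le_totalDegree {x : σ → Polynomial B} (hx : ∀ a, (x a).natDegree ≤ 1)
    (f : MvPolynomial σ k) : (aeval x f).natDegree ≤ f.totalDegree := by
  rw [aeval_def, eval₂_eq]
  refine Polynomial.natDegree_sum_le_of_forall_le _ _ fun s hs => ?_
  rw [Polynomial.algebraMap_apply]
  refine (Polynomial.natDegree_C_mul_le _ _).trans ((natDegree_prod_pow_le hx _ _).trans ?_)
  exact le_totalDegree hs

/-- The behaviour of a form at the point at infinity of a line. -/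
theorem coeff_aeval_of_isHomogeneous {x : σ → Polynomial B} (hx : ∀ a, (x a).natDegree ≤ 1)
    {f : MvPolynomial σ k} {n : ℕ} (hf : f.IsHomogeneous n) :
    (aeval x f).coeff n = aeval (fun a => (x a).coeff 1) f := by
  rw [aeval_def, eval₂_eq, aeval_def, eval₂_eq, Polynomial.finsetSum_coeff]
  refine Finset.sum_congr rfl fun s hs => ?_
  have hn : ∑ i ∈ s.support, s i = n := by
    rw [← hf (mem_support_iff.mp hs), Finsupp.weight_apply, Finsupp.sum]
    simp
  rw [Polynomial.algebraMap_apply, Polynomial.coeff_C_mul, ← hn, coeff_prod_pow hx]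

/-- The form in `l₁` and `l₂` that is obtained by homogenizing a polynomial in one variable. -/
noncomputable def homogForm (μ : Polynomial k) (l₁ l₂ : MvPolynomial σ k) : MvPolynomial σ k :=
  ∑ i ∈ Finset.range (μ.natDegree + 1), C (μ.coeff i) * (l₂ ^ i * l₁ ^ (μ.natDegree - i))

theorem isHomogeneous_homogForm (μ : Polynomial k) {l₁ l₂ : MvPolynomial σ k}
    (h1 : l₁.IsHomogeneous 1) (h2 : l₂.IsHomogeneous 1) :
    (homogForm μ l₁ l₂).IsHomogeneous μ.natDegree := by
  refine IsHomogeneous.sum _ _ _ fun i hi => ?_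
  have := (h2.pow i).mul (h1.pow (μ.natDegree - i))
  rw [one_mul, one_mul, Nat.add_sub_cancel' (by simpa [Nat.lt_succ_iff] using hi)] at this
  simpa using (isHomogeneous_C σ (μ.coeff i)).mul this

theorem aeval_homogForm_of_eq_one {A : Type*} [CommRing A] [Algebra k A] {μ : Polynomial k}
    {l₁ l₂ : MvPolynomial σ k} {x : σ → A} (h : aeval x l₁ = 1) :
    aeval x (homogForm μ l₁ l₂) = Polynomial.aeval (aeval x l₂) μ := by
  rw [homogForm, map_sum, Polynomial.aeval_eq_sum_range]
  refine Finset.sum_congr rfl fun i _ => ?_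
  simp only [map_mul, map_pow, h, one_pow, mul_one, algHom_C, Algebra.smul_def]

theorem aeval_homogForm_of_eq_zero {A : Type*} [CommRing A] [Algebra k A] {μ : Polynomial k}
    {l₁ l₂ : MvPolynomial σ k} {x : σ → A} (h : aeval x l₁ = 0) :
    aeval x (homogForm μ l₁ l₂) =
      algebraMap k A μ.leadingCoeff * aeval x l₂ ^ μ.natDegree := by
  rw [homogForm, map_sum, Finset.sum_range_succ, Finset.sum_eq_zero]
  · simp [algHom_C]
  · intro i hi
    have : μ.natDegree - i ≠ 0 := by
      have := Finset.mem_range.mp hi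
      omega
    simp [h, this]

variable {N : Set σ}

open Classical in
/-- A parametrization of the line in affine space that consists of the points whose `a₀`-th
coordinate is a root of `μ`, whose `w`-th coordinate is arbitrary and whose other coordinates
vanish. -/
noncomputable def lineParam (μ : Polynomial k) (w a₀ : N) (a : N) : Polynomial (AdjoinRoot μ) :=
  if a = w then Polynomial.X else if a = a₀ then Polynomial.C (AdjoinRoot.root μ) else 0

/-- The generic point of the line parametrized by `lineParam`. -/
noncomputable def linePrime (μ : Polynomial k) [Fact (Irreducible μ)] (w a₀ : N) :
    PrimeSpectrum (MvPolynomial N k) :=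
  ⟨RingHom.ker (aeval (lineParam μ w a₀)), RingHom.ker_isPrime _⟩

theorem natDegree_lineParam_le (μ : Polynomial k) (w a₀ a : N) :
    (lineParam μ w a₀ a).natDegree ≤ 1 := by
  unfold lineParam
  split_ifs <;> simp [Polynomial.natDegree_X_le]

variable {μ : Polynomial k} {w a₀ : N} {u : σ}

theorem aeval_mem_linePrime [Fact (Irreducible μ)] (h : a₀ ≠ w) :
    Polynomial.aeval (X a₀) μ ∈ (linePrime μ w a₀).asIdeal := by
  change aeval (lineParam μ w a₀) _ = 0
  rw [← Polynomial.aeval_algHom_apply, aeval_X, lineParam, if_neg h, if_pos rfl,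
    ← Polynomial.algebraMap_eq, Polynomial.aeval_algebraMap_apply, AdjoinRoot.aeval_eq,
    AdjoinRoot.mk_self, map_zero]

theorem linePrime_ne_bot [Fact (Irreducible μ)] (h : a₀ ≠ w) : (linePrime μ w a₀).asIdeal ≠ ⊥ := by
  intro h0
  have h1 := aeval_mem_linePrime (μ := μ) h
  rw [h0, Ideal.mem_bot] at h1
  have h2 := congrArg (aeval (fun _ : N => (Polynomial.X : Polynomial k))) h1
  rw [← Polynomial.aeval_algHom_apply, aeval_X, map_zero, Polynomial.aeval_X_left_apply] at h2
  exact (Fact.out : Irreducible μ).ne_zero h2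

/-- On the line parametrized by `lineParam`, the leading coefficient of a form of degree `n` is its
value at the coordinate point `w` at infinity. -/
theorem coeff_aeval_lineParam [DecidableEq σ] (hu : u ∉ N) {f : MvPolynomial σ k} {n : ℕ}
    (hf : f.IsHomogeneous n) :
    (aeval (lineParam μ w a₀) (dehom k u N f)).coeff n =
      algebraMap k _ (eval (Pi.single (w : σ) 1) f) := by
  classical
  have h1 : (aeval (lineParam μ w a₀)) (dehom k u N f) =
      aeval (fun a => aeval (lineParam μ w a₀) (dehomVal k u N a)) f := by
    rw [dehom, ← AlgHom.comp_apply]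
    congr 1
    ext a; simp
  have hval : ∀ a, aeval (lineParam μ w a₀) (dehomVal k u N a) =
      if a = u then 1 else if h : a ∈ N then lineParam μ w a₀ ⟨a, h⟩ else 0 := by
    intro a
    unfold dehomVal
    split_ifs <;> simp
  rw [h1, coeff_aeval_of_isHomogeneous (fun a => ?_) hf]
  · rw [← coe_aeval_eq_eval, RingHom.coe_coe, ← aeval_algebraMap_apply]
    congr 2
    ext a
    rw [hval]
    have hwu : (w : σ) ≠ u := fun h => hu (h ▸ w.2)
    by_cases ha : a = w
    · subst ha
      simp [hwu, lineParam]
    · have : ∀ h, (⟨a, h⟩ : N) ≠ w := fun h h' => ha (congrArg Subtype.val h')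
      simp only [Function.comp, Pi.single_eq_of_ne ha, map_zero]
      split_ifs with h2
      · simp [Polynomial.coeff_one]
      · unfold lineParam
        rw [if_neg (this _)]
        split_ifs <;> simp
      · simp
  · rw [hval]
    split_ifs
    · simp
    · exact natDegree_lineParam_le _ _ _ _
    · simp

/-- A line through a coordinate point at infinity meets every hypersurface that does not contain
this point: on the line, the equation of the hypersurface becomes a polynomial in one variable that
is not constant. -/
theorem exists_prime_ge_of_notMem [DecidableEq σ] [Fact (Irreducible μ)] (hu : u ∉ N)
    {π : MvPolynomial N k} (hπ : Prime π) {f : MvPolynomial σ k} {n : ℕ}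
    (hf : f.IsHomogeneous n) (hπf : π ∣ dehom k u N f)
    (hfw : eval (Pi.single (w : σ) 1) f ≠ 0) :
    ∃ Q : PrimeSpectrum (MvPolynomial N k), π ∈ Q.asIdeal ∧ linePrime μ w a₀ ≤ Q := by
  set y := lineParam μ w a₀
  obtain ⟨h, hh⟩ := hπf
  have hf0 : dehom k u N f ≠ 0 := by
    intro h0
    have := coeff_aeval_lineParam (μ := μ) (w := w) (a₀ := a₀) hu hf
    rw [h0, map_zero, Polynomial.coeff_zero] at this
    exact hfw ((map_eq_zero _).mp this.symm)
  have hdeg : π.totalDegree + h.totalDegree ≤ n := by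
    rw [← totalDegree_mul_of_isDomain hπ.ne_zero (fun h0 => hf0 (by rw [hh, h0, mul_zero])), ← hh]
    exact totalDegree_dehom_le hf
  have hπ0 : π.totalDegree ≠ 0 := by
    intro h0
    rw [totalDegree_eq_zero_iff_eq_C] at h0
    refine hπ.not_isUnit (h0 ▸ (IsUnit.map C (isUnit_iff_ne_zero.mpr fun hc => ?_)))
    rw [hc, map_zero] at h0
    exact hπ.ne_zero h0
  have hn : n ≤ (aeval y (dehom k u N f)).natDegree := by
    refine Polynomial.le_natDegree_of_ne_zero ?_
    rw [coeff_aeval_lineParam hu hf]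
    exact (map_ne_zero _).mpr hfw
  have hnu : ¬ IsUnit (aeval y π) := by
    intro hunit
    have h1 : (aeval y (dehom k u N f)).natDegree ≤ h.totalDegree := by
      rw [hh, map_mul]
      refine Polynomial.natDegree_mul_le.trans ?_
      rw [Polynomial.natDegree_eq_zero_of_isUnit hunit, zero_add]
      exact natDegree_aeval_le_totalDegree (natDegree_lineParam_le _ _ _) _
    omega
  obtain ⟨M, hM, hMπ⟩ := exists_max_ideal_of_mem_nonunits hnu
  have := hM.isPrime
  refine ⟨⟨M.comap (aeval y), M.comap_isPrime _⟩, hMπ, fun g hg => ?_⟩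
  change aeval y g ∈ M
  rw [show aeval y g = 0 from hg]
  exact zero_mem _

end Curves

/-! ### Irreducible components and the order of specialization -/

namespace LooseGraph

open MvPolynomial

variable {V E : Type*} {T : LooseGraph V E} {k : Type*} [Field k]

/-- The neighbours of a vertex of `T` in the completion. -/
def nbrs (T : LooseGraph V E) (u : V) : Set T.CompVert := {a | T.completion.Adj (.inl u) a}

theorem notMem_nbrs_self (u : V) : Sum.inl u ∉ T.nbrs u := fun h =>
  (show T.completion.Adj (.inl u) (.inl u) from h).ne rfl

theorem X_mem_of_mem_localAffine {v : V} {p : T.Ambient k} (hp : p ∈ T.localAffine k v)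
    {a : T.CompVert} (ha : a ∉ T.star v) : X a ∈ p.asHomogeneousIdeal :=
  hp.2 a (fun h => ha (.inl h)) fun h => ha (.inr h)

theorem mem_localAffine {v : V} {p : T.Ambient k} (h1 : X (.inl v) ∉ p.asHomogeneousIdeal)
    (h2 : ∀ a ∉ T.star v, X a ∈ p.asHomogeneousIdeal) : p ∈ T.localAffine k v :=
  ⟨h1, fun a ha ha' => h2 a fun h => h.elim ha ha'⟩

open Classical in
/-- The generic point of the coordinate subspace spanned by the star of a vertex. -/
noncomputable def starGen (T : LooseGraph V E) (k : Type*) [Field k] (u : V) : T.Ambient k :=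
  domPoint (B := MvPolynomial T.CompVert k) (fun a => if a ∈ T.star u then X a else 0) fun h => by
    simpa [inl_mem_star_self] using congrFun h (Sum.inl u)

theorem X_mem_starGen_iff {u : V} {a : T.CompVert} :
    X a ∈ (T.starGen k u).asHomogeneousIdeal ↔ a ∉ T.star u := by
  rw [starGen, X_mem_domPoint_iff]
  simp

theorem starGen_mem (u : V) : T.starGen k u ∈ T.localAffine k u :=
  mem_localAffine (fun h => X_mem_starGen_iff.mp h (inl_mem_star_self u))
    fun _ => X_mem_starGen_iff.mpr

theorem starGen_le_iff {u : V} {q : T.Ambient k} :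
    T.starGen k u ≤ q ↔ ∀ a ∉ T.star u, X a ∈ q.asHomogeneousIdeal := by
  classical
  refine ⟨fun h a ha => h (X_mem_starGen_iff.mpr ha), fun h => ?_⟩
  rw [ProjectiveSpectrum.le_iff_forall_isHomogeneous]
  intro n f hf hfu
  rw [starGen, mem_domPoint_iff hf] at hfu
  rw [← q.asHomogeneousIdeal.mem_iff, ← Ideal.Quotient.eq_zero_iff_mem, ← aeval_mk_X]
  rw [← map_zero (Ideal.Quotient.mkₐ k q.asHomogeneousIdeal.toIdeal), ← hfu,
    ← AlgHom.comp_apply]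
  congr 1
  ext a
  simp only [aeval_X, AlgHom.comp_apply]
  split_ifs with ha
  · rfl
  · rw [map_zero]
    exact Ideal.Quotient.eq_zero_iff_mem.mpr (h a ha)

theorem starGen_le_of_mem {u : V} {q : T.Ambient k} (hq : q ∈ T.localAffine k u) :
    T.starGen k u ≤ q :=
  starGen_le_iff.mpr fun _ ha => X_mem_of_mem_localAffine hq ha

theorem localAffine_subset_points (u : V) : T.localAffine k u ⊆ T.points k :=
  Set.subset_iUnion _ u

section

variable [DecidableEq V] [DecidableEq E]

theorem X_mem_vertPoint_iff {w : V} {a : T.CompVert} :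
    X a ∈ (T.vertPoint k w).1.asHomogeneousIdeal ↔ a ≠ .inl w := by
  rw [vertPoint, X_mem_ratPoint_iff, vertVec, Pi.single_apply]
  simp

theorem vertPoint_mem_localAffine {w v : V} :
    (T.vertPoint k w).1 ∈ T.localAffine k v ↔ v = w := by
  constructor
  · intro h
    by_contra hne
    exact h.1 (X_mem_vertPoint_iff.mpr fun h => hne (Sum.inl.inj h))
  · rintro rfl
    exact mem_localAffine (fun h => X_mem_vertPoint_iff.mp h rfl)
      fun a ha => X_mem_vertPoint_iff.mpr fun h => ha (.inl h)

theorem vertPoint_injective : Function.Injective (T.vertPoint k) := fun v w h =>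
  vertPoint_mem_localAffine.mp (h ▸ vertPoint_mem_localAffine.mpr rfl :
    (T.vertPoint k w).1 ∈ T.localAffine k v)

theorem starGen_le_vertPoint_iff {u w : V} :
    T.starGen k u ≤ (T.vertPoint k w).1 ↔ Sum.inl w ∈ T.star u := by
  rw [starGen_le_iff]
  constructor
  · intro h
    by_contra h'
    exact X_mem_vertPoint_iff.mp (h _ h') rfl
  · rintro h a ha
    exact X_mem_vertPoint_iff.mpr fun h' => ha (h' ▸ h)

theorem eq_vertPoint {w : V} {q : T.points k}
    (h : ∀ a, a ≠ .inl w → X a ∈ q.1.asHomogeneousIdeal) : q = T.vertPoint k w := by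
  refine Subtype.ext (eq_ratPoint (T.vertVec_ne_zero k w) fun a i => ?_)
  have hsing : ∀ a, a ≠ Sum.inl w → T.vertVec k w a = 0 := fun a ha => Pi.single_eq_of_ne ha _
  by_cases ha : a = .inl w
  · by_cases hi : i = .inl w
    · rw [ha, hi, sub_self]
      exact zero_mem _
    · rw [hsing i hi, map_zero, zero_mul, zero_sub]
      exact (Ideal.neg_mem_iff _).mpr (Ideal.mul_mem_left q.1.asHomogeneousIdeal.toIdeal _ (h i hi))
  · rw [hsing a ha, map_zero, zero_mul, sub_zero]
    exact Ideal.mul_mem_left _ _ (h a ha)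

namespace IsLooseTree

variable (hT : T.IsLooseTree)
include hT

/-- The irreducible component of a vertex consists of the affine space at this vertex and of the
adjacent vertices. -/
theorem mem_or_eq_of_starGen_le {u : V} {q : T.points k} (h : T.starGen k u ≤ q.1) :
    q.1 ∈ T.localAffine k u ∨ ∃ w, T.graph.Adj u w ∧ q = T.vertPoint k w := by
  rw [starGen_le_iff] at h
  obtain ⟨v, hv⟩ := Set.mem_iUnion.mp q.2
  by_cases hu : X (.inl u) ∈ q.1.asHomogeneousIdeal
  · right
    have hvu : Sum.inl v ∈ T.star u := by
      by_contra h'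
      exact hv.1 (h _ h')
    rcases inl_mem_star.mp hvu with rfl | huv
    · exact absurd hu hv.1
    refine ⟨v, huv, eq_vertPoint fun a ha => ?_⟩
    by_cases ha' : a = .inl u
    · rwa [ha']
    by_cases h1 : a ∈ T.star u
    · by_cases h2 : a ∈ T.star v
      · exact ((hT.mem_star_inter_of_adj huv h1 h2).elim ha' ha).elim
      · exact X_mem_of_mem_localAffine hv h2
    · exact h a h1
  · exact .inl (mem_localAffine hu h)

variable [Finite V] [Finite E]

omit [DecidableEq V] [DecidableEq E] in
theorem exists_starGen_le (hI : 2 ≤ T.inner.ncard) (q : T.points k) :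
    ∃ u ∈ T.inner, T.starGen k u ≤ q.1 := by
  obtain ⟨v, hv⟩ := Set.mem_iUnion.mp q.2
  obtain ⟨u, hu, hvu, -⟩ := hT.exists_star_subset hI v
  exact ⟨u, hu, starGen_le_iff.mpr fun a ha => X_mem_of_mem_localAffine hv fun h => ha (hvu h)⟩

omit [DecidableEq V] [DecidableEq E] in
theorem eq_of_starGen_le_starGen {u w : V} (hw : w ∈ T.inner)
    (h : T.starGen k u ≤ T.starGen k w) : u = w := by
  refine hT.eq_of_star_subset hw fun a ha => ?_
  by_contra h'
  exact X_mem_starGen_iff.mp (starGen_le_iff.mp h a h') ha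

end IsLooseTree

end

end LooseGraph

section Hub

variable {Y : Type*} [PartialOrder Y]

/-- In the specialization order of a space with a generic point `η`: the closure of `c` meets every
irreducible hypersurface of the closure of `η`. -/
def MeetsHypersurfaces (η c : Y) : Prop := η ≤ c ∧ ∀ z, η ⋖ z → ∃ q, z ≤ q ∧ c ≤ q

/-- A finite set that meets the closure of every `c` with `MeetsHypersurfaces η c`. -/
def IsHitting (η : Y) (F : Set Y) : Prop :=
  F.Finite ∧ ∀ c, MeetsHypersurfaces η c → ∃ q ∈ F, c ≤ q

/-- The intersection of all finite hitting sets. -/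
def hub (η : Y) : Set Y := {q | ∀ F, IsHitting η F → q ∈ F}

variable {Z : Type*} [PartialOrder Z]

theorem MeetsHypersurfaces.map (e : Y ≃o Z) {η c : Y} (h : MeetsHypersurfaces η c) :
    MeetsHypersurfaces (e η) (e c) := by
  refine ⟨e.monotone h.1, fun z hz => ?_⟩
  obtain ⟨z, rfl⟩ := e.surjective z
  obtain ⟨q, h1, h2⟩ := h.2 z ((apply_covBy_apply_iff e).mp hz)
  exact ⟨e q, e.monotone h1, e.monotone h2⟩

theorem IsHitting.preimage (e : Y ≃o Z) {η : Y} {F : Set Z} (h : IsHitting (e η) F) :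
    IsHitting η (e ⁻¹' F) := by
  refine ⟨h.1.preimage e.injective.injOn, fun c hc => ?_⟩
  obtain ⟨q, h1, h2⟩ := h.2 _ (hc.map e)
  exact ⟨e.symm q, by simpa using h1, by simpa using e.symm.monotone h2⟩

theorem mem_hub_map (e : Y ≃o Z) {η q : Y} (h : q ∈ hub η) : e q ∈ hub (e η) :=
  fun _ hF => h _ (hF.preimage e)

theorem apply_mem_hub_iff (e : Y ≃o Z) {η q : Y} : e q ∈ hub (e η) ↔ q ∈ hub η :=
  ⟨fun h => by simpa using mem_hub_map e.symm h, mem_hub_map e⟩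

end Hub

namespace LooseGraph

open MvPolynomial

variable {V E : Type*} {T : LooseGraph V E} {k : Type*} [Field k]

/-- The generic point of the irreducible component of an inner vertex, as a point of `X_k`. -/
noncomputable def gen (T : LooseGraph V E) (k : Type*) [Field k] (u : V) : T.points k :=
  ⟨T.starGen k u, localAffine_subset_points u (starGen_mem u)⟩

/-- The prime ideal of the coordinate ring of the affine space at `u` that belongs to a point. -/
noncomputable def affPrime (u : V) (q : T.points k) : PrimeSpectrum (MvPolynomial (T.nbrs u) k) :=
  cellPrime (T.nbrs u) (.inl u) q.1

/-- The point of the affine space at `u` that belongs to a prime ideal of its coordinate ring. -/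
noncomputable def affPoint (u : V) (Q : PrimeSpectrum (MvPolynomial (T.nbrs u) k)) : T.points k :=
  ⟨cellPoint (.inl u) Q, localAffine_subset_points u (cellPoint_mem _)⟩

theorem affPoint_mem (u : V) (Q : PrimeSpectrum (MvPolynomial (T.nbrs u) k)) :
    (affPoint u Q).1 ∈ T.localAffine k u := cellPoint_mem _

theorem affPrime_affPoint (u : V) (Q : PrimeSpectrum (MvPolynomial (T.nbrs u) k)) :
    affPrime u (affPoint u Q) = Q := cellPrime_cellPoint (notMem_nbrs_self u) Q

theorem affPoint_affPrime {u : V} {q : T.points k} (hq : q.1 ∈ T.localAffine k u) :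
    affPoint u (affPrime u q) = q :=
  Subtype.ext (cellPoint_cellPrime (notMem_nbrs_self u) hq)

theorem affPrime_le_iff {u : V} {p q : T.points k} (hp : p.1 ∈ T.localAffine k u)
    (hq : q.1 ∈ T.localAffine k u) : affPrime u p ≤ affPrime u q ↔ p ≤ q :=
  cellPrime_le_iff hp hq (notMem_nbrs_self u)

theorem affPoint_le_iff {u : V} {Q : PrimeSpectrum (MvPolynomial (T.nbrs u) k)} {q : T.points k}
    (hq : q.1 ∈ T.localAffine k u) : affPoint u Q ≤ q ↔ Q ≤ affPrime u q :=
  cellPoint_le_iff (notMem_nbrs_self u) hq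

theorem gen_le_of_mem {u : V} {q : T.points k} (hq : q.1 ∈ T.localAffine k u) : T.gen k u ≤ q :=
  starGen_le_of_mem hq

theorem affPrime_gen (u : V) : affPrime u (T.gen k u) = ⟨⊥, Ideal.isPrime_bot⟩ := by
  refine le_antisymm ?_ bot_le
  rw [← affPrime_affPoint u ⟨⊥, Ideal.isPrime_bot⟩,
    affPrime_le_iff (starGen_mem u) (affPoint_mem _ _)]
  exact gen_le_of_mem (affPoint_mem _ _)

theorem eq_gen_of_affPrime_eq_bot {u : V} {q : T.points k} (hq : q.1 ∈ T.localAffine k u)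
    (h : (affPrime u q).asIdeal = ⊥) : q = T.gen k u := by
  rw [← affPoint_affPrime hq, ← affPoint_affPrime (q := T.gen k u) (starGen_mem u), affPrime_gen]
  congr 1
  exact PrimeSpectrum.ext h

/-- The generic point of the line in the affine space at `u` which has direction `w` and on which
the `a₀`-coordinate is a root of `μ`. -/
noncomputable def lineGen {u : V} (μ : Polynomial k) [Fact (Irreducible μ)] (w a₀ : T.nbrs u) :
    T.points k :=
  affPoint u (linePrime μ w a₀)

theorem lineGen_mem {u : V} (μ : Polynomial k) [Fact (Irreducible μ)] (w a₀ : T.nbrs u) :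
    (lineGen μ w a₀).1 ∈ T.localAffine k u := affPoint_mem _ _

theorem gen_lt_lineGen {u : V} {w a₀ : T.nbrs u} (μ : Polynomial k)
    [Fact (Irreducible μ)] (h : a₀ ≠ w) : T.gen k u < lineGen μ w a₀ := by
  refine lt_of_le_of_ne (gen_le_of_mem (lineGen_mem μ w a₀)) fun h0 => ?_
  have h1 := congrArg (affPrime u) h0
  rw [affPrime_gen, lineGen, affPrime_affPoint] at h1
  exact linePrime_ne_bot h (congrArg PrimeSpectrum.asIdeal h1).symm

variable [DecidableEq V] [DecidableEq E]

theorem lineGen_le_vertPoint {u : V} {w : V} (hw : Sum.inl w ∈ T.nbrs u) (μ : Polynomial k)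
    [Fact (Irreducible μ)] (a₀ : T.nbrs u) :
    lineGen μ ⟨_, hw⟩ a₀ ≤ T.vertPoint k w := by
  change (lineGen μ _ a₀).1 ≤ (T.vertPoint k w).1
  rw [ProjectiveSpectrum.le_iff_forall_isHomogeneous]
  intro n f hf hfl
  rw [vertPoint, mem_ratPoint_iff hf]
  have h1 : aeval (lineParam μ ⟨_, hw⟩ a₀) (dehom k (.inl u) (T.nbrs u) f) = 0 :=
    (mem_cellPoint_iff hf).mp hfl
  have h2 := coeff_aeval_lineParam (μ := μ) (w := ⟨_, hw⟩) (a₀ := a₀) (notMem_nbrs_self u) hf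
  rw [h1, Polynomial.coeff_zero] at h2
  exact (map_eq_zero _).mp h2.symm

theorem lineGen_ne_vertPoint {u w : V} (hw : Sum.inl w ∈ T.nbrs u) (μ : Polynomial k)
    [Fact (Irreducible μ)] (b a₀ : T.nbrs u) : lineGen μ b a₀ ≠ T.vertPoint k w := by
  intro h
  have h1 := lineGen_mem μ b a₀
  rw [h, vertPoint_mem_localAffine] at h1
  subst h1
  exact notMem_nbrs_self _ hw

namespace IsLooseTree

variable (hT : T.IsLooseTree) [Finite V] [Finite E]
include hT

theorem not_gen_covBy_vertPoint {u w : V} (hu : u ∈ T.inner) (hw : Sum.inl w ∈ T.nbrs u) :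
    ¬ T.gen k u ⋖ T.vertPoint k w := by
  intro h
  obtain ⟨a₀, ha, ha₀⟩ := hT.exists_ne_adj hu (.inl w)
  have : Fact (Irreducible (Polynomial.X : Polynomial k)) := ⟨Polynomial.irreducible_X⟩
  exact h.2 (gen_lt_lineGen (w := ⟨_, hw⟩) (a₀ := ⟨a₀, ha₀⟩) Polynomial.X
      fun h => ha (congrArg Subtype.val h))
    (lt_of_le_of_ne (lineGen_le_vertPoint hw _ _) (lineGen_ne_vertPoint hw _ _ _))

/-- A hypersurface that does not contain the point at infinity of a line is the zero set of a prime
element that is not constant on the line. -/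
theorem meetsHypersurfaces_lineGen {u w : V} (hu : u ∈ T.inner) (hw : Sum.inl w ∈ T.nbrs u)
    {a₀ : T.nbrs u} (μ : Polynomial k) [Fact (Irreducible μ)] :
    MeetsHypersurfaces (T.gen k u) (lineGen μ ⟨_, hw⟩ a₀) := by
  refine ⟨starGen_le_of_mem (lineGen_mem μ _ a₀), fun z hz => ?_⟩
  by_cases hzw : z ≤ T.vertPoint k w
  · exact ⟨_, hzw, lineGen_le_vertPoint hw μ a₀⟩
  rcases hT.mem_or_eq_of_starGen_le hz.1.le with hzu | ⟨w', hw', rfl⟩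
  swap
  · exact absurd hz (hT.not_gen_covBy_vertPoint hu (completion_adj_inl_inl.mpr hw'))
  obtain ⟨n, f, hf, hfz, hfw⟩ : ∃ (n : ℕ) (f : MvPolynomial T.CompVert k), f.IsHomogeneous n ∧
      f ∈ z.1.asHomogeneousIdeal ∧ f ∉ (T.vertPoint k w).1.asHomogeneousIdeal := by
    by_contra! h
    exact hzw (ProjectiveSpectrum.le_iff_forall_isHomogeneous.mpr h)
  rw [vertPoint, mem_ratPoint_iff hf] at hfw
  set Q := affPrime u z
  have hQ : Q.asIdeal ≠ ⊥ := fun h0 => hz.1.ne (eq_gen_of_affPrime_eq_bot hzu h0).symm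
  obtain ⟨π, hπQ, hπ⟩ := Q.2.exists_mem_prime_of_ne_bot hQ
  -- the coordinate ring is factorial, and so the prime `Q` of height one is principal
  have hQe : Q.asIdeal = Ideal.span {π} := by
    have hP : (Ideal.span {π}).IsPrime := (Ideal.span_singleton_prime hπ.ne_zero).mpr hπ
    have hqz : affPoint u ⟨_, hP⟩ ≤ z :=
      (affPoint_le_iff hzu).mpr ((Ideal.span_singleton_le_iff_mem _).mpr hπQ)
    rcases hz.eq_or_eq (gen_le_of_mem (affPoint_mem u ⟨_, hP⟩)) hqz with h | h
    · exfalso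
      have h1 := congrArg (affPrime u) h
      rw [affPrime_gen, affPrime_affPoint] at h1
      exact hπ.ne_zero (Ideal.span_singleton_eq_bot.mp (congrArg PrimeSpectrum.asIdeal h1))
    · have h1 := congrArg (affPrime u) h
      rw [affPrime_affPoint] at h1
      exact (congrArg PrimeSpectrum.asIdeal h1).symm
  have hdvd : π ∣ dehom k (.inl u) (T.nbrs u) f := by
    rw [← Ideal.mem_span_singleton, ← hQe]
    exact (dehom_mem_cellPrime_iff hzu (notMem_nbrs_self u) hf).mpr hfz
  obtain ⟨Q', h1, h2⟩ := exists_prime_ge_of_notMem (μ := μ) (w := ⟨_, hw⟩) (a₀ := a₀)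
    (notMem_nbrs_self u) hπ hf hdvd hfw
  refine ⟨affPoint u Q', ?_, ?_⟩
  · rw [← affPrime_le_iff hzu (affPoint_mem u Q'), affPrime_affPoint]
    change Q.asIdeal ≤ Q'.asIdeal
    rw [hQe]
    exact (Ideal.span_singleton_le_iff_mem _).mpr h1
  · rw [lineGen, affPoint_le_iff (affPoint_mem u Q'), affPrime_affPoint]
    exact h2

/-- An irreducible closed subset of a component that contains no vertex at infinity is disjoint from
some hypersurface: if `F` vanishes on it, then `F + 1` vanishes nowhere on it. -/
theorem exists_le_vertPoint_of_meetsHypersurfaces (hI : 2 ≤ T.inner.ncard) {u : V}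
    {c : T.points k} (hc : MeetsHypersurfaces (T.gen k u) c) :
    ∃ w, T.graph.Adj u w ∧ c ≤ T.vertPoint k w := by
  rcases hT.mem_or_eq_of_starGen_le hc.1 with hcu | ⟨w, hw, rfl⟩
  swap
  · exact ⟨w, hw, le_rfl⟩
  by_contra! hno
  set Q := affPrime u c
  have hQ : Q.asIdeal ≠ ⊥ := by
    intro h0
    obtain ⟨w, -, hw⟩ := hT.exists_inner_adj hI u
    refine hno w hw ?_
    rw [eq_gen_of_affPrime_eq_bot hcu h0]
    exact starGen_le_vertPoint_iff.mpr (inl_mem_star.mpr (.inr hw))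
  obtain ⟨F, hFQ, hF0⟩ := Submodule.exists_mem_ne_zero_of_ne_bot hQ
  have hconst : ∀ c : k, C c ∈ Q.asIdeal → c = 0 := by
    intro c hc
    by_contra h0
    exact Q.2.ne_top (Ideal.eq_top_of_isUnit_mem _ hc
      ((isUnit_iff_ne_zero.mpr h0).map C))
  have hnu : ¬ IsUnit (F + 1) := by
    intro h
    rw [isUnit_iff_eq_C_of_isReduced] at h
    obtain ⟨r, -, hr⟩ := h
    have hF : F = C (r - 1) := by rw [map_sub, ← hr, map_one, add_sub_cancel_right]
    rw [hF] at hFQ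
    rw [hF, hconst _ hFQ, map_zero] at hF0
    exact hF0 rfl
  have hne : F + 1 ≠ 0 := by
    intro h
    refine Q.2.ne_top ((Ideal.eq_top_iff_one _).mpr ?_)
    rw [show (1 : MvPolynomial (T.nbrs u) k) = -F by linear_combination h]
    exact neg_mem hFQ
  obtain ⟨π, hπ, hπF⟩ := WfDvdMonoid.exists_irreducible_factor hnu hne
  replace hπ := hπ.prime
  have hP : (Ideal.span {π}).IsPrime := (Ideal.span_singleton_prime hπ.ne_zero).mpr hπ
  let z : T.points k := affPoint u ⟨_, hP⟩
  have hzu : z.1 ∈ T.localAffine k u := affPoint_mem _ _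
  have hz : T.gen k u ⋖ z := by
    refine ⟨lt_of_le_of_ne (gen_le_of_mem hzu) fun h => ?_, fun p h1 h2 => ?_⟩
    · have h1 := congrArg (affPrime u) h
      rw [affPrime_gen, affPrime_affPoint] at h1
      exact hπ.ne_zero (Ideal.span_singleton_eq_bot.mp (congrArg PrimeSpectrum.asIdeal h1).symm)
    · have hpu : p.1 ∈ T.localAffine k u :=
        mem_localAffine (fun h => hzu.1 (h2.le h)) (starGen_le_iff.mp h1.le)
      have hle : affPrime u p ≤ ⟨_, hP⟩ := by
        rw [← affPrime_affPoint u ⟨_, hP⟩, affPrime_le_iff hpu hzu]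
        exact h2.le
      obtain ⟨ρ, hρ, hρp⟩ := (affPrime u p).2.exists_mem_prime_of_ne_bot
        fun h0 => h1.ne (eq_gen_of_affPrime_eq_bot hpu h0).symm
      have hass := (hπ.dvd_prime_iff_associated hρp).mp (Ideal.mem_span_singleton.mp (hle hρ))
      refine h2.not_ge ((affPoint_le_iff hpu).mpr ?_)
      exact (Ideal.span_singleton_le_iff_mem _).mpr (Ideal.mem_of_dvd _ hass.symm.dvd hρ)
  obtain ⟨q, hzq, hcq⟩ := hc.2 z hz
  rcases hT.mem_or_eq_of_starGen_le (hz.1.le.trans hzq) with hqu | ⟨w, hw, rfl⟩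
  · have h1 : Q ≤ affPrime u q := (affPrime_le_iff hcu hqu).mpr hcq
    have h2 : π ∈ (affPrime u q).asIdeal :=
      (affPoint_le_iff hqu).mp hzq (Ideal.mem_span_singleton_self π)
    have h3 : F + 1 ∈ (affPrime u q).asIdeal := Ideal.mem_of_dvd _ hπF h2
    refine (affPrime u q).2.ne_top ((Ideal.eq_top_iff_one _).mpr ?_)
    have := sub_mem h3 (h1 hFQ)
    rwa [add_sub_cancel_left] at this
  · exact hno w hw hcq

end IsLooseTree

end LooseGraph

/-! ### Homeomorphisms act on the inner tree -/

namespace LooseGraph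

open MvPolynomial

variable {V E : Type*} {T : LooseGraph V E} {k : Type*} [Field k]

/-- The affine space at a vertex, ordered by specialization, is the spectrum of a polynomial
ring. -/
noncomputable def affOrderIso (u : V) :
    {q : T.points k // q.1 ∈ T.localAffine k u} ≃o PrimeSpectrum (MvPolynomial (T.nbrs u) k) where
  toFun q := affPrime u q.1
  invFun Q := ⟨affPoint u Q, affPoint_mem u Q⟩
  left_inv q := Subtype.ext (affPoint_affPrime q.2)
  right_inv Q := affPrime_affPoint u Q
  map_rel_iff' {p q} := affPrime_le_iff p.2 q.2

theorem IsLooseTree.krullDim_localAffine [Finite V] [Finite E] (hT : T.IsLooseTree) (u : V) :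
    Order.krullDim {q : T.points k // q.1 ∈ T.localAffine k u} = T.degree u := by
  rw [Order.krullDim_eq_of_orderIso (affOrderIso (k := k) u), hT.degree_eq u]
  change ringKrullDim _ = _
  rw [MvPolynomial.ringKrullDim_of_isNoetherianRing, ringKrullDim_eq_zero_of_field, zero_add]
  rfl

variable [DecidableEq V] [DecidableEq E]

/-- A line that avoids a given finite set of points, apart from its point at infinity. -/
theorem IsLooseTree.exists_lineGen_avoiding (hT : T.IsLooseTree) {u w : V}
    (hw : Sum.inl w ∈ T.nbrs u) {a₀ : T.nbrs u} (ha : a₀.1 ≠ .inl w) {F : Set (T.points k)} (hF : F.Finite)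
    (hwF : T.vertPoint k w ∉ F) :
    ∃ (μ : Polynomial k) (_ : Fact (Irreducible μ)), ∀ q ∈ F, ¬ lineGen μ ⟨_, hw⟩ a₀ ≤ q := by
  classical
  have ha' : a₀ ≠ ⟨_, hw⟩ := fun h => ha (congrArg Subtype.val h)
  have hg : ∀ q : T.points k, ∃ g : Polynomial k, g ≠ 0 ∧ ∀ h : Polynomial k, h ≠ 0 →
      Polynomial.aeval (X a₀) h ∈ (affPrime u q).asIdeal →
        Polynomial.aeval (X a₀) g ∈ (affPrime u q).asIdeal := by
    intro q
    by_cases h : ∃ h : Polynomial k, h ≠ 0 ∧ Polynomial.aeval (X a₀) h ∈ (affPrime u q).asIdeal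
    · obtain ⟨g, hg0, hg⟩ := h
      exact ⟨g, hg0, fun _ _ _ => hg⟩
    · exact ⟨1, one_ne_zero, fun g h1 h2 => absurd ⟨g, h1, h2⟩ h⟩
  choose g hg0 hg using hg
  obtain ⟨μ, hμ, hcop⟩ := Polynomial.exists_irreducible_isCoprime
    (Finset.prod_ne_zero_iff.mpr fun q (_ : q ∈ hF.toFinset) => hg0 q)
  have : Fact (Irreducible μ) := ⟨hμ⟩
  refine ⟨μ, this, fun q hq hle => ?_⟩
  rcases hT.mem_or_eq_of_starGen_le
    ((gen_le_of_mem (lineGen_mem μ ⟨_, hw⟩ a₀)).trans hle) with hqu | ⟨w', hw', rfl⟩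
  · have h1 : Polynomial.aeval (X a₀) μ ∈ (affPrime u q).asIdeal :=
      (affPoint_le_iff hqu).mp hle (aeval_mem_linePrime ha')
    have h2 := hg q μ hμ.ne_zero h1
    obtain ⟨a, b, hab⟩ := hcop
    refine (affPrime u q).2.ne_top ((Ideal.eq_top_iff_one _).mpr ?_)
    have h3 := congrArg (Polynomial.aeval (X a₀ : MvPolynomial (T.nbrs u) k)) hab
    rw [map_add, map_mul, map_mul, map_one] at h3
    rw [← h3]
    refine add_mem (Ideal.mul_mem_left _ _ h1) (Ideal.mul_mem_left _ _ ?_)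
    exact Ideal.mem_of_dvd _ (map_dvd _ (Finset.dvd_prod_of_mem g (hF.mem_toFinset.mpr hq))) h2
  · have hne : w' ≠ w := by rintro rfl; exact hwF hq
    have hw'N : Sum.inl w' ∈ T.nbrs u := completion_adj_inl_inl.mpr hw'
    by_cases h0 : a₀ = ⟨_, hw'N⟩
    · -- the homogenization of `μ` vanishes on the line, but not at the coordinate point
      have h1 := (isHomogeneous_homogForm μ (isHomogeneous_X k (Sum.inl u : T.CompVert))
        (isHomogeneous_X k a₀.1))
      have h2 : homogForm μ (X (.inl u)) (X a₀.1) ∈ (T.vertPoint k w').1.asHomogeneousIdeal := by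
        refine hle ((mem_cellPoint_iff h1).mpr ?_)
        rw [dehom, aeval_homogForm_of_eq_one (by rw [← dehom, dehom_X_self]), ← dehom,
          dehom_X_of_mem (notMem_nbrs_self u)]
        exact aeval_mem_linePrime ha'
      rw [vertPoint, mem_ratPoint_iff h1, ← coe_aeval_eq_eval, RingHom.coe_coe,
        aeval_homogForm_of_eq_zero] at h2
      · simp [h0, hμ.ne_zero] at h2
      · simp [hw'.ne]
    · have h2 : X (.inl w') ∈ (T.vertPoint k w').1.asHomogeneousIdeal := by
        refine hle ((mem_cellPoint_iff (isHomogeneous_X k _)).mpr ?_)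
        rw [dehom_X_of_mem (notMem_nbrs_self u) ⟨_, hw'N⟩]
        change aeval _ _ = 0
        rw [aeval_X, lineParam, if_neg, if_neg (Ne.symm h0)]
        exact fun h => hne (Sum.inl.inj (congrArg Subtype.val h))
      exact X_mem_vertPoint_iff.mp h2 rfl

variable [Finite V] [Finite E]

namespace IsLooseTree

variable (hT : T.IsLooseTree) (hI : 2 ≤ T.inner.ncard)
include hT hI

/-- The vertices adjacent to an inner vertex `u` are determined by the order of specialization. -/
theorem mem_hub_gen_iff {u : V} (hu : u ∈ T.inner) {q : T.points k} :
    q ∈ hub (T.gen k u) ↔ ∃ w, T.graph.Adj u w ∧ q = T.vertPoint k w := by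
  constructor
  · intro h
    refine h {q | ∃ w, T.graph.Adj u w ∧ q = T.vertPoint k w} ⟨?_, fun c hc => ?_⟩
    · refine (Set.finite_range (T.vertPoint k)).subset ?_
      rintro _ ⟨w, -, rfl⟩
      exact ⟨w, rfl⟩
    · obtain ⟨w, hw, hcw⟩ := hT.exists_le_vertPoint_of_meetsHypersurfaces hI hc
      exact ⟨_, ⟨w, hw, rfl⟩, hcw⟩
  · rintro ⟨w, hw, rfl⟩ F hF
    by_contra hwF
    have hwN : Sum.inl w ∈ T.nbrs u := completion_adj_inl_inl.mpr hw
    obtain ⟨a₀, ha, ha₀⟩ := hT.exists_ne_adj hu (.inl w)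
    obtain ⟨μ, hμ, hno⟩ := hT.exists_lineGen_avoiding hwN (a₀ := ⟨a₀, ha₀⟩) ha hF.1 hwF
    obtain ⟨q, hq, hle⟩ := hF.2 _ (hT.meetsHypersurfaces_lineGen hu hwN μ)
    exact hno q hq hle

theorem vertPoint_mem_hub_gen_iff {u w : V} (hu : u ∈ T.inner) :
    T.vertPoint k w ∈ hub (T.gen k u) ↔ T.graph.Adj u w := by
  rw [hT.mem_hub_gen_iff hI hu]
  constructor
  · rintro ⟨w', h, h'⟩
    rwa [vertPoint_injective h']
  · exact fun h => ⟨w, h, rfl⟩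

omit [DecidableEq V] [DecidableEq E] in
/-- The generic points of the components are the minimal points of the order of specialization. -/
theorem exists_apply_gen_eq (e : T.points k ≃o T.points k) {u : V} (hu : u ∈ T.inner) :
    ∃ u' ∈ T.inner, e (T.gen k u) = T.gen k u' := by
  obtain ⟨w, hw, hle⟩ := hT.exists_starGen_le hI (e (T.gen k u))
  refine ⟨w, hw, le_antisymm ?_ hle⟩
  obtain ⟨x, hx, hxle⟩ := hT.exists_starGen_le hI (e.symm (T.gen k w))
  replace hxle : T.gen k x ≤ e.symm (T.gen k w) := hxle
  have h1 : e.symm (T.gen k w) ≤ T.gen k u := e.symm_apply_le.mpr hle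
  rw [hT.eq_of_starGen_le_starGen hu (hxle.trans h1)] at hxle
  exact (e.le_symm_apply).mp hxle

theorem exists_apply_vertPoint_eq (e : T.points k ≃o T.points k) (v : V) :
    ∃ v', e (T.vertPoint k v) = T.vertPoint k v' := by
  obtain ⟨u, hu, hvu⟩ := hT.exists_inner_adj hI v
  obtain ⟨u', hu', he⟩ := hT.exists_apply_gen_eq hI e hu
  have h1 := (apply_mem_hub_iff e).mpr ((hT.vertPoint_mem_hub_gen_iff (k := k) hI hu).mpr hvu.symm)
  rw [he, hT.mem_hub_gen_iff hI hu'] at h1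
  obtain ⟨v', -, h⟩ := h1
  exact ⟨v', h⟩

omit hI [Finite V] [Finite E] in
/-- Two irreducible components have more than one common point if and only if the vertices are
adjacent. -/
theorem adj_iff_exists_ne {u v : V} (huv : u ≠ v) :
    T.graph.Adj u v ↔ ∃ p q : T.points k, p ≠ q ∧ T.gen k u ≤ p ∧ T.gen k v ≤ p ∧
      T.gen k u ≤ q ∧ T.gen k v ≤ q := by
  constructor
  · intro h
    refine ⟨T.vertPoint k u, T.vertPoint k v, vertPoint_injective.ne huv, ?_, ?_, ?_, ?_⟩ <;>
    refine starGen_le_vertPoint_iff.mpr (inl_mem_star.mpr ?_)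
    exacts [.inl rfl, .inr h.symm, .inr h, .inl rfl]
  · rintro ⟨p, q, hpq, hup, hvp, huq, hvq⟩
    by_contra hn
    have key : ∀ {p : T.points k} {a}, T.gen k u ≤ p → T.gen k v ≤ p →
        X a ∉ p.1.asHomogeneousIdeal → ∃ x, a = .inl x ∧ T.graph.Adj u x ∧ T.graph.Adj v x := by
      intro p a hu hv ha
      refine hT.mem_star_inter_of_not_adj huv hn ?_ ?_
      · by_contra h; exact ha (starGen_le_iff.mp hu a h)
      · by_contra h; exact ha (starGen_le_iff.mp hv a h)
    obtain ⟨a, ha⟩ := p.1.exists_X_notMem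
    obtain ⟨x, -, h1, h2⟩ := key hup hvp ha
    have key2 : ∀ {p : T.points k}, T.gen k u ≤ p → T.gen k v ≤ p → p = T.vertPoint k x := by
      intro p hu hv
      refine eq_vertPoint fun b hb => ?_
      by_contra h
      obtain ⟨y, rfl, h3, h4⟩ := key hu hv h
      exact hb (by rw [hT.eq_of_common_adj huv h1 h2 h3 h4])
    exact hpq ((key2 hup hvp).trans (key2 huq hvq).symm)

/-- The action on the components is the same as that on the vertices: if `v` is adjacent to `u`,
then `u` is the only neighbour of `v` in the component of `u`. -/
theorem apply_gen_eq (e : T.points k ≃o T.points k) {u u' : V} (hu : u ∈ T.inner)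
    (he : e (T.vertPoint k u) = T.vertPoint k u') :
    u' ∈ T.inner ∧ e (T.gen k u) = T.gen k u' := by
  obtain ⟨v, hv, huv⟩ := hT.exists_inner_adj hI u
  obtain ⟨x, hx, hex⟩ := hT.exists_apply_gen_eq hI e hu
  obtain ⟨y, hy, hey⟩ := hT.exists_apply_gen_eq hI e hv
  have hxy : T.graph.Adj x y := by
    rw [hT.adj_iff_exists_ne (k := k)]
    · obtain ⟨p, q, hpq, h1, h2, h3, h4⟩ := (hT.adj_iff_exists_ne (k := k) huv.ne).mp huv
      refine ⟨e p, e q, e.injective.ne hpq, ?_⟩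
      rw [← hex, ← hey]
      exact ⟨e.monotone h1, e.monotone h2, e.monotone h3, e.monotone h4⟩
    · rintro rfl
      have := congrArg (fun q : T.points k => q.1) (e.injective (hex.trans hey.symm))
      exact huv.ne (hT.eq_of_starGen_le_starGen hv this.le)
  have h1 : T.graph.Adj y u' := by
    rw [← hT.vertPoint_mem_hub_gen_iff (k := k) hI hy, ← hey, ← he, apply_mem_hub_iff,
      hT.vertPoint_mem_hub_gen_iff hI hv]
    exact huv.symm
  have h2 : T.gen k x ≤ T.vertPoint k u' := by
    rw [← hex, ← he]
    exact e.monotone (starGen_le_vertPoint_iff.mpr (inl_mem_star_self u))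
  rcases inl_mem_star.mp (starGen_le_vertPoint_iff.mp h2) with rfl | h3
  · exact ⟨hx, hex⟩
  · exact (hT.not_triangle hxy h1 h3).elim

theorem adj_of_apply_eq (e : T.points k ≃o T.points k) {u u' v v' : V} (huv : T.graph.Adj u v)
    (hu : e (T.vertPoint k u) = T.vertPoint k u') (hv : e (T.vertPoint k v) = T.vertPoint k v') :
    T.graph.Adj u' v' := by
  wlog hin : u ∈ T.inner generalizing u u' v v'
  · obtain ⟨w, hw, huw⟩ := hT.exists_inner_adj hI u
    have hwv : w = v := Sum.inl.inj (hT.eq_of_not_inner hin (completion_adj_inl_inl.mpr huw)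
      (completion_adj_inl_inl.mpr huv))
    exact (this huv.symm hv hu (hwv ▸ hw)).symm
  obtain ⟨hin', hg⟩ := hT.apply_gen_eq hI e hin hu
  rw [← hT.vertPoint_mem_hub_gen_iff (k := k) hI hin', ← hg, ← hv, apply_mem_hub_iff,
    hT.vertPoint_mem_hub_gen_iff hI hin]
  exact huv

theorem mem_localAffine_iff {u : V} (hu : u ∈ T.inner) {q : T.points k} :
    q.1 ∈ T.localAffine k u ↔ T.gen k u ≤ q ∧ q ∉ hub (T.gen k u) := by
  rw [hT.mem_hub_gen_iff hI hu]
  constructor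
  · refine fun h => ⟨gen_le_of_mem h, ?_⟩
    rintro ⟨w, hw, rfl⟩
    exact hw.ne (vertPoint_mem_localAffine.mp h)
  · rintro ⟨h1, h2⟩
    exact (hT.mem_or_eq_of_starGen_le h1).resolve_right h2

omit [DecidableEq V] [DecidableEq E] in
theorem degree_eq_one {u : V} (hu : u ∉ T.inner) : T.degree u = 1 := by
  obtain ⟨w, -, hw⟩ := hT.exists_inner_adj hI u
  have h1 : T.degree u < 2 := not_le.mp hu
  have h2 : 0 < T.degree u := by
    rw [hT.degree_eq, Set.ncard_pos]
    exact ⟨_, completion_adj_inl_inl.mpr hw⟩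
  omega

theorem degree_eq_of_apply_eq (e : T.points k ≃o T.points k) {u u' : V}
    (hu : e (T.vertPoint k u) = T.vertPoint k u') : T.degree u' = T.degree u := by
  by_cases hin : u ∈ T.inner
  · obtain ⟨hin', hg⟩ := hT.apply_gen_eq hI e hin hu
    have hiff : ∀ q : T.points k, q.1 ∈ T.localAffine k u ↔ (e q).1 ∈ T.localAffine k u' := by
      intro q
      rw [hT.mem_localAffine_iff hI hin, hT.mem_localAffine_iff hI hin', ← hg,
        apply_mem_hub_iff, e.le_iff_le]
    let e' : {q : T.points k // q.1 ∈ T.localAffine k u} ≃o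
        {q : T.points k // q.1 ∈ T.localAffine k u'} :=
      ⟨e.toEquiv.subtypeEquiv hiff, fun {p q} => e.le_iff_le⟩
    have := Order.krullDim_eq_of_orderIso e'
    rw [hT.krullDim_localAffine, hT.krullDim_localAffine] at this
    exact_mod_cast this.symm
  · have hin' : u' ∉ T.inner := fun h =>
      hin (hT.apply_gen_eq hI e.symm h (by rw [← hu, e.symm_apply_apply])).1
    rw [hT.degree_eq_one hI hin, hT.degree_eq_one hI hin']

omit hI [DecidableEq V] [DecidableEq E] [Finite V] in
/-- A permutation of the vertices of `T` that preserves adjacency and degrees gives an automorphism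
of the embedded inner tree. -/
theorem exists_embeddedInnerAut {β : Equiv.Perm V}
    (hadj : ∀ u v, T.graph.Adj (β u) (β v) ↔ T.graph.Adj u v)
    (hdeg : ∀ v, T.degree (β v) = T.degree v) :
    ∃ α ∈ T.embeddedInnerAut, ∀ v : T.inner, (α v : V) = β v := by
  have hin : ∀ v, v ∈ T.inner ↔ β v ∈ T.inner := fun v => by
    simp only [inner, Set.mem_ofPred_eq, hdeg]
  let α : T.innerTree ≃g T.innerTree := ⟨β.subtypeEquiv hin, fun {u v} => hadj u v⟩
  obtain ⟨φ, hφ⟩ := hT.exists_auto_of_degree_eq hadj hdeg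
  exact ⟨α, ⟨φ, fun v => by rw [hφ]; rfl⟩, fun v => rfl⟩

/-- An automorphism of the specialization order of `X_k` permutes the vertices of `T`, and preserves
adjacency and degrees. -/
theorem exists_perm_of_orderIso (e : T.points k ≃o T.points k) :
    ∃ β : Equiv.Perm V, (∀ v, e (T.vertPoint k v) = T.vertPoint k (β v)) ∧
      (∀ u v, T.graph.Adj (β u) (β v) ↔ T.graph.Adj u v) ∧
      ∀ v, T.degree (β v) = T.degree v := by
  choose f hf using hT.exists_apply_vertPoint_eq (k := k) hI e
  choose f' hf' using hT.exists_apply_vertPoint_eq (k := k) hI e.symm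
  refine ⟨⟨f, f', fun v => ?_, fun v => ?_⟩, hf, fun u v => ⟨fun h => ?_, fun h => ?_⟩,
    fun v => hT.degree_eq_of_apply_eq hI e (hf v)⟩
  · apply vertPoint_injective (T := T) (k := k)
    rw [← hf', ← hf, e.symm_apply_apply]
  · apply vertPoint_injective (T := T) (k := k)
    rw [← hf, ← hf', e.apply_symm_apply]
  · exact hT.adj_of_apply_eq hI e.symm h ((e.symm_apply_eq).mpr (hf u).symm)
      ((e.symm_apply_eq).mpr (hf v).symm)
  · exact hT.adj_of_apply_eq hI e h (hf u) (hf v)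

end IsLooseTree

end LooseGraph

namespace LooseGraph

open MvPolynomial

variable {V E : Type*} {T : LooseGraph V E} {k : Type*} [Field k] [DecidableEq V] [DecidableEq E]
  [Fintype V] [Fintype E]

theorem mem_edgeLine_iff {u v : V} {q : T.points k} :
    q ∈ T.edgeLine k u v ↔
      ∀ a, a ≠ .inl u → a ≠ .inl v → X a ∈ q.1.asHomogeneousIdeal := by
  change (∀ c : T.CompVert → k, _ → _) ↔ _
  constructor
  · intro h a hau hav
    have h1 := h (Pi.single a 1) fun x hx => by
      have h2 : ∑ b, (Pi.single a 1 : T.CompVert → k) b * x b = x a := by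
        simp [Pi.single_apply]
      rw [h2]
      rw [edgeSpan, Submodule.mem_span_pair] at hx
      obtain ⟨r, s, rfl⟩ := hx
      simp [hau, hav]
    rw [Finset.sum_eq_single a (fun b _ hb => by simp [Pi.single_eq_of_ne hb])
      (fun h => absurd (Finset.mem_univ a) h)] at h1
    simpa using h1
  · intro h c hc
    have hu := hc _ (Submodule.subset_span (Set.mem_insert _ _))
    have hv := hc _ (Submodule.subset_span (Set.mem_insert_of_mem _ rfl))
    simp only [vertVec, Pi.single_apply, mul_ite, mul_one, mul_zero, Finset.sum_ite_eq',
      Finset.mem_univ, if_true] at hu hv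
    refine Ideal.sum_mem q.1.asHomogeneousIdeal.toIdeal fun a _ => ?_
    by_cases hau : a = .inl u
    · rw [hau, hu, map_zero, zero_mul]; exact zero_mem _
    by_cases hav : a = .inl v
    · rw [hav, hv, map_zero, zero_mul]; exact zero_mem _
    exact Ideal.mul_mem_left _ _ (h a hau hav)

theorem IsLooseTree.mem_edgeLine_iff_gen_le (hT : T.IsLooseTree) {u v : V}
    (huv : T.graph.Adj u v) {q : T.points k} :
    q ∈ T.edgeLine k u v ↔ T.gen k u ≤ q ∧ T.gen k v ≤ q := by
  rw [mem_edgeLine_iff]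
  constructor
  · intro h
    constructor <;> refine starGen_le_iff.mpr fun a ha => h a ?_ ?_ <;> rintro rfl <;>
      refine ha (inl_mem_star.mpr ?_)
    exacts [.inl rfl, .inr huv, .inr huv.symm, .inl rfl]
  · rintro ⟨h1, h2⟩ a hau hav
    by_cases ha : a ∈ T.star u
    · refine starGen_le_iff.mp h2 a fun ha' => ?_
      exact (hT.mem_star_inter_of_adj huv ha ha').elim hau hav
    · exact starGen_le_iff.mp h1 a ha

omit [DecidableEq V] [DecidableEq E] [Fintype V] [Fintype E] in
theorem le_iff_specializes {p q : T.points k} : p ≤ q ↔ p ⤳ q := by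
  rw [subtype_specializes_iff, specializes_iff_mem_closure,
    ← ProjectiveSpectrum.le_iff_mem_closure]
  rfl

omit [DecidableEq V] [DecidableEq E] [Fintype V] [Fintype E] in
theorem IsTopological.le_iff {g : Equiv.Perm (T.points k)} (hg : T.IsTopological k g)
    {p q : T.points k} : g p ≤ g q ↔ p ≤ q := by
  rw [le_iff_specializes, le_iff_specializes]
  exact ⟨fun h => by simpa using h.map hg.2, fun h => h.map hg.1⟩

/-- The action of a homeomorphism on the embedded inner tree. -/
theorem IsLooseTree.exists_induces_of_isTopological (hT : T.IsLooseTree)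
    (hI : 2 ≤ T.inner.ncard) {g : Equiv.Perm (T.points k)} (hg : T.IsTopological k g) :
    ∃ α ∈ T.embeddedInnerAut, LooseGraph.Induces g α := by
  let e : T.points k ≃o T.points k := ⟨g, hg.le_iff⟩
  obtain ⟨β, hβ, hadj, hdeg⟩ := hT.exists_perm_of_orderIso hI e
  obtain ⟨α, hα, hαβ⟩ := hT.exists_embeddedInnerAut hadj hdeg
  refine ⟨α, hα, fun v => ?_, fun u v huv => ?_⟩
  · rw [hαβ]; exact hβ v
  · have hgen : ∀ w : T.inner, g (T.gen k w) = T.gen k (α w) := fun w => by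
      rw [hαβ]
      exact (hT.apply_gen_eq hI e w.2 (hβ w)).2
    ext q
    have huv' : T.graph.Adj (α u) (α v) := α.map_adj_iff.mpr huv
    rw [hT.mem_edgeLine_iff_gen_le huv', Set.mem_image_equiv,
      hT.mem_edgeLine_iff_gen_le (show T.graph.Adj u v from huv), ← hgen, ← hgen]
    rw [← hg.le_iff, ← hg.le_iff (p := T.gen k v), Equiv.apply_symm_apply]

end LooseGraph

/-! ### The lines of `X_k` -/

section LinearAlgebra

variable {k M : Type*} [Field k] [AddCommGroup M] [Module k M]

theorem Submodule.span_pair_eq_of_finrank_eq_two {W : Submodule k M} (hW : Module.finrank k W = 2)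
    {x y : M} (hx : x ∈ W) (hy : y ∈ W) (hx0 : x ≠ 0) (hxy : y ∉ Submodule.span k {x}) :
    Submodule.span k {x, y} = W := by
  have : FiniteDimensional k W := Module.finite_of_finrank_pos (by omega)
  refine Submodule.eq_of_le_of_finrank_eq (Submodule.span_le.mpr ?_) ?_
  · rintro z (rfl | rfl)
    exacts [hx, hy]
  · have hli : LinearIndependent k ![x, y] := (LinearIndependent.pair_iff' hx0).mpr fun a ha =>
      hxy (ha ▸ Submodule.smul_mem _ _ (Submodule.mem_span_singleton_self x))
    have := finrank_span_eq_card hli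
    rw [Matrix.range_cons_cons_empty, Fintype.card_fin] at this
    rw [hW, this]

theorem Submodule.finrank_span_pair {x y : M} (hx0 : x ≠ 0) (hxy : y ∉ Submodule.span k {x}) :
    Module.finrank k (Submodule.span k {x, y}) = 2 := by
  have hli : LinearIndependent k ![x, y] := (LinearIndependent.pair_iff' hx0).mpr fun a ha =>
    hxy (ha ▸ Submodule.smul_mem _ _ (Submodule.mem_span_singleton_self x))
  have := finrank_span_eq_card hli
  rwa [Matrix.range_cons_cons_empty, Fintype.card_fin] at this

theorem Submodule.exists_notMem_span_singleton {W : Submodule k M} (hW : Module.finrank k W = 2)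
    (x : M) : ∃ y ∈ W, y ∉ Submodule.span k {x} := by
  by_contra! h
  have h1 := Submodule.finrank_mono (show W ≤ Submodule.span k {x} from h)
  have h2 := finrank_span_le_card (R := k) ({x} : Set M)
  simp at h2
  omega

theorem exists_linearForm {σ : Type*} [Fintype σ] {x y : σ → k} (h : x ∉ Submodule.span k {y}) :
    ∃ c : σ → k, ∑ a, c a * x a = 1 ∧ ∑ a, c a * y a = 0 := by
  classical
  obtain ⟨f, hf, hle⟩ := Submodule.exists_le_ker_of_notMem h
  have hy : f y = 0 := hle (Submodule.mem_span_singleton_self y)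
  have key : ∀ z, ∑ a, f (Pi.single a 1) * z a = f z := by
    intro z
    rw [LinearMap.pi_apply_eq_sum_univ f z]
    refine Finset.sum_congr rfl fun a _ => ?_
    rw [smul_eq_mul, mul_comm]
    congr 2
    ext b
    simp [Pi.single_apply, eq_comm]
  refine ⟨fun a => (f x)⁻¹ * f (Pi.single a 1), ?_, ?_⟩ <;>
    simp only [mul_assoc, ← Finset.mul_sum, key]
  · exact inv_mul_cancel₀ hf
  · rw [hy, mul_zero]

end LinearAlgebra

section LinePoints

open MvPolynomial

variable {σ k : Type*} [Field k]

/-- The linear form with coefficients `c`. -/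
noncomputable def linForm [Fintype σ] (c : σ → k) : MvPolynomial σ k := ∑ a, C (c a) * X a

theorem isHomogeneous_linForm [Fintype σ] (c : σ → k) : (linForm c).IsHomogeneous 1 :=
  IsHomogeneous.sum _ _ _ fun a _ => by
    simpa using (isHomogeneous_C σ (c a)).mul (isHomogeneous_X k a)

/-- The coordinates of the point of the line through `x` and `y` with parameter `t`. -/
def linePt {B : Type*} [CommRing B] [Algebra k B] (x y : σ → k) (t : B) (a : σ) : B :=
  algebraMap k B (x a) + algebraMap k B (y a) * t

theorem aeval_linePt_linForm [Fintype σ] {B : Type*} [CommRing B] [Algebra k B] (x y : σ → k)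
    (t : B)
    (c : σ → k) : aeval (linePt x y t) (linForm c) =
      algebraMap k B (∑ a, c a * x a) + algebraMap k B (∑ a, c a * y a) * t := by
  simp only [linForm, map_sum, map_mul, aeval_X, algHom_C, linePt, Finset.sum_mul,
    ← Finset.sum_add_distrib]
  exact Finset.sum_congr rfl fun a _ => by ring

theorem linePt_ne_zero [Fintype σ] {B : Type*} [CommRing B] [IsDomain B] [Algebra k B] {x y : σ → k}
    (h : x ∉ Submodule.span k {y}) (t : B) : linePt x y t ≠ 0 := by
  intro h0
  obtain ⟨c, h1, h2⟩ := exists_linearForm h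
  have h3 := aeval_linePt_linForm x y t c
  rw [h1, h2, h0] at h3
  simp [linForm] at h3

theorem domPoint_mem_linSpace [Fintype σ] {B : Type*} [CommRing B] [IsDomain B] [Algebra k B]
    {x y : σ → k} {t : B} (h : linePt x y t ≠ 0) {W : Submodule k (σ → k)} (hx : x ∈ W)
    (hy : y ∈ W) : domPoint (linePt x y t) h ∈ linSpace W := by
  intro c hc
  change linForm c ∈ _
  rw [mem_domPoint_iff (isHomogeneous_linForm c), aeval_linePt_linForm, hc x hx, hc y hy]
  simp

/-- Every line of projective space has, besides its generic point, a point at which only those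
coordinates vanish that vanish on the whole line. -/
theorem exists_ne_generic [Fintype σ] {x y : σ → k} (h : x ∉ Submodule.span k {y})
    (h' : y ∉ Submodule.span k {x})
    (hη : linePt x y (Polynomial.X : Polynomial k) ≠ 0) {W : Submodule k (σ → k)} (hx : x ∈ W)
    (hy : y ∈ W) :
    ∃ q ∈ linSpace W, q ≠ domPoint (linePt x y (Polynomial.X : Polynomial k)) hη ∧
      ∀ a, X a ∈ q.asHomogeneousIdeal ↔
        X a ∈ (domPoint (linePt x y (Polynomial.X : Polynomial k)) hη :
          ProjectiveSpectrum (polyGrading σ k)).asHomogeneousIdeal := by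
  classical
  obtain ⟨μ, hμ, hcop⟩ := Polynomial.exists_irreducible_isCoprime
    (P := ∏ a ∈ Finset.univ.filter (fun a => linePt x y (Polynomial.X : Polynomial k) a ≠ 0),
      linePt x y (Polynomial.X : Polynomial k) a)
    (Finset.prod_ne_zero_iff.mpr fun a ha => (Finset.mem_filter.mp ha).2)
  have : Fact (Irreducible μ) := ⟨hμ⟩
  have hmk : ∀ a, linePt x y (AdjoinRoot.root μ) a =
      AdjoinRoot.mk μ (linePt x y (Polynomial.X : Polynomial k) a) := by
    intro a
    simp only [linePt, map_add, map_mul, AdjoinRoot.mk_X]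
    rfl
  refine ⟨domPoint (linePt x y (AdjoinRoot.root μ)) (linePt_ne_zero h _),
    domPoint_mem_linSpace _ hx hy, ?_, fun a => ?_⟩
  · intro heq
    obtain ⟨c, h1, h2⟩ := exists_linearForm h
    obtain ⟨d, h3, h4⟩ := exists_linearForm h'
    have hh := isHomogeneous_homogForm μ (isHomogeneous_linForm c) (isHomogeneous_linForm d)
    have h5 : homogForm μ (linForm c) (linForm d) ∈
        (domPoint (linePt x y (AdjoinRoot.root μ)) (linePt_ne_zero h _) :
          ProjectiveSpectrum (polyGrading σ k)).asHomogeneousIdeal := by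
      rw [mem_domPoint_iff hh, aeval_homogForm_of_eq_one, aeval_linePt_linForm, h3, h4]
      · simp
      · rw [aeval_linePt_linForm, h1, h2]; simp
    rw [heq, mem_domPoint_iff hh, aeval_homogForm_of_eq_one, aeval_linePt_linForm, h3, h4] at h5
    · rw [map_zero, map_one, zero_add, one_mul, Polynomial.aeval_X_left_apply] at h5
      exact hμ.ne_zero h5
    · rw [aeval_linePt_linForm, h1, h2]; simp
  · rw [X_mem_domPoint_iff, X_mem_domPoint_iff, hmk, AdjoinRoot.mk_eq_zero]
    refine ⟨fun hd => ?_, fun h0 => by rw [h0]; exact dvd_zero _⟩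
    by_contra h0
    have hd' : μ ∣ ∏ a ∈ Finset.univ.filter
        (fun a => linePt x y (Polynomial.X : Polynomial k) a ≠ 0),
          linePt x y (Polynomial.X : Polynomial k) a :=
      hd.trans (Finset.dvd_prod_of_mem _ (by simp [h0]))
    exact hμ.not_isUnit (hcop.isUnit_of_dvd' dvd_rfl hd')

end LinePoints

namespace LooseGraph

open MvPolynomial

variable {V E : Type*} {T : LooseGraph V E} {k : Type*} [Field k]

/-- The linear subspace spanned by the coordinate vectors in the star of a vertex. -/
def starSpace (T : LooseGraph V E) (k : Type*) [Field k] (v : V) :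
    Submodule k (T.CompVert → k) where
  carrier := {x | ∀ a ∉ T.star v, x a = 0}
  add_mem' hx hy a ha := by simp [hx a ha, hy a ha]
  zero_mem' _ _ := rfl
  smul_mem' c x hx a ha := by simp [hx a ha]

theorem mem_starSpace {v : V} {x : T.CompVert → k} :
    x ∈ T.starSpace k v ↔ ∀ a ∉ T.star v, x a = 0 := Iff.rfl

theorem ratPoint_mem_points_iff {x : T.CompVert → k} (hx : x ≠ 0) :
    ratPoint x hx ∈ T.points k ↔ ∃ v, x ∈ T.starSpace k v ∧ x (.inl v) ≠ 0 := by
  rw [points, Set.mem_iUnion]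
  refine exists_congr fun v => ⟨fun h => ⟨fun a ha => ?_, fun h0 => ?_⟩, fun h => ?_⟩
  · exact (X_mem_ratPoint_iff x hx a).mp (X_mem_of_mem_localAffine h ha)
  · exact h.1 ((X_mem_ratPoint_iff x hx _).mpr h0)
  · exact mem_localAffine (fun h0 => h.2 ((X_mem_ratPoint_iff x hx _).mp h0))
      fun a ha => (X_mem_ratPoint_iff x hx _).mpr (h.1 a ha)

theorem exists_mem_eq_zero {W : Submodule k (T.CompVert → k)} (hW : Module.finrank k W = 2)
    {x : T.CompVert → k} {a : T.CompVert} (hx : x ∈ W) (ha : x a ≠ 0) :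
    ∃ y ∈ W, y a = 0 ∧ y ≠ 0 ∧ y ∉ Submodule.span k {x} ∧ Submodule.span k {x, y} = W := by
  obtain ⟨z, hz, hzx⟩ := Submodule.exists_notMem_span_singleton hW x
  have hx0 : x ≠ 0 := fun h => ha (by rw [h]; rfl)
  have hy : z - (z a / x a) • x ∉ Submodule.span k {x} := fun h =>
    hzx ((Submodule.sub_mem_iff_left _
      (Submodule.smul_mem _ _ (Submodule.mem_span_singleton_self x))).mp h)
  have hyW : z - (z a / x a) • x ∈ W := W.sub_mem hz (W.smul_mem _ hx)
  refine ⟨_, hyW, by simp [ha], fun h0 => hy (h0 ▸ zero_mem _), hy,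
    Submodule.span_pair_eq_of_finrank_eq_two hW hx hyW hx0 hy⟩

variable [Fintype V] [Fintype E]

theorem X_mem_of_mem_linSpace {W : Submodule k (T.CompVert → k)} {p : T.Ambient k}
    (hp : p ∈ linSpace W) {a : T.CompVert} (ha : ∀ x ∈ W, x a = 0) :
    X a ∈ p.asHomogeneousIdeal := by
  classical
  have h1 := hp (Pi.single a 1) fun x hx => by
    rw [Finset.sum_eq_single a (fun b _ hb => by simp [Pi.single_eq_of_ne hb])
      (fun h => absurd (Finset.mem_univ a) h), ha x hx, mul_zero]
  rw [Finset.sum_eq_single a (fun b _ hb => by simp [Pi.single_eq_of_ne hb])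
    (fun h => absurd (Finset.mem_univ a) h)] at h1
  simpa using h1

/-- The lines of `X_k` are the affine lines of the affine spaces at the vertices: if the generic
point of a line lies in such an affine space, then the line has at most one point outside it. -/
theorem isLine_iff {W : Submodule k (T.CompVert → k)} (hW : Module.finrank k W = 2) :
    (linSpace W ⊆ T.points k ∨ ∃ p, linSpace W \ T.points k = {p}) ↔
      ∃ v, W ≤ T.starSpace k v ∧ ∃ x ∈ W, x (.inl v) ≠ 0 := by
  classical
  constructor
  · intro h
    obtain ⟨x, hxW, hx⟩ := Submodule.exists_notMem_span_singleton hW 0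
    have hx0 : x ≠ 0 := by rintro rfl; exact hx (zero_mem _)
    obtain ⟨y, hyW, hy⟩ := Submodule.exists_notMem_span_singleton hW x
    have hx' : x ∉ Submodule.span k {y} := by
      intro h1
      obtain ⟨c, rfl⟩ := Submodule.mem_span_singleton.mp h1
      have hc : c ≠ 0 := by rintro rfl; exact hx0 (zero_smul _ _)
      exact hy (Submodule.mem_span_singleton.mpr
        ⟨c⁻¹, by rw [smul_smul, inv_mul_cancel₀ hc, one_smul]⟩)
    have hspan := Submodule.span_pair_eq_of_finrank_eq_two hW hxW hyW hx0 hy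
    have hη := linePt_ne_zero hx' (Polynomial.X : Polynomial k)
    set η : T.Ambient k := domPoint (linePt x y (Polynomial.X : Polynomial k)) hη with hηdef
    obtain ⟨q, hq, hqη, hqX⟩ := exists_ne_generic hx' hy hη hxW hyW
    have hηW : η ∈ linSpace W := domPoint_mem_linSpace hη hxW hyW
    have hηpts : η ∈ T.points k := by
      by_contra hno
      rcases h with h | ⟨p, hp⟩
      · exact hno (h hηW)
      · have h1 : η = p := by
          have : η ∈ linSpace W \ T.points k := ⟨hηW, hno⟩
          rwa [hp] at this
        have h2 : q ∈ T.points k := by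
          by_contra hno'
          have : q ∈ linSpace W \ T.points k := ⟨hq, hno'⟩
          rw [hp, ← h1] at this
          exact hqη this
        obtain ⟨v, hv⟩ := Set.mem_iUnion.mp h2
        refine hno (localAffine_subset_points v (mem_localAffine (fun h => hv.1 ?_) fun a ha => ?_))
        · exact (hqX _).mpr h
        · exact (hqX _).mp (X_mem_of_mem_localAffine hv ha)
    obtain ⟨v, hv⟩ := Set.mem_iUnion.mp hηpts
    have hXη : ∀ a, X a ∈ η.asHomogeneousIdeal ↔ x a = 0 ∧ y a = 0 := by
      intro a
      rw [hηdef, X_mem_domPoint_iff, linePt]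
      constructor
      · intro h0
        have h1 := congrArg (Polynomial.coeff · 0) h0
        have h2 := congrArg (Polynomial.coeff · 1) h0
        simp [Polynomial.coeff_C] at h1 h2
        exact ⟨h1, h2⟩
      · rintro ⟨h1, h2⟩
        rw [h1, h2]; simp
    refine ⟨v, ?_, ?_⟩
    · rw [← hspan, Submodule.span_le]
      rintro z (rfl | rfl) a ha
      · exact ((hXη a).mp (X_mem_of_mem_localAffine hv ha)).1
      · exact ((hXη a).mp (X_mem_of_mem_localAffine hv ha)).2
    · by_contra! h0
      exact hv.1 ((hXη _).mpr ⟨h0 x hxW, h0 y hyW⟩)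
  · rintro ⟨v, hWv, x, hxW, hxv⟩
    obtain ⟨y, hyW, hyv, hy0, -, hspan⟩ := exists_mem_eq_zero hW hxW hxv
    have key : ∀ p ∈ linSpace W, p ∈ T.points k ∨ p = ratPoint y hy0 := by
      intro p hp
      have hstar : ∀ a ∉ T.star v, X a ∈ p.asHomogeneousIdeal := fun a ha =>
        X_mem_of_mem_linSpace hp fun z hz => hWv hz a ha
      by_cases hpv : X (.inl v) ∈ p.asHomogeneousIdeal
      · right
        refine eq_ratPoint hy0 fun a i => ?_
        -- modulo `X_v`, the form below is one that vanishes on `W`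
        set t := (y i * x a - y a * x i) / x (.inl v) with ht
        have h1 := hp (Pi.single a (y i) - Pi.single i (y a) - Pi.single (.inl v) t) ?_
        · have h2 : (∑ b, C ((Pi.single a (y i) - Pi.single i (y a) - Pi.single (.inl v) t :
              T.CompVert → k) b) * X b : MvPolynomial T.CompVert k) =
              C (y i) * X a - C (y a) * X i - C t * X (.inl v) := by
            simp only [Pi.sub_apply, map_sub, sub_mul, Finset.sum_sub_distrib]
            congr 1
            · congr 1
              · rw [Finset.sum_eq_single a (fun b _ hb => by simp [Pi.single_eq_of_ne hb])
                  (fun h => absurd (Finset.mem_univ a) h), Pi.single_eq_same]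
              · rw [Finset.sum_eq_single i (fun b _ hb => by simp [Pi.single_eq_of_ne hb])
                  (fun h => absurd (Finset.mem_univ i) h), Pi.single_eq_same]
            · rw [Finset.sum_eq_single (.inl v) (fun b _ hb => by simp [Pi.single_eq_of_ne hb])
                (fun h => absurd (Finset.mem_univ _) h), Pi.single_eq_same]
          rw [h2] at h1
          have h3 := Ideal.add_mem p.asHomogeneousIdeal.toIdeal h1
            (Ideal.mul_mem_left _ (C t) hpv)
          rwa [sub_add_cancel] at h3
        · have hsum : ∀ z : T.CompVert → k, ∑ b, (Pi.single a (y i) - Pi.single i (y a)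
              - Pi.single (.inl v) t : T.CompVert → k) b * z b =
              y i * z a - y a * z i - t * z (.inl v) := by
            intro z
            simp [sub_mul, Finset.sum_sub_distrib, Pi.single_apply]
          intro z hz
          rw [← hspan, Submodule.mem_span_pair] at hz
          obtain ⟨r, s, rfl⟩ := hz
          rw [hsum]
          simp only [Pi.add_apply, Pi.smul_apply, smul_eq_mul, hyv, ht]
          field_simp
          ring
      · exact .inl (localAffine_subset_points v (mem_localAffine hpv hstar))
    have hyL : ratPoint y hy0 ∈ linSpace W := by
      intro c hc
      change linForm c ∈ _
      rw [mem_ratPoint_iff (isHomogeneous_linForm c), ← hc y hyW]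
      simp [linForm]
    by_cases hyp : ratPoint y hy0 ∈ T.points k
    · left
      intro p hp
      rcases key p hp with h | rfl
      exacts [h, hyp]
    · right
      refine ⟨ratPoint y hy0, Set.ext fun p => ⟨fun h => ?_, ?_⟩⟩
      · exact (key p h.1).resolve_left h.2
      · rintro rfl
        exact ⟨hyL, hyp⟩

end LooseGraph

/-! ### Full lines -/

section Incidence

variable {P L P' L' : Type*} (I : P → L → Prop)

/-- Two points of an incidence structure are equal or on a common line. -/
def CollinearPts (p q : P) : Prop := p = q ∨ ∃ l, I p l ∧ I q l

/-- All points of the two lines are collinear. -/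
def LinesJoined (l m : L) : Prop := ∀ p q, I p l → I q m → CollinearPts I p q

/-- The line `l` has at least three points, and whenever the two lines `m₁` and `m₂` through a
point `p` meet `l` in two points, every line through two points of `m₁` and `m₂` meets `l`: there is
no point at infinity missing on `l`. -/
def IsFull (l : L) : Prop :=
  (∃ p q r, p ≠ q ∧ p ≠ r ∧ q ≠ r ∧ I p l ∧ I q l ∧ I r l) ∧
  ∀ m₁ m₂ n p a₁ a₂ b₁ b₂, I p m₁ → I a₁ m₁ → I b₁ m₁ → I p m₂ → I a₂ m₂ → I b₂ m₂ →
    a₁ ≠ a₂ → b₁ ≠ b₂ → I a₁ l → I a₂ l → I b₁ n → I b₂ n → ∃ c, I c l ∧ I c n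

/-- The point `p` lies on two full lines all whose points are collinear. -/
def IsVertexLike (p : P) : Prop :=
  ∃ l m, l ≠ m ∧ I p l ∧ I p m ∧ IsFull I l ∧ IsFull I m ∧ LinesJoined I l m

/-- The points other than `q` on a full line through `q` that is joined to a line through `p` and
`q`. -/
def localPart (p q : P) : Set P :=
  {r | r ≠ q ∧ ∃ l, IsFull I l ∧ I r l ∧ I q l ∧ ∃ m, I p m ∧ I q m ∧ LinesJoined I l m}

/-- The set `A` is generated, with respect to the lines, by at most `n` of its points. -/
def IsGeneratedBy (A : Set P) (n : ℕ) : Prop :=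
  ∃ F : Set P, F ⊆ A ∧ F.Finite ∧ F.ncard ≤ n ∧ ∀ Y : Set P, F ⊆ Y →
    (∀ p q r l, p ∈ Y → q ∈ Y → p ≠ q → r ∈ A → I p l → I q l → I r l → r ∈ Y) → A ⊆ Y

variable {I} {I' : P' → L' → Prop} (f : P ≃ P') (g : L ≃ L')
  (h : ∀ p l, I' (f p) (g l) ↔ I p l)
include h

theorem collinearPts_map_iff {p q : P} : CollinearPts I' (f p) (f q) ↔ CollinearPts I p q := by
  simp only [CollinearPts, g.surjective.exists, h, f.injective.eq_iff]

theorem linesJoined_map_iff {l m : L} : LinesJoined I' (g l) (g m) ↔ LinesJoined I l m := by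
  simp only [LinesJoined, f.surjective.forall, h, collinearPts_map_iff f g h]

theorem isFull_map_iff {l : L} : IsFull I' (g l) ↔ IsFull I l := by
  simp only [IsFull, f.surjective.forall, f.surjective.exists, g.surjective.forall, h,
    f.injective.ne_iff]

theorem isVertexLike_map_iff {p : P} : IsVertexLike I' (f p) ↔ IsVertexLike I p := by
  simp only [IsVertexLike, g.surjective.exists, h, g.injective.ne_iff, isFull_map_iff f g h,
    linesJoined_map_iff f g h]

theorem mem_localPart_map_iff {p q r : P} :
    f r ∈ localPart I' (f p) (f q) ↔ r ∈ localPart I p q := by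
  simp only [localPart, Set.mem_ofPred_eq, g.surjective.exists, h, f.injective.ne_iff,
    isFull_map_iff f g h, linesJoined_map_iff f g h]

theorem IsGeneratedBy.map {A : Set P} {n : ℕ} (hA : IsGeneratedBy I A n) :
    IsGeneratedBy I' (f '' A) n := by
  obtain ⟨F, hFA, hF, hn, hgen⟩ := hA
  refine ⟨f '' F, Set.image_mono hFA, hF.image f,
    (Set.ncard_image_of_injective F f.injective).trans_le hn, fun Y hFY hY => ?_⟩
  rw [Set.image_subset_iff] at hFY ⊢
  refine hgen _ hFY fun p q r l hp hq hpq hr h1 h2 h3 => ?_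
  exact hY (f p) (f q) (f r) (g l) hp hq (f.injective.ne hpq) (Set.mem_image_of_mem f hr)
    ((h _ _).mpr h1) ((h _ _).mpr h2) ((h _ _).mpr h3)

end Incidence

namespace LooseGraph

variable {V E : Type*} {T : LooseGraph V E} {k : Type*} [Field k]

theorem toAmbient_mem_points_iff {x : T.CompVert → k} (hx : x ≠ 0) :
    T.toAmbient (Projectivization.mk k x hx) ∈ T.points k ↔
      ∃ v, x ∈ T.starSpace k v ∧ x (.inl v) ≠ 0 := by
  obtain ⟨c, hc⟩ := Projectivization.exists_smul_eq_mk_rep k x hx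
  rw [toAmbient, ratPoint_mem_points_iff, ← hc]
  refine exists_congr fun v => and_congr ?_ ?_
  · exact Submodule.smul_mem_iff' _ _
  · simp [Units.smul_def]

/-- The rational point of `X_k` with homogeneous coordinates `x`. -/
def mkPt (x : T.CompVert → k) (hx : x ≠ 0)
    (h : ∃ v, x ∈ T.starSpace k v ∧ x (.inl v) ≠ 0) : T.RatPoints k :=
  ⟨Projectivization.mk k x hx, (toAmbient_mem_points_iff hx).mpr h⟩

theorem exists_mkPt_eq (p : T.RatPoints k) : ∃ x hx h, p = mkPt (T := T) (k := k) x hx h := by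
  obtain ⟨p, hp⟩ := p
  induction p using Projectivization.ind with
  | h x hx => exact ⟨x, hx, (toAmbient_mem_points_iff hx).mp hp, rfl⟩

theorem mkPt_eq_mkPt_iff {x y : T.CompVert → k} {hx hy h h'} :
    mkPt (T := T) x hx h = mkPt y hy h' ↔ x ∈ Submodule.span k {y} := by
  rw [mkPt, mkPt, Subtype.mk.injEq, Projectivization.mk_eq_mk_iff', Submodule.mem_span_singleton]

variable [Fintype V] [Fintype E]

/-- Incidence between the rational points and the lines of `X_k`. -/
def IncPt (T : LooseGraph V E) (k : Type*) [Field k] (p : T.RatPoints k)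
    (l : T.Lines k) : Prop := p.1.submodule ≤ l.1

theorem incPt_mkPt_iff {x : T.CompVert → k} {hx h} {l : T.Lines k} :
    IncPt T k (mkPt x hx h) l ↔ x ∈ l.1 := by
  rw [IncPt, mkPt, Projectivization.submodule_mk, Submodule.span_singleton_le_iff_mem]

theorem exists_starSpace (l : T.Lines k) :
    ∃ v, l.1 ≤ T.starSpace k v ∧ ∃ x ∈ l.1, x (.inl v) ≠ 0 :=
  (isLine_iff l.2.1).mp l.2.2

theorem exists_line {v : V} {x y : T.CompVert → k} (hx : x ∈ T.starSpace k v)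
    (hxv : x (.inl v) ≠ 0) (hy : y ∈ T.starSpace k v) (hxy : y ∉ Submodule.span k {x}) :
    ∃ l : T.Lines k, l.1 = Submodule.span k {x, y} := by
  have hx0 : x ≠ 0 := fun h => hxv (by rw [h]; rfl)
  have h2 := Submodule.finrank_span_pair hx0 hxy
  refine ⟨⟨Submodule.span k {x, y}, h2, (isLine_iff h2).mpr ⟨v, ?_, x, ?_, hxv⟩⟩, rfl⟩
  · rw [Submodule.span_le]
    rintro z (rfl | rfl)
    exacts [hx, hy]
  · exact Submodule.subset_span (Set.mem_insert _ _)

theorem line_eq {l : T.Lines k} {x y : T.CompVert → k} (hx : x ∈ l.1) (hy : y ∈ l.1)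
    (hx0 : x ≠ 0) (hxy : y ∉ Submodule.span k {x}) : l.1 = Submodule.span k {x, y} :=
  (Submodule.span_pair_eq_of_finrank_eq_two l.2.1 hx hy hx0 hxy).symm

theorem not_mem_span_symm {M : Type*} [AddCommGroup M] [Module k M] {x y : M} (hx : x ≠ 0)
    (h : y ∉ Submodule.span k {x}) : x ∉ Submodule.span k {y} := by
  intro h1
  obtain ⟨c, rfl⟩ := Submodule.mem_span_singleton.mp h1
  have hc : c ≠ 0 := by rintro rfl; exact hx (zero_smul _ _)
  exact h (Submodule.mem_span_singleton.mpr
    ⟨c⁻¹, by rw [smul_smul, inv_mul_cancel₀ hc, one_smul]⟩)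

theorem collinearPts_mkPt_of {v : V} {x y : T.CompVert → k} {hx hy h h'}
    (hxs : x ∈ T.starSpace k v) (hys : y ∈ T.starSpace k v)
    (hv : x (.inl v) ≠ 0 ∨ y (.inl v) ≠ 0) :
    CollinearPts (IncPt T k) (mkPt x hx h) (mkPt y hy h') := by
  by_cases hxy : x ∈ Submodule.span k {y}
  · exact .inl (mkPt_eq_mkPt_iff.mpr hxy)
  right
  have key : ∃ l : T.Lines k, x ∈ l.1 ∧ y ∈ l.1 := by
    rcases hv with hv | hv
    · obtain ⟨l, hl⟩ := exists_line hxs hv hys (not_mem_span_symm hy hxy)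
      exact ⟨l, by rw [hl]; exact Submodule.subset_span (by simp),
        by rw [hl]; exact Submodule.subset_span (by simp)⟩
    · obtain ⟨l, hl⟩ := exists_line hys hv hxs hxy
      exact ⟨l, by rw [hl]; exact Submodule.subset_span (by simp),
        by rw [hl]; exact Submodule.subset_span (by simp)⟩
  obtain ⟨l, h1, h2⟩ := key
  exact ⟨l, incPt_mkPt_iff.mpr h1, incPt_mkPt_iff.mpr h2⟩

theorem exists_of_collinearPts_mkPt {x y : T.CompVert → k} {hx hy h h'}
    (hc : CollinearPts (IncPt T k) (mkPt x hx h) (mkPt y hy h')) :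
    ∃ v, x ∈ T.starSpace k v ∧ y ∈ T.starSpace k v ∧ (x (.inl v) ≠ 0 ∨ y (.inl v) ≠ 0) := by
  by_cases hxy : x ∈ Submodule.span k {y}
  · obtain ⟨c, rfl⟩ := Submodule.mem_span_singleton.mp hxy
    obtain ⟨v, h1, h2⟩ := h'
    exact ⟨v, Submodule.smul_mem _ _ h1, h1, .inr h2⟩
  rcases hc with hc | ⟨l, h1, h2⟩
  · exact absurd (mkPt_eq_mkPt_iff.mp hc) hxy
  rw [incPt_mkPt_iff] at h1 h2
  obtain ⟨v, hlv, z, hz, hzv⟩ := exists_starSpace l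
  refine ⟨v, hlv h1, hlv h2, ?_⟩
  by_contra! h0
  rw [line_eq h2 h1 hy hxy, Submodule.mem_span_pair] at hz
  obtain ⟨r, s, rfl⟩ := hz
  exact hzv (by simp [h0])

variable [DecidableEq V] [DecidableEq E]

omit [Fintype V] [Fintype E] in
theorem single_mem_starSpace {v : V} {a : T.CompVert} (ha : a ∈ T.star v) (c : k) :
    (Pi.single a c : T.CompVert → k) ∈ T.starSpace k v := fun b hb => by
  rw [Pi.single_eq_of_ne]
  rintro rfl
  exact hb ha

omit [Fintype V] [Fintype E] [DecidableEq V] [DecidableEq E] in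
theorem mem_star_of_mem_starSpace {v : V} {x : T.CompVert → k} (hx : x ∈ T.starSpace k v)
    {a : T.CompVert} (ha : x a ≠ 0) : a ∈ T.star v := by
  by_contra h
  exact ha (hx a h)

omit [Fintype V] [Fintype E] in
theorem mem_span_single {x : T.CompVert → k} {a : T.CompVert} (h : ∀ b, b ≠ a → x b = 0) :
    x ∈ Submodule.span k {(Pi.single a 1 : T.CompVert → k)} := by
  refine Submodule.mem_span_singleton.mpr ⟨x a, funext fun b => ?_⟩
  by_cases hb : b = a
  · subst hb; simp
  · simp [hb, h b hb]

omit [Fintype V] [Fintype E] in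
/-- The vertex `w` of `T`, as a rational point of `X_k`, is given by its coordinate vector. -/
theorem exists_starSpace_vertVec (w : V) :
    ∃ v, T.vertVec k w ∈ T.starSpace k v ∧ T.vertVec k w (.inl v) ≠ 0 :=
  ⟨w, single_mem_starSpace (inl_mem_star_self w) 1, by simp⟩

omit [Fintype V] [Fintype E] in
theorem vertRatPoint_eq (w : V) : T.vertRatPoint k w =
    mkPt (T.vertVec k w) (T.vertVec_ne_zero k w) (exists_starSpace_vertVec w) := rfl

theorem incPt_vertRatPoint_iff {w : V} {l : T.Lines k} :
    IncPt T k (T.vertRatPoint k w) l ↔ T.vertVec k w ∈ l.1 := by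
  rw [vertRatPoint_eq, incPt_mkPt_iff]

/-- The line `l` is contained in the projective space at the vertex `v`, meets the affine space at
`v`, and contains the adjacent vertex `w`. -/
def FullAt (v w : V) (l : T.Lines k) : Prop :=
  T.graph.Adj v w ∧ T.vertVec k w ∈ l.1 ∧ l.1 ≤ T.starSpace k v ∧ ∃ x ∈ l.1, x (.inl v) ≠ 0

theorem FullAt.eq_span {v w : V} {l : T.Lines k} (h : FullAt v w l) {x : T.CompVert → k}
    (hx : x ∈ l.1) (hxv : x (.inl v) ≠ 0) : l.1 = Submodule.span k {x, T.vertVec k w} := by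
  refine line_eq hx h.2.1 (fun h0 => hxv (by rw [h0]; rfl)) fun h1 => ?_
  obtain ⟨c, hc⟩ := Submodule.mem_span_singleton.mp h1
  have h2 := congrFun hc (.inl v)
  have h3 := congrFun hc (.inl w)
  simp [h.1.ne, hxv] at h2
  simp [h2] at h3

theorem FullAt.mem_span {v w : V} {l : T.Lines k} (h : FullAt v w l) {x : T.CompVert → k}
    (hx : x ∈ l.1) (hxv : x (.inl v) = 0) : x ∈ Submodule.span k {T.vertVec k w} := by
  obtain ⟨z, hz, hzv⟩ := h.2.2.2
  rw [h.eq_span hz hzv, Submodule.mem_span_pair] at hx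
  obtain ⟨r, s, rfl⟩ := hx
  have : r = 0 := by simpa [h.1.ne, hzv] using hxv
  rw [this, zero_smul, zero_add]
  exact Submodule.smul_mem _ _ (Submodule.mem_span_singleton_self _)

theorem FullAt.exists_mem_starSpace {v w : V} {l : T.Lines k} (h : FullAt v w l)
    {x : T.CompVert → k} (hx : x ∈ l.1) (hx0 : x ≠ 0) :
    ∃ u, x ∈ T.starSpace k u ∧ x (.inl u) ≠ 0 := by
  by_cases hxv : x (.inl v) = 0
  · obtain ⟨c, rfl⟩ := Submodule.mem_span_singleton.mp (h.mem_span hx hxv)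
    have hc : c ≠ 0 := by rintro rfl; exact hx0 (zero_smul _ _)
    exact ⟨w, Submodule.smul_mem _ _ (single_mem_starSpace (inl_mem_star_self w) 1), by simpa⟩
  · exact ⟨v, h.2.2.1 hx, hxv⟩

theorem FullAt.joined {v w : V} {l m : T.Lines k} (hl : FullAt v w l) (hm : FullAt v w m) :
    LinesJoined (IncPt T k) l m := by
  intro p q hp hq
  obtain ⟨x, hx, h, rfl⟩ := exists_mkPt_eq p
  obtain ⟨y, hy, h', rfl⟩ := exists_mkPt_eq q
  rw [incPt_mkPt_iff] at hp hq
  by_cases hv : x (.inl v) ≠ 0 ∨ y (.inl v) ≠ 0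
  · exact collinearPts_mkPt_of (hl.2.2.1 hp) (hm.2.2.1 hq) hv
  · push Not at hv
    have h1 := hl.mem_span hp hv.1
    obtain ⟨c, rfl⟩ := Submodule.mem_span_singleton.mp (hm.mem_span hq hv.2)
    have hc : c ≠ 0 := by rintro rfl; exact hy (zero_smul _ _)
    left
    rw [mkPt_eq_mkPt_iff]
    obtain ⟨d, rfl⟩ := Submodule.mem_span_singleton.mp h1
    exact Submodule.mem_span_singleton.mpr ⟨d / c, by rw [smul_smul, div_mul_cancel₀ _ hc]⟩

omit [Fintype V] [Fintype E] [DecidableEq V] [DecidableEq E] in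
theorem mkPt_ne {x y : T.CompVert → k} {hx hy h h'} (hn : x ∉ Submodule.span k {y}) :
    mkPt (T := T) x hx h ≠ mkPt y hy h' := fun h0 => hn (mkPt_eq_mkPt_iff.mp h0)

/-- A line that misses no point of `X_k` is full, by the axiom of Veblen and Young in the ambient
projective space. -/
theorem FullAt.isFull {v w : V} {l : T.Lines k} (hl : FullAt v w l) : IsFull (IncPt T k) l := by
  constructor
  · obtain ⟨x, hx, hxv⟩ := hl.2.2.2
    have hx0 : x ≠ 0 := fun h => hxv (by rw [h]; rfl)
    have hvw : (Sum.inl v : T.CompVert) ≠ .inl w := fun h => hl.1.ne (Sum.inl.inj h)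
    have hxw : x + T.vertVec k w ∈ l.1 := l.1.add_mem hx hl.2.1
    have hxwv : (x + T.vertVec k w) (.inl v) ≠ 0 := by simpa [hl.1.ne] using hxv
    refine ⟨mkPt x hx0 ⟨v, hl.2.2.1 hx, hxv⟩, T.vertRatPoint k w,
      mkPt (x + T.vertVec k w) (fun h => hxwv (by rw [h]; rfl)) ⟨v, hl.2.2.1 hxw, hxwv⟩,
      ?_, ?_, ?_, incPt_mkPt_iff.mpr hx, incPt_vertRatPoint_iff.mpr hl.2.1, incPt_mkPt_iff.mpr hxw⟩
    · refine mkPt_ne (h' := exists_starSpace_vertVec w) fun h => ?_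
      obtain ⟨c, rfl⟩ := Submodule.mem_span_singleton.mp h
      simp [hvw] at hxv
    · refine mkPt_ne fun h => ?_
      obtain ⟨c, hc⟩ := Submodule.mem_span_singleton.mp h
      have h1 := congrFun hc (.inl v)
      simp only [Pi.smul_apply, Pi.add_apply, smul_eq_mul, vertVec, Pi.single_eq_of_ne hvw,
        add_zero] at h1
      have h2 := congrFun hc (.inl w)
      rw [mul_eq_right₀ hxv] at h1
      simp [h1] at h2
    · refine mkPt_ne (h := exists_starSpace_vertVec w) fun h => ?_
      obtain ⟨c, hc⟩ := Submodule.mem_span_singleton.mp h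
      have h1 := congrFun hc (.inl v)
      have h2 := congrFun hc (.inl w)
      simp only [Pi.smul_apply, Pi.add_apply, smul_eq_mul, vertVec, Pi.single_eq_of_ne hvw,
        add_zero, mul_eq_zero, hxv, or_false] at h1
      simp [h1] at h2
  · intro m₁ m₂ n p a₁ a₂ b₁ b₂ hp1 ha1 hb1 hp2 ha2 hb2 hane hbne hal1 hal2 hbn1 hbn2
    obtain ⟨p, hp, _, rfl⟩ := exists_mkPt_eq p
    obtain ⟨a₁, ha₁, _, rfl⟩ := exists_mkPt_eq a₁
    obtain ⟨a₂, ha₂, _, rfl⟩ := exists_mkPt_eq a₂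
    obtain ⟨b₁, hb₁, _, rfl⟩ := exists_mkPt_eq b₁
    obtain ⟨b₂, hb₂, _, rfl⟩ := exists_mkPt_eq b₂
    rw [incPt_mkPt_iff] at *
    rw [Ne, mkPt_eq_mkPt_iff] at hane hbne
    have hleq := line_eq hal2 hal1 ha₂ hane
    have hneq := line_eq hbn2 hbn1 hb₂ hbne
    have h3 : Module.finrank k ↥(m₁.1 ⊔ m₂.1) ≤ 3 := by
      have h1 := Submodule.finrank_sup_add_finrank_inf_eq m₁.1 m₂.1
      have h2 : 0 < Module.finrank k ↥(m₁.1 ⊓ m₂.1) := by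
        rw [Module.finrank_pos_iff_exists_ne_zero]
        exact ⟨⟨p, hp1, hp2⟩, fun h => hp (congrArg Subtype.val h)⟩
      rw [m₁.2.1, m₂.2.1] at h1
      omega
    have hle : l.1 ⊔ n.1 ≤ m₁.1 ⊔ m₂.1 := by
      refine sup_le ?_ ?_
      · rw [hleq, Submodule.span_le]
        rintro z (rfl | rfl)
        exacts [Submodule.mem_sup_right ha2, Submodule.mem_sup_left ha1]
      · rw [hneq, Submodule.span_le]
        rintro z (rfl | rfl)
        exacts [Submodule.mem_sup_right hb2, Submodule.mem_sup_left hb1]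
    have h4 : 0 < Module.finrank k ↥(l.1 ⊓ n.1) := by
      have h1 := Submodule.finrank_sup_add_finrank_inf_eq l.1 n.1
      have h2 := Submodule.finrank_mono hle
      rw [l.2.1, n.2.1] at h1
      omega
    obtain ⟨⟨c, hcl, hcn⟩, hc0⟩ := Module.finrank_pos_iff_exists_ne_zero.mp h4
    have hc0' : c ≠ 0 := fun h => hc0 (Subtype.ext h)
    exact ⟨mkPt c hc0' (hl.exists_mem_starSpace hcl hc0'), incPt_mkPt_iff.mpr hcl,
      incPt_mkPt_iff.mpr hcn⟩

namespace IsLooseTree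

variable (hT : T.IsLooseTree) (hI : 2 ≤ T.inner.ncard)
include hT

omit [Fintype V] [Fintype E] [DecidableEq V] [DecidableEq E] in
theorem eq_zero_of_mem_starSpace {u v : V} (huv : T.graph.Adj u v) {x : T.CompVert → k}
    (hu : x ∈ T.starSpace k u) (hv : x ∈ T.starSpace k v) {a : T.CompVert} (hau : a ≠ .inl u)
    (hav : a ≠ .inl v) : x a = 0 := by
  by_contra h
  exact (hT.mem_star_inter_of_adj huv (mem_star_of_mem_starSpace hu h)
    (mem_star_of_mem_starSpace hv h)).elim hau hav

include hI

/-- A full line misses no point of `X_k`: the point at infinity of an affine line violates the axiom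
of Veblen and Young, except over the field with two elements, where affine lines have only two
points. -/
theorem exists_fullAt {l : T.Lines k} (hl : IsFull (IncPt T k) l) : ∃ v w, FullAt v w l := by
  obtain ⟨v, hlv, x, hx, hxv⟩ := exists_starSpace l
  obtain ⟨y, hy, hyv, hy0, hyx, hspan⟩ := exists_mem_eq_zero l.2.1 hx hxv
  by_contra hno
  push Not at hno
  have hyX : ∀ u, y ∈ T.starSpace k u → y (.inl u) = 0 := by
    intro u hyu
    by_contra h0
    have huv : T.graph.Adj v u := by
      rcases inl_mem_star.mp (mem_star_of_mem_starSpace (hlv hy) h0) with rfl | h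
      · exact absurd hyv h0
      · exact h
    refine hno v u ⟨huv, ?_, hlv, x, hx, hxv⟩
    have h1 : y ∈ Submodule.span k {T.vertVec k u} := mem_span_single fun b hb => by
      by_cases hbv : b = .inl v
      · rw [hbv, hyv]
      · exact hT.eq_zero_of_mem_starSpace huv (hlv hy) hyu hbv hb
    obtain ⟨c, hc⟩ := Submodule.mem_span_singleton.mp h1
    have hc0 : c ≠ 0 := by rintro rfl; exact hy0 (by rw [← hc, zero_smul])
    rw [← hc] at hy
    exact (l.1.smul_mem_iff hc0).mp hy
  have hpt : ∀ z (hz : z ∈ l.1) (h : ∃ u, z ∈ T.starSpace k u ∧ z (.inl u) ≠ 0),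
      z (.inl v) ≠ 0 := by
    rintro z hz ⟨u, hu, hzu⟩ h0
    rw [← hspan, Submodule.mem_span_pair] at hz
    obtain ⟨r, s, rfl⟩ := hz
    have hr : r = 0 := by simpa [hyv, hxv] using h0
    subst hr
    rw [zero_smul, zero_add] at hu hzu
    have hs : s ≠ 0 := by rintro rfl; simp at hzu
    exact hzu (by simp [hyX u ((Submodule.smul_mem_iff _ hs).mp hu)])
  by_cases hs : ∃ s : k, s ≠ 0 ∧ s ≠ 1
  · obtain ⟨s, hs0, hs1⟩ := hs
    obtain ⟨w, -, hvw⟩ := hT.exists_inner_adj hI v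
    have hew : T.vertVec k w ∉ l.1 := fun h => hno v w ⟨hvw, h, hlv, x, hx, hxv⟩
    -- the plane spanned by `l` and `p` contains the parallel of `l` through `p + s * (x - p)`
    set p : T.CompVert → k := x + T.vertVec k w with hp
    have hpl : p ∉ l.1 := fun h => hew ((Submodule.add_mem_iff_right _ hx).mp h)
    have hps : p ∈ T.starSpace k v := Submodule.add_mem _ (hlv hx)
      (single_mem_starSpace (inl_mem_star.mpr (.inr hvw)) 1)
    have hpv : p (.inl v) = x (.inl v) := by simp [hp, hvw.ne]
    have hmk : ∀ z, z ∈ T.starSpace k v → z (.inl v) = x (.inl v) →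
        z ≠ 0 ∧ ∃ u, z ∈ T.starSpace k u ∧ z (.inl u) ≠ 0 := by
      intro z hz hzv
      refine ⟨fun h => hxv ?_, v, hz, hzv ▸ hxv⟩
      rw [← hzv, h]; rfl
    set a := x + y with ha
    have hal : a ∈ l.1 := l.1.add_mem hx hy
    have hav : a (.inl v) = x (.inl v) := by simp [ha, hyv]
    set b₁ := p + s • (x - p) with hb₁
    set b₂ := p + s • (a - p) with hb₂
    have hb₁s : b₁ ∈ T.starSpace k v :=
      Submodule.add_mem _ hps (Submodule.smul_mem _ _ (Submodule.sub_mem _ (hlv hx) hps))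
    have hb₂s : b₂ ∈ T.starSpace k v :=
      Submodule.add_mem _ hps (Submodule.smul_mem _ _ (Submodule.sub_mem _ (hlv hal) hps))
    have hb₁v : b₁ (.inl v) = x (.inl v) := by simp [hb₁, hpv]
    have hb₂v : b₂ (.inl v) = x (.inl v) := by simp [hb₂, hpv, hav]
    -- two vectors with the same nonzero `v`-coordinate are proportional only if they are equal
    have hspan' : ∀ z z' : T.CompVert → k, z (.inl v) = x (.inl v) → z' (.inl v) = x (.inl v) →
        z ∈ Submodule.span k {z'} → z = z' := by
      intro z z' hz hz' h
      obtain ⟨c, rfl⟩ := Submodule.mem_span_singleton.mp h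
      have : c = 1 := by
        simp only [Pi.smul_apply, smul_eq_mul, hz'] at hz
        exact (mul_eq_right₀ hxv).mp hz
      rw [this, one_smul]
    have hb21 : b₂ = b₁ + s • y := by
      rw [hb₂, hb₁, ha, ← sub_eq_zero]
      module
    have hxp : x ∉ Submodule.span k {p} := fun h => hpl (hspan' _ _ rfl hpv h ▸ hx)
    have hap : a ∉ Submodule.span k {p} := fun h => hpl (hspan' _ _ hav hpv h ▸ hal)
    have hb : b₂ ∉ Submodule.span k {b₁} := by
      intro h
      have h1 := hspan' _ _ hb₂v hb₁v h
      rw [hb21, add_eq_left] at h1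
      exact (smul_ne_zero hs0 hy0) h1
    obtain ⟨m₁, hm₁⟩ := exists_line hps (hpv ▸ hxv) (hlv hx) hxp
    obtain ⟨m₂, hm₂⟩ := exists_line hps (hpv ▸ hxv) (hlv hal) hap
    obtain ⟨n, hn⟩ := exists_line hb₁s (hb₁v ▸ hxv) hb₂s hb
    have hpm : ∀ {m : T.Lines k} {z z'}, m.1 = Submodule.span k {z, z'} → z ∈ m.1 ∧ z' ∈ m.1 := by
      intro m z z' h
      rw [h]
      exact ⟨Submodule.subset_span (by simp), Submodule.subset_span (by simp)⟩
    obtain ⟨c, hcl, hcn⟩ := hl.2 m₁ m₂ n (mkPt p (hmk _ hps hpv).1 (hmk _ hps hpv).2)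
      (mkPt x (hmk _ (hlv hx) rfl).1 (hmk _ (hlv hx) rfl).2)
      (mkPt a (hmk _ (hlv hal) hav).1 (hmk _ (hlv hal) hav).2)
      (mkPt b₁ (hmk _ hb₁s hb₁v).1 (hmk _ hb₁s hb₁v).2)
      (mkPt b₂ (hmk _ hb₂s hb₂v).1 (hmk _ hb₂s hb₂v).2)
      (incPt_mkPt_iff.mpr (hpm hm₁).1) (incPt_mkPt_iff.mpr (hpm hm₁).2)
      (incPt_mkPt_iff.mpr (m₁.1.add_mem (hpm hm₁).1
        (m₁.1.smul_mem _ (m₁.1.sub_mem (hpm hm₁).2 (hpm hm₁).1))))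
      (incPt_mkPt_iff.mpr (hpm hm₂).1) (incPt_mkPt_iff.mpr (hpm hm₂).2)
      (incPt_mkPt_iff.mpr (m₂.1.add_mem (hpm hm₂).1
        (m₂.1.smul_mem _ (m₂.1.sub_mem (hpm hm₂).2 (hpm hm₂).1))))
      (mkPt_ne fun h => hy0 (by
        have := hspan' _ _ rfl hav h
        rwa [ha, left_eq_add] at this))
      (mkPt_ne (not_mem_span_symm (hmk _ hb₁s hb₁v).1 hb))
      (incPt_mkPt_iff.mpr hx) (incPt_mkPt_iff.mpr hal)
      (incPt_mkPt_iff.mpr (hpm hn).1) (incPt_mkPt_iff.mpr (hpm hn).2)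
    obtain ⟨c, hc0, hcX, rfl⟩ := exists_mkPt_eq c
    rw [incPt_mkPt_iff] at hcl hcn
    refine hpt c hcl hcX ?_
    rw [hn, Submodule.mem_span_pair] at hcn
    obtain ⟨r, t, rfl⟩ := hcn
    have h1 : ((r + t) * (1 - s)) • p ∈ l.1 := by
      have h2 : ((r + t) * (1 - s)) • p =
          (r • b₁ + t • b₂) - ((r + t) * s) • x - (t * s) • y := by
        rw [hb21, hb₁]
        module
      rw [h2]
      exact l.1.sub_mem (l.1.sub_mem hcl (l.1.smul_mem _ hx)) (l.1.smul_mem _ hy)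
    have h2 : (r + t) * (1 - s) = 0 := by
      by_contra h0
      exact hpl ((l.1.smul_mem_iff h0).mp h1)
    have h3 : r + t = 0 := (mul_eq_zero.mp h2).resolve_right (sub_ne_zero.mpr hs1.symm)
    simp only [Pi.add_apply, Pi.smul_apply, hb₁v, hb₂v, smul_eq_mul, ← add_mul, h3, zero_mul]
  · push Not at hs
    obtain ⟨⟨p, q, r, hpq, hpr, hqr, hp, hq, hr⟩, -⟩ := hl
    obtain ⟨p, hp0, hpX, rfl⟩ := exists_mkPt_eq p
    obtain ⟨q, hq0, hqX, rfl⟩ := exists_mkPt_eq q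
    obtain ⟨r, hr0, hrX, rfl⟩ := exists_mkPt_eq r
    rw [incPt_mkPt_iff] at hp hq hr
    have key : ∀ z ∈ l.1, (∃ u, z ∈ T.starSpace k u ∧ z (.inl u) ≠ 0) → z = x ∨ z = x + y := by
      intro z hz hzX
      have h1 := hpt z hz hzX
      rw [← hspan, Submodule.mem_span_pair] at hz
      obtain ⟨c, d, rfl⟩ := hz
      have hc : c = 1 := hs c fun hc => h1 (by simp [hc, hyv])
      by_cases hd : d = 0
      · left; simp [hc, hd]
      · right; simp [hc, hs d hd]
    have hne : ∀ {z z' : T.CompVert → k} {hz hz' h h'},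
        mkPt (T := T) z hz h ≠ mkPt z' hz' h' → z ≠ z' := by
      rintro z z' _ _ _ _ h rfl
      exact h rfl
    have h1 := hne hpq
    have h2 := hne hpr
    have h3 := hne hqr
    rcases key p hp hpX with rfl | rfl <;> rcases key q hq hqX with rfl | rfl <;>
      rcases key r hr hrX with rfl | rfl <;> simp_all

end IsLooseTree

end LooseGraph

/-! ### The rational points of the affine space at a vertex -/

namespace LooseGraph

variable {V E : Type*} {T : LooseGraph V E} {k : Type*} [Field k]

/-- The rational points of the affine space at the vertex `u`. -/
def ratCell (T : LooseGraph V E) (k : Type*) [Field k] (u : V) : Set (T.RatPoints k) :=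
  {p | T.toAmbient p.1 ∈ T.localAffine k u}

theorem mkPt_mem_ratCell_iff {u : V} {x : T.CompVert → k} {hx h} :
    mkPt x hx h ∈ T.ratCell k u ↔ x ∈ T.starSpace k u ∧ x (.inl u) ≠ 0 := by
  have h1 : ∀ (y : T.CompVert → k) (hy : y ≠ 0), ratPoint y hy ∈ T.localAffine k u ↔
      y ∈ T.starSpace k u ∧ y (.inl u) ≠ 0 := fun y hy =>
    ⟨fun h => ⟨fun a ha => (X_mem_ratPoint_iff y hy a).mp (X_mem_of_mem_localAffine h ha),
      fun h0 => h.1 ((X_mem_ratPoint_iff y hy _).mpr h0)⟩,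
    fun h => mem_localAffine (fun h0 => h.2 ((X_mem_ratPoint_iff y hy _).mp h0))
      fun a ha => (X_mem_ratPoint_iff y hy _).mpr (h.1 a ha)⟩
  obtain ⟨c, hc⟩ := Projectivization.exists_smul_eq_mk_rep k x hx
  refine (h1 _ (Projectivization.rep_nonzero _)).trans ?_
  change (Projectivization.mk k x hx).rep ∈ _ ∧ (Projectivization.mk k x hx).rep _ ≠ 0 ↔ _
  rw [← hc]
  refine and_congr (Submodule.smul_mem_iff' _ _) ?_
  simp [Units.smul_def]

theorem vec_pt {u : V} {x : T.CompVert → k} (hx : x ∈ T.starSpace k u) (hxu : x (.inl u) = 1) :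
    x ≠ 0 ∧ ∃ v, x ∈ T.starSpace k v ∧ x (.inl v) ≠ 0 :=
  ⟨fun h => by simp [h] at hxu, u, hx, by simp [hxu]⟩

/-- The rational point of the affine space at `u` with given affine coordinates. -/
def affPt {u : V} (x : T.CompVert → k) (hx : x ∈ T.starSpace k u) (hxu : x (.inl u) = 1) :
    T.RatPoints k :=
  mkPt x (vec_pt hx hxu).1 (vec_pt hx hxu).2

theorem affPt_mem_ratCell {u : V} {x : T.CompVert → k} (hx : x ∈ T.starSpace k u)
    (hxu : x (.inl u) = 1) : affPt x hx hxu ∈ T.ratCell k u :=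
  mkPt_mem_ratCell_iff.mpr ⟨hx, by simp [hxu]⟩

theorem exists_affPt_eq {u : V} {p : T.RatPoints k} (hp : p ∈ T.ratCell k u) :
    ∃ x hx hxu, p = affPt (T := T) (k := k) (u := u) x hx hxu := by
  obtain ⟨x, hx, h, rfl⟩ := exists_mkPt_eq p
  obtain ⟨h1, h2⟩ := mkPt_mem_ratCell_iff.mp hp
  refine ⟨(x (.inl u))⁻¹ • x, Submodule.smul_mem _ _ h1, by simp [h2], ?_⟩
  rw [affPt, mkPt_eq_mkPt_iff]
  exact Submodule.mem_span_singleton.mpr ⟨x (.inl u), by rw [smul_smul, mul_inv_cancel₀ h2, one_smul]⟩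

theorem affPt_inj {u : V} {x y : T.CompVert → k} {hx : x ∈ T.starSpace k u} {hxu}
    {hy : y ∈ T.starSpace k u} {hyu} : affPt x hx hxu = affPt y hy hyu ↔ x = y := by
  rw [affPt, affPt, mkPt_eq_mkPt_iff]
  refine ⟨fun h => ?_, fun h => h ▸ Submodule.mem_span_singleton_self _⟩
  obtain ⟨c, rfl⟩ := Submodule.mem_span_singleton.mp h
  have : c = 1 := by simpa [hyu] using hxu
  rw [this, one_smul]

/-- Over a finite field the affine space at a vertex has `|k| ^ deg` rational points. -/
theorem IsLooseTree.ncard_ratCell (hT : T.IsLooseTree) [Finite V] [Finite E] (u : V) :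
    (T.ratCell k u).ncard = Nat.card k ^ T.degree u := by
  classical
  let N : Set T.CompVert := {a | T.completion.Adj (.inl u) a}
  let F : (N → k) → T.CompVert → k := fun y a =>
    if a = .inl u then 1 else if h : a ∈ N then y ⟨a, h⟩ else 0
  have hFu : ∀ y, F y (.inl u) = 1 := fun y => if_pos rfl
  have hFN : ∀ y (a : N), F y a = y a := fun y a => by
    have h : (a : T.CompVert) ≠ .inl u := fun h => notMem_nbrs_self u (h ▸ a.2)
    simp [F, h]
  have hF : ∀ y, F y ∈ T.starSpace k u := fun y a ha => by
    have h1 : a ≠ .inl u := fun h => ha (.inl h)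
    have h2 : a ∉ N := fun h => ha (.inr h)
    simp [F, h1, h2]
  let G : (N → k) → T.ratCell k u := fun y => ⟨affPt (F y) (hF y) (hFu y), affPt_mem_ratCell _ _⟩
  have hG : Function.Bijective G := by
    constructor
    · intro y z h
      have h1 := (affPt_inj (hx := hF y) (hxu := hFu y) (hy := hF z) (hyu := hFu z)).mp
        (congrArg Subtype.val h)
      funext a
      rw [← hFN y, ← hFN z, h1]
    · rintro ⟨p, hp⟩
      obtain ⟨x, hx, hxu, rfl⟩ := exists_affPt_eq hp
      obtain ⟨y, hy⟩ : ∃ y : N → k, ∀ a : N, y a = x a := ⟨_, fun _ => rfl⟩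
      have hyx : F y = x := by
        funext a
        by_cases h1 : a = .inl u
        · rw [h1, hFu, hxu]
        by_cases h2 : a ∈ N
        · exact (hFN y ⟨a, h2⟩).trans (hy _)
        · rw [hx a fun h => h.elim h1 h2]
          simp [F, h1, h2]
      exact ⟨y, Subtype.ext ((affPt_inj (hx := hF y) (hxu := hFu y) (hy := hx) (hyu := hxu)).mpr hyx)⟩
  rw [← Nat.card_coe_set_eq, ← Nat.card_congr (Equiv.ofBijective G hG), Nat.card_fun,
    Nat.card_coe_set_eq, hT.degree_eq]

variable [Fintype V] [Fintype E] [DecidableEq V] [DecidableEq E]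

/-- The linear span of generators contains the whole affine space, so they are at least as many as
its dimension plus one. -/
theorem IsLooseTree.degree_add_one_le_of_isGeneratedBy (hT : T.IsLooseTree) {u : V} {n : ℕ}
    (h : IsGeneratedBy (IncPt T k) (T.ratCell k u) n) : T.degree u + 1 ≤ n := by
  obtain ⟨F, hFA, hF, hn, hgen⟩ := h
  -- the points in the linear span of the generators are closed under taking lines
  set R : Set (T.CompVert → k) := (fun p : T.RatPoints k => p.1.rep) '' F with hR
  have hRfin : R.Finite := hF.image _
  have h1 := hgen {p | p.1.submodule ≤ Submodule.span k R} (fun p hp => by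
    rw [Set.mem_ofPred_eq, Projectivization.submodule_eq, Submodule.span_singleton_le_iff_mem]
    exact Submodule.subset_span (Set.mem_image_of_mem _ hp)) (by
    intro p q r l hp hq hpq _ hpl hql hrl
    obtain ⟨x, hx, _, rfl⟩ := exists_mkPt_eq p
    obtain ⟨y, hy, _, rfl⟩ := exists_mkPt_eq q
    rw [incPt_mkPt_iff] at hpl hql
    rw [Ne, mkPt_eq_mkPt_iff] at hpq
    rw [Set.mem_ofPred_eq, mkPt, Projectivization.submodule_mk,
      Submodule.span_singleton_le_iff_mem] at hp hq
    refine hrl.trans ?_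
    rw [line_eq hql hpl hy hpq, Submodule.span_le]
    rintro z (rfl | rfl)
    exacts [hq, hp])
  have h2 : ∀ x ∈ T.starSpace k u, x (.inl u) = 1 → x ∈ Submodule.span k R := by
    intro x hx hxu
    have := h1 (affPt_mem_ratCell hx hxu)
    rwa [Set.mem_ofPred_eq, affPt, mkPt, Projectivization.submodule_mk,
      Submodule.span_singleton_le_iff_mem] at this
  have hu : T.vertVec k u ∈ Submodule.span k R :=
    h2 _ (single_mem_starSpace (inl_mem_star_self u) 1) (by simp)
  have h3 : ∀ a ∈ T.star u, (Pi.single a 1 : T.CompVert → k) ∈ Submodule.span k R := by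
    intro a ha
    by_cases hau : a = .inl u
    · rw [hau]; exact hu
    · refine (Submodule.add_mem_iff_right _ hu).mp (h2 _ (Submodule.add_mem _
        (single_mem_starSpace (inl_mem_star_self u) 1) (single_mem_starSpace ha 1)) ?_)
      simp [Pi.single_eq_of_ne (Ne.symm hau)]
  have hli : LinearIndependent k fun a : T.star u =>
      (Pi.single (a : T.CompVert) 1 : T.CompVert → k) := by
    have := (Pi.basisFun k T.CompVert).linearIndependent.comp _
      (Subtype.val_injective (p := (· ∈ T.star u)))
    simpa [Function.comp_def] using this
  have h4 : (T.star u).ncard = T.degree u + 1 := by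
    have h5 : T.star u = insert (.inl u) (T.nbrs u) := rfl
    rw [h5, Set.ncard_insert_of_notMem (notMem_nbrs_self u) (Set.toFinite _), hT.degree_eq]
    rfl
  classical
  have h5 := finrank_span_eq_card hli
  have h6 : Submodule.span k (Set.range fun a : T.star u =>
      (Pi.single (a : T.CompVert) 1 : T.CompVert → k)) ≤ Submodule.span k R := by
    rw [Submodule.span_le]
    rintro _ ⟨a, rfl⟩
    exact h3 a a.2
  have h7 := Submodule.finrank_mono h6
  have := hRfin.fintype
  have h8 := finrank_span_le_card (R := k) R
  rw [h5, ← Nat.card_eq_fintype_card, Nat.card_coe_set_eq, h4] at h7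
  rw [← Set.ncard_eq_toFinset_card'] at h8
  exact h7.trans (h8.trans ((Set.ncard_image_le hF).trans hn))

/-- Over a field with more than two elements, an affine space is generated by an affine basis. -/
theorem IsLooseTree.isGeneratedBy_ratCell (hT : T.IsLooseTree) (hk : ∃ t : k, t ≠ 0 ∧ t ≠ 1)
    (u : V) : IsGeneratedBy (IncPt T k) (T.ratCell k u) (T.degree u + 1) := by
  obtain ⟨t, ht0, ht1⟩ := hk
  have hvu := single_mem_starSpace (k := k) (inl_mem_star_self (T := T) u) 1
  have hva : ∀ {a}, a ∈ T.nbrs u → (Pi.single a 1 : T.CompVert → k) ∈ T.starSpace k u :=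
    fun ha => single_mem_starSpace (.inr ha) 1
  have hau : ∀ {a}, a ∈ T.nbrs u → (Pi.single a 1 : T.CompVert → k) (.inl u) = 0 := fun ha =>
    Pi.single_eq_of_ne (fun h => notMem_nbrs_self u (by rw [h]; exact ha)) _
  let P₀ : T.RatPoints k := affPt (T.vertVec k u) hvu (by simp)
  let P₁ : T.nbrs u → T.RatPoints k := fun a => affPt (T.vertVec k u + Pi.single (a : T.CompVert) 1)
    (Submodule.add_mem _ hvu (hva a.2)) (by simp [hau a.2])
  refine ⟨insert P₀ (Set.range P₁), ?_, Set.toFinite _, ?_, ?_⟩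
  · rintro p (rfl | ⟨a, rfl⟩) <;> exact affPt_mem_ratCell _ _
  · refine (Set.ncard_insert_le _ _).trans (Nat.add_le_add_right ?_ 1)
    rw [← Set.image_univ, hT.degree_eq]
    refine (Set.ncard_image_le (Set.toFinite _)).trans ?_
    rw [Set.ncard_univ, Nat.card_coe_set_eq]
    rfl
  intro Y hFY hY
  let Q : (T.CompVert → k) → Prop := fun x => ∀ hx hxu, affPt (u := u) x hx hxu ∈ Y
  -- `Y` is closed under affine combinations of two points
  have haff : ∀ x y, x ∈ T.starSpace k u → x (.inl u) = 1 → y ∈ T.starSpace k u →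
      y (.inl u) = 1 → Q x → Q y → ∀ s : k, Q (x + s • (y - x)) := by
    intro x y hx hxu hy hyu hQx hQy s hz hzu
    by_cases hxy : x = y
    · subst hxy
      simpa using hQx hx hxu
    have hne : affPt x hx hxu ≠ affPt y hy hyu := fun h => hxy (affPt_inj.mp h)
    obtain ⟨l, hl⟩ := exists_line hy (by simp [hyu]) hx
      (fun h => hne (mkPt_eq_mkPt_iff.mpr h))
    have hxl : x ∈ l.1 := by rw [hl]; exact Submodule.subset_span (by simp)
    have hyl : y ∈ l.1 := by rw [hl]; exact Submodule.subset_span (by simp)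
    exact hY _ _ _ l (hQx hx hxu) (hQy hy hyu) hne (affPt_mem_ratCell hz hzu)
      (incPt_mkPt_iff.mpr hxl) (incPt_mkPt_iff.mpr hyl)
      (incPt_mkPt_iff.mpr (l.1.add_mem hxl (l.1.smul_mem _ (l.1.sub_mem hyl hxl))))
  have hQ0 : Q (T.vertVec k u) := fun _ _ => hFY (.inl rfl)
  -- the axes lie in `Y`
  have hQ1 : ∀ a ∈ T.nbrs u, ∀ c : k, Q (T.vertVec k u + c • Pi.single a 1) := by
    intro a ha c
    have h1 : Q (T.vertVec k u + Pi.single a 1) := fun _ _ => hFY (.inr ⟨⟨a, ha⟩, rfl⟩)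
    have := haff _ _ hvu (by simp) (Submodule.add_mem _ hvu (hva ha)) (by simp [hau ha]) hQ0 h1 c
    rwa [add_sub_cancel_left] at this
  have key : ∀ s : Finset T.CompVert, ∀ y ∈ T.starSpace k u, y (.inl u) = 0 →
      (∀ a ∉ s, y a = 0) → Q (T.vertVec k u + y) := by
    intro s
    induction s using Finset.induction_on with
    | empty =>
      intro y _ _ hy
      have : y = 0 := funext fun a => hy a (Finset.notMem_empty a)
      rw [this, add_zero]
      exact hQ0
    | insert a s has ih =>
      intro y hy hyu hys
      by_cases hya : y a = 0
      · refine ih y hy hyu fun b hb => ?_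
        by_cases hba : b = a
        · rw [hba, hya]
        · exact hys b (by simp [hba, hb])
      have haN : a ∈ T.nbrs u := (mem_star_of_mem_starSpace hy hya).resolve_left fun h => hya (h ▸ hyu)
      -- `y` is an affine combination, with coefficients `1 - t` and `t`, of a vector with smaller
      -- support and a vector on an axis
      set z := (1 - t)⁻¹ • (y - y a • Pi.single a 1) with hz
      have hzs : z ∈ T.starSpace k u :=
        Submodule.smul_mem _ _ (Submodule.sub_mem _ hy (Submodule.smul_mem _ _ (hva haN)))
      have hzu : z (.inl u) = 0 := by simp [hz, hyu, hau haN]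
      have h1 := ih z hzs hzu fun b hb => by
        by_cases hba : b = a
        · subst hba; simp [hz]
        · simp [hz, hba, hys b (by simp [hba, hb])]
      have h2 := haff _ _ (Submodule.add_mem _ hvu hzs) (by simp [hzu])
        (Submodule.add_mem _ hvu (Submodule.smul_mem _ _ (hva haN))) (by simp [hau haN]) h1
        (hQ1 a haN (t⁻¹ * y a)) t
      have h3 : T.vertVec k u + z + t • (T.vertVec k u + (t⁻¹ * y a) • Pi.single a 1 -
          (T.vertVec k u + z)) = T.vertVec k u + y := by
        have ht : (1 - t) * (1 - t)⁻¹ = 1 := mul_inv_cancel₀ (sub_ne_zero.mpr ht1.symm)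
        have h4 : (1 - t) • z = y - y a • Pi.single a 1 := by rw [hz, smul_smul, ht, one_smul]
        have h5 : t • (t⁻¹ * y a) • (Pi.single a 1 : T.CompVert → k) = y a • Pi.single a 1 := by
          rw [smul_smul, mul_inv_cancel_left₀ ht0]
        have h6 : y = (1 - t) • z + t • (t⁻¹ * y a) • (Pi.single a 1 : T.CompVert → k) := by
          rw [h4, h5, sub_add_cancel]
        conv_rhs => rw [h6]
        module
      rwa [h3] at h2
  intro p hp
  obtain ⟨x, hx, hxu, rfl⟩ := exists_affPt_eq hp
  have h1 := key Finset.univ (x - T.vertVec k u) (Submodule.sub_mem _ hx hvu) (by simp [hxu])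
    (fun a ha => absurd (Finset.mem_univ a) ha)
  rw [add_sub_cancel] at h1
  exact h1 hx hxu

namespace IsLooseTree

variable (hT : T.IsLooseTree) (hI : 2 ≤ T.inner.ncard)
include hT

/-- An automorphism of the incidence geometry that maps the affine space at `u` onto the one at `v`
preserves their dimension. -/
theorem degree_eq_of_image_ratCell {u v : V} (f : Equiv.Perm (T.RatPoints k))
    (g : Equiv.Perm (T.Lines k)) (h : ∀ p l, IncPt T k (f p) (g l) ↔ IncPt T k p l)
    (huv : f '' T.ratCell k u = T.ratCell k v) : T.degree v = T.degree u := by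
  classical
  rcases finite_or_infinite k with hk | hk
  · have h1 := Set.ncard_image_of_injective (T.ratCell k u) f.injective
    rw [huv, hT.ncard_ratCell, hT.ncard_ratCell] at h1
    exact Nat.pow_right_injective Finite.one_lt_card h1
  · have hs : ∃ t : k, t ≠ 0 ∧ t ≠ 1 := by
      obtain ⟨t, ht⟩ := Infinite.exists_notMem_finset ({0, 1} : Finset k)
      exact ⟨t, by simpa [not_or] using ht⟩
    refine le_antisymm ?_ ?_
    · have h1 := (hT.isGeneratedBy_ratCell hs u).map f g h
      rw [huv] at h1
      exact Nat.le_of_add_le_add_right (hT.degree_add_one_le_of_isGeneratedBy h1)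
    · have h1 := (hT.isGeneratedBy_ratCell hs v).map (I' := IncPt T k) f.symm g.symm fun p l => by
        rw [← h, f.apply_symm_apply, g.apply_symm_apply]
      rw [← huv, ← Set.image_comp] at h1
      simp only [Equiv.symm_comp_self, Set.image_id] at h1
      exact Nat.le_of_add_le_add_right (hT.degree_add_one_le_of_isGeneratedBy h1)

end IsLooseTree

end LooseGraph

/-! ### Combinatorial automorphisms act on the inner tree -/

namespace LooseGraph

variable {V E : Type*} {T : LooseGraph V E} {k : Type*} [Field k] [Fintype V] [Fintype E]
  [DecidableEq V] [DecidableEq E]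

theorem collinearPts_vertRatPoint_iff {u v : V} :
    CollinearPts (IncPt T k) (T.vertRatPoint k u) (T.vertRatPoint k v) ↔
      u = v ∨ T.graph.Adj u v := by
  rw [vertRatPoint_eq, vertRatPoint_eq]
  constructor
  · intro h
    obtain ⟨s, h1, h2, h3⟩ := exists_of_collinearPts_mkPt h
    have h1 := inl_mem_star.mp (mem_star_of_mem_starSpace h1 (a := .inl u) (by simp))
    have h2 := inl_mem_star.mp (mem_star_of_mem_starSpace h2 (a := .inl v) (by simp))
    rcases h3 with h3 | h3
    · have : s = u := by
        by_contra h
        simp [h] at h3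
      subst this
      exact h2.imp Eq.symm id
    · have : s = v := by
        by_contra h
        simp [h] at h3
      subst this
      exact h1.imp id fun h => h.symm
  · rintro (rfl | h)
    · exact .inl rfl
    · exact collinearPts_mkPt_of (v := u) (single_mem_starSpace (inl_mem_star_self u) 1)
        (single_mem_starSpace (inl_mem_star.mpr (.inr h)) 1) (.inl (by simp))

theorem exists_fullAt_span {v w : V} (hvw : T.graph.Adj v w) {x : T.CompVert → k}
    (hx : x ∈ T.starSpace k v) (hxv : x (.inl v) ≠ 0) :
    ∃ l : T.Lines k, x ∈ l.1 ∧ FullAt v w l := by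
  have hvw' : (Sum.inl v : T.CompVert) ≠ .inl w := fun h => hvw.ne (Sum.inl.inj h)
  obtain ⟨l, hl⟩ := exists_line hx hxv (single_mem_starSpace (inl_mem_star.mpr (.inr hvw)) 1)
    (fun h => by
      obtain ⟨c, hc⟩ := Submodule.mem_span_singleton.mp h
      have h1 := congrFun hc (.inl v)
      have h2 := congrFun hc (.inl w)
      simp [hvw', hxv] at h1
      simp [h1] at h2)
  have hxl : x ∈ l.1 := by rw [hl]; exact Submodule.subset_span (by simp)
  refine ⟨l, hxl, hvw, by rw [hl]; exact Submodule.subset_span (by simp), ?_, x, hxl, hxv⟩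
  rw [hl, Submodule.span_le]
  rintro z (rfl | rfl)
  exacts [hx, single_mem_starSpace (inl_mem_star.mpr (.inr hvw)) 1]

omit [Fintype V] [Fintype E] in
theorem vertRatPoint_injective : Function.Injective (T.vertRatPoint k) := by
  intro u v h
  rw [vertRatPoint_eq, vertRatPoint_eq, mkPt_eq_mkPt_iff] at h
  obtain ⟨c, hc⟩ := Submodule.mem_span_singleton.mp h
  by_contra hne
  have := congrFun hc (.inl u)
  simp [hne] at this

theorem FullAt.apply_ne_zero {v w : V} {l : T.Lines k} (hl : FullAt v w l) {x : T.CompVert → k}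
    {hx h} (hxl : x ∈ l.1) (hne : mkPt x hx h ≠ T.vertRatPoint k w) : x (.inl v) ≠ 0 := fun h0 =>
  hne ((mkPt_eq_mkPt_iff (h' := exists_starSpace_vertVec w)).mpr (hl.mem_span hxl h0))

namespace IsLooseTree

variable (hT : T.IsLooseTree) (hI : 2 ≤ T.inner.ncard)
include hT

theorem vertVec_mem_line {v w : V} (hvw : T.graph.Adj v w) {x : T.CompVert → k} {l : T.Lines k}
    (hxl : x ∈ l.1) (hxv : x ∈ T.starSpace k v) (hxw : x ∈ T.starSpace k w)
    (hwl : T.vertVec k w ∈ l.1) (hv : x (.inl v) ≠ 0) : T.vertVec k v ∈ l.1 := by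
  have hvw' : (Sum.inl v : T.CompVert) ≠ .inl w := fun h => hvw.ne (Sum.inl.inj h)
  have h1 : x (.inl v) • T.vertVec k v = x - x (.inl w) • T.vertVec k w := by
    funext a
    by_cases hav : a = .inl v
    · subst hav; simp [hvw']
    by_cases haw : a = .inl w
    · subst haw; simp [hvw'.symm]
    · simp [hav, haw, hT.eq_zero_of_mem_starSpace hvw hxv hxw hav haw]
  exact (l.1.smul_mem_iff hv).mp (h1 ▸ l.1.sub_mem hxl (l.1.smul_mem _ hwl))

include hI

/-- The vertices of `T` can be recognized in the incidence geometry of `X_k`. -/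
theorem isVertexLike_iff {p : T.RatPoints k} :
    IsVertexLike (IncPt T k) p ↔ ∃ w, p = T.vertRatPoint k w := by
  constructor
  · rintro ⟨l, m, hlm, hpl, hpm, hl, hm, hj⟩
    obtain ⟨v, w, hl⟩ := hT.exists_fullAt hI hl
    obtain ⟨v', w', hm⟩ := hT.exists_fullAt hI hm
    by_contra hno
    push Not at hno
    obtain ⟨x, hx, hxX, rfl⟩ := exists_mkPt_eq p
    rw [incPt_mkPt_iff] at hpl hpm
    have hxv := hl.apply_ne_zero hpl (hno w)
    have hxv' := hm.apply_ne_zero hpm (hno w')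
    have hls := hl.eq_span hpl hxv
    have hms := hm.eq_span hpm hxv'
    have hww : w ≠ w' := by
      rintro rfl
      exact hlm (Subtype.ext (hls.trans hms.symm))
    have hj' : ∀ a b, T.vertVec k a ∈ l.1 → T.vertVec k b ∈ m.1 → a = b ∨ T.graph.Adj a b :=
      fun a b ha hb => collinearPts_vertRatPoint_iff.mp
        (hj _ _ (incPt_vertRatPoint_iff.mpr ha) (incPt_vertRatPoint_iff.mpr hb))
    have hadj := (hj' w w' hl.2.1 hm.2.1).resolve_left hww
    rcases inl_mem_star.mp (mem_star_of_mem_starSpace (hl.2.2.1 hpl) hxv') with rfl | hvv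
    · exact hT.not_triangle hl.1 hadj hm.1
    have hvl : w = v' → T.vertVec k v ∈ l.1 := by
      rintro rfl
      exact hT.vertVec_mem_line hvv hpl (hl.2.2.1 hpl) (hm.2.2.1 hpm) hl.2.1 hxv
    have hvm : w' = v → T.vertVec k v' ∈ m.1 := by
      rintro rfl
      exact hT.vertVec_mem_line hvv.symm hpm (hm.2.2.1 hpm) (hl.2.2.1 hpl) hm.2.1 hxv'
    by_cases hvw : v = w'
    · subst hvw
      by_cases hvw' : v' = w
      · subst hvw'
        refine hlm (Subtype.ext ?_)
        rw [hms]
        refine line_eq hpl (hvl rfl) hx fun h => ?_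
        obtain ⟨c, hc⟩ := Submodule.mem_span_singleton.mp h
        have h1 := congrFun hc (.inl v')
        have h2 := congrFun hc (.inl v)
        simp [hvv.ne', hxv'] at h1
        simp [h1] at h2
      · exact (hj' w v' hl.2.1 (hvm rfl)).elim (fun h => hvw' h.symm) fun h =>
          hT.not_triangle hl.1 h hvv
    · have h1 : w = v' := hT.eq_of_common_adj hvw hl.1 hadj.symm hvv hm.1.symm
      subst h1
      exact (hj' v w' (hvl rfl) hm.2.1).elim hvw fun h => hT.not_triangle hvv hm.1 h
  · rintro ⟨w, rfl⟩
    obtain ⟨v, hv, hwv⟩ := hT.exists_inner_adj hI w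
    obtain ⟨a, haw, hav⟩ := hT.exists_ne_adj hv (.inl w)
    have hvs := single_mem_starSpace (k := k) (inl_mem_star_self (T := T) v) 1
    have hva : (Sum.inl v : T.CompVert) ≠ a := hav.ne
    obtain ⟨l, hvl, hl⟩ := exists_fullAt_span (k := k) hwv.symm hvs (by simp)
    obtain ⟨m, hvm, hm⟩ := exists_fullAt_span (k := k) hwv.symm
      (Submodule.add_mem _ hvs (single_mem_starSpace (.inr hav) 1)) (by simp [hva])
    refine ⟨l, m, ?_, incPt_vertRatPoint_iff.mpr hl.2.1, incPt_vertRatPoint_iff.mpr hm.2.1,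
      hl.isFull, hm.isFull, hl.joined hm⟩
    rintro rfl
    have h1 := (Submodule.add_mem_iff_right _ hvl).mp hvm
    rw [hl.eq_span hvl (by simp), Submodule.mem_span_pair] at h1
    obtain ⟨r, s, h1⟩ := h1
    have := congrFun h1 a
    simp [hva.symm, haw] at this

/-- The affine space at a vertex, too, can be recognized in the incidence geometry of `X_k`. -/
theorem localPart_vertRatPoint {u v : V} (huv : T.graph.Adj u v) :
    localPart (IncPt T k) (T.vertRatPoint k u) (T.vertRatPoint k v) = T.ratCell k u := by
  have huv' : (Sum.inl u : T.CompVert) ≠ .inl v := fun h => huv.ne (Sum.inl.inj h)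
  have hus := single_mem_starSpace (k := k) (inl_mem_star_self (T := T) u) 1
  ext p
  obtain ⟨x, hx, hxX, rfl⟩ := exists_mkPt_eq p
  rw [mkPt_mem_ratCell_iff]
  constructor
  · rintro ⟨hne, l, hl, hxl, hvl, m, hum, hvm, hj⟩
    obtain ⟨z, w, hl⟩ := hT.exists_fullAt hI hl
    rw [incPt_mkPt_iff] at hxl
    rw [incPt_vertRatPoint_iff] at hvl
    have hlu : ∀ a, T.vertVec k a ∈ l.1 → a = u ∨ T.graph.Adj a u := fun a ha =>
      collinearPts_vertRatPoint_iff.mp (hj _ _ (incPt_vertRatPoint_iff.mpr ha) hum)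
    by_cases hvw : w = v
    · subst hvw
      have hxz := hl.apply_ne_zero hxl hne
      have hxs := hl.2.2.1 hxl
      by_cases hzu : z = u
      · subst hzu
        exact ⟨hxs, hxz⟩
      exfalso
      have hnadj : ¬ T.graph.Adj z u := fun h => hT.not_triangle h huv hl.1
      have h1 := hj _ _ (incPt_mkPt_iff (h := hxX) (hx := hx).mpr hxl) hum
      rw [vertRatPoint_eq] at h1
      obtain ⟨s, h2, h3, -⟩ := exists_of_collinearPts_mkPt h1
      rcases inl_mem_star.mp (mem_star_of_mem_starSpace h2 hxz) with rfl | h4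
      · rcases inl_mem_star.mp (mem_star_of_mem_starSpace h3 (a := .inl u) (by simp)) with h5 | h5
        exacts [hzu h5.symm, hnadj h5]
      rcases inl_mem_star.mp (mem_star_of_mem_starSpace h3 (a := .inl u) (by simp)) with rfl | h5
      · exact hnadj h4.symm
      obtain rfl : s = w := hT.eq_of_common_adj hzu h4.symm h5.symm hl.1 huv
      have h6 := hT.vertVec_mem_line h4.symm hxl hxs h2 hvl hxz
      exact (hlu z h6).elim hzu hnadj
    · have hzv : z = v := by
        by_contra hzv
        obtain ⟨c, hc⟩ := Submodule.mem_span_singleton.mp (hl.mem_span hvl (by simp [hzv]))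
        have := congrFun hc (.inl v)
        simp [Ne.symm hvw] at this
      subst hzv
      have hwu : w = u := by
        by_contra hwu
        exact hT.not_triangle ((hlu w hl.2.1).resolve_left hwu) huv hl.1.symm
      subst hwu
      have h1 := hl.eq_span hvl (by simp)
      rw [h1, Submodule.mem_span_pair] at hxl
      obtain ⟨r, s, rfl⟩ := hxl
      refine ⟨Submodule.add_mem _ (Submodule.smul_mem _ _
        (single_mem_starSpace (inl_mem_star.mpr (.inr huv)) 1)) (Submodule.smul_mem _ _ hus), ?_⟩
      intro h0
      have hs : s = 0 := by simpa [huv'] using h0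
      subst hs
      refine hne ((mkPt_eq_mkPt_iff (h' := exists_starSpace_vertVec z)).mpr ?_)
      rw [zero_smul, add_zero]
      exact Submodule.smul_mem _ _ (Submodule.mem_span_singleton_self _)
  · rintro ⟨hxs, hxu⟩
    obtain ⟨l, hxl, hl⟩ := exists_fullAt_span huv hxs hxu
    obtain ⟨m, hum, hm⟩ := exists_fullAt_span (k := k) huv hus (by simp)
    refine ⟨?_, l, hl.isFull, incPt_mkPt_iff.mpr hxl, incPt_vertRatPoint_iff.mpr hl.2.1, m,
      incPt_vertRatPoint_iff.mpr hum, incPt_vertRatPoint_iff.mpr hm.2.1, hl.joined hm⟩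
    refine mkPt_ne (h' := exists_starSpace_vertVec v) fun h => hxu ?_
    obtain ⟨c, rfl⟩ := Submodule.mem_span_singleton.mp h
    simp [huv']

/-- The action of a combinatorial automorphism on the embedded inner tree. -/
theorem exists_induces_of_combAuto (g : T.CombAuto k) :
    ∃ α ∈ T.embeddedInnerAut, g.Induces α := by
  have h : ∀ p l, IncPt T k (g.onPoints p) (g.onLines l) ↔ IncPt T k p l := g.incident_iff
  have hβ : ∀ w, ∃ w', g.onPoints (T.vertRatPoint k w) = T.vertRatPoint k w' := fun w =>
    (hT.isVertexLike_iff hI).mp ((isVertexLike_map_iff g.onPoints g.onLines h).mpr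
      ((hT.isVertexLike_iff hI).mpr ⟨w, rfl⟩))
  choose β hβ using hβ
  have hinj : Function.Injective β := fun u v huv => by
    have h1 : g.onPoints (T.vertRatPoint k u) = g.onPoints (T.vertRatPoint k v) := by
      rw [hβ, hβ, huv]
    exact vertRatPoint_injective (g.onPoints.injective h1)
  have hadj : ∀ u v, T.graph.Adj (β u) (β v) ↔ T.graph.Adj u v := by
    intro u v
    have h1 := collinearPts_map_iff g.onPoints g.onLines h (p := T.vertRatPoint k u)
      (q := T.vertRatPoint k v)
    rw [hβ, hβ, collinearPts_vertRatPoint_iff, collinearPts_vertRatPoint_iff, hinj.eq_iff] at h1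
    by_cases huv : u = v
    · subst huv; simp
    · simpa [huv] using h1
  have hdeg : ∀ u, T.degree (β u) = T.degree u := by
    intro u
    obtain ⟨v, -, huv⟩ := hT.exists_inner_adj hI u
    refine hT.degree_eq_of_image_ratCell g.onPoints g.onLines h ?_
    rw [← hT.localPart_vertRatPoint hI huv, ← hT.localPart_vertRatPoint hI ((hadj u v).mpr huv),
      ← hβ, ← hβ]
    ext p
    obtain ⟨q, rfl⟩ := g.onPoints.surjective p
    rw [mem_localPart_map_iff g.onPoints g.onLines h, g.onPoints.injective.mem_set_image]
  obtain ⟨α, hα, hαβ⟩ := hT.exists_embeddedInnerAut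
    (β := Equiv.ofBijective β hinj.bijective_of_finite) hadj hdeg
  have hv : ∀ v : T.inner, g.onPoints (T.vertRatPoint k v) = T.vertRatPoint k (α v) := fun v => by
    rw [hαβ]
    exact hβ v
  refine ⟨α, hα, hv, fun u v huv => ?_⟩
  have huv : T.graph.Adj u v := huv
  obtain ⟨l, hul, hl⟩ := exists_fullAt_span (k := k) huv
    (single_mem_starSpace (inl_mem_star_self (u : V)) 1) (by simp)
  refine ⟨l, hl.eq_span hul (by simp), ?_⟩
  have h1 : ∀ w : T.inner, T.vertVec k w ∈ l.1 → T.vertVec k (α w) ∈ (g.onLines l).1 :=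
    fun w hw => by
      rw [← incPt_vertRatPoint_iff, ← hv, h, incPt_vertRatPoint_iff]
      exact hw
  refine line_eq (h1 u hul) (h1 v hl.2.1) (T.vertVec_ne_zero k _) fun h2 => ?_
  have h3 := vertRatPoint_injective (mkPt_eq_mkPt_iff (h := exists_starSpace_vertVec _)
    (h' := exists_starSpace_vertVec _) (hx := T.vertVec_ne_zero k _)
    (hy := T.vertVec_ne_zero k _) |>.mpr h2)
  exact huv.ne' (congrArg Subtype.val (α.injective (Subtype.ext h3)))

end IsLooseTree

end LooseGraph

/-! ### Base change of sheaves along homeomorphisms, and permutations of coordinates -/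

section PullbackPushforward

universe w

variable {X X' Y Y' : TopCat.{w}}

/-- The pushforward of sheaves along a homeomorphism is left adjoint to the pushforward along its
inverse. -/
noncomputable def TopCat.Sheaf.pushforwardIsoAdjunction (H : X ≅ Y) :
    TopCat.Sheaf.pushforward CommRingCat.{w} H.hom ⊣
      TopCat.Sheaf.pushforward CommRingCat.{w} H.inv :=
  (TopCat.Presheaf.presheafEquivOfIso CommRingCat.{w} H).toAdjunction.restrictFullyFaithful
    (fullyFaithfulSheafToPresheaf _ _) (fullyFaithfulSheafToPresheaf _ _) (Iso.refl _) (Iso.refl _)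

/-- Base change of sheaves along a commutative square whose horizontal maps are homeomorphisms: both
composites are left adjoint to the pushforward along the diagonal. -/
noncomputable def TopCat.Sheaf.pullbackPushforwardIso {i : X ⟶ Y} {i' : X' ⟶ Y'} (g : X ≅ X')
    (ψ : Y ≅ Y') (h : g.hom ≫ i' = i ≫ ψ.hom) :
    TopCat.Sheaf.pullback CommRingCat.{w} i ⋙ TopCat.Sheaf.pushforward CommRingCat.{w} g.hom ≅
      TopCat.Sheaf.pushforward CommRingCat.{w} ψ.hom ⋙ TopCat.Sheaf.pullback CommRingCat.{w} i' :=
  Adjunction.leftAdjointUniq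
    ((TopCat.Sheaf.pullbackPushforwardAdjunction CommRingCat.{w} i).comp
      (TopCat.Sheaf.pushforwardIsoAdjunction g))
    (((TopCat.Sheaf.pushforwardIsoAdjunction ψ).comp
      (TopCat.Sheaf.pullbackPushforwardAdjunction CommRingCat.{w} i')).ofNatIsoRight
        (eqToIso (by
          change TopCat.Sheaf.pushforward CommRingCat.{w} (i' ≫ ψ.inv) =
            TopCat.Sheaf.pushforward CommRingCat.{w} (g.inv ≫ i)
          rw [show i' ≫ ψ.inv = g.inv ≫ i by rw [Iso.comp_inv_eq, Category.assoc, ← h,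
            Iso.inv_hom_id_assoc]])))

end PullbackPushforward

section PermIso

variable {s k : Type*} [Field k]

/-- A permutation of the coordinates, as a graded ring homomorphism. -/
noncomputable def permHom (k : Type*) [Field k] (σ : Equiv.Perm s) :
    GradedRingHom (polyGrading s k) (polyGrading s k) where
  toRingHom := (MvPolynomial.rename (R := k) σ.symm).toRingHom
  map_mem h := MvPolynomial.IsHomogeneous.rename_isHomogeneous h

theorem irrelevant_le_map_permHom (σ : Equiv.Perm s) :
    HomogeneousIdeal.irrelevant (polyGrading s k) ≤
      (HomogeneousIdeal.irrelevant (polyGrading s k)).map (permHom k σ) := by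
  rw [HomogeneousIdeal.irrelevant_le]
  intro n hn f hf
  have h1 : MvPolynomial.rename σ f ∈ HomogeneousIdeal.irrelevant (polyGrading s k) :=
    HomogeneousIdeal.mem_irrelevant_of_mem _ hn (MvPolynomial.IsHomogeneous.rename_isHomogeneous hf)
  have h2 : permHom k σ (MvPolynomial.rename σ f) = f := by
    change MvPolynomial.rename σ.symm (MvPolynomial.rename σ f) = f
    simp [MvPolynomial.rename_rename]
  change f ∈ Ideal.map _ _
  rw [← h2]
  exact Ideal.mem_map_of_mem _ h1

theorem permHom_comp (σ τ : Equiv.Perm s) :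
    (permHom k σ).comp (permHom k τ) = permHom k (τ * σ) := by
  ext1 f
  change MvPolynomial.rename _ (MvPolynomial.rename _ f) = MvPolynomial.rename _ f
  rw [MvPolynomial.rename_rename]
  rfl

theorem permHom_one : permHom k (1 : Equiv.Perm s) = GradedRingHom.id _ := by
  ext1 f
  exact MvPolynomial.rename_id_apply f

/-- The automorphism of projective space that permutes the coordinates by `σ`: a polynomial vanishes
at the image of a point if and only if its pull-back along `σ⁻¹` vanishes at the point. -/
noncomputable def permIso (k : Type*) [Field k] (σ : Equiv.Perm s) :
    projSpace s k ≅ projSpace s k where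
  hom := Proj.map (permHom k σ) (irrelevant_le_map_permHom σ)
  inv := Proj.map (permHom k σ⁻¹) (irrelevant_le_map_permHom σ⁻¹)
  hom_inv_id := by
    rw [← Proj.map_comp]
    simp only [permHom_comp, inv_mul_cancel, permHom_one, Proj.map_id]
  inv_hom_id := by
    rw [← Proj.map_comp]
    simp only [permHom_comp, mul_inv_cancel, permHom_one, Proj.map_id]

end PermIso

/-! ### Homeomorphisms given by automorphisms of `T` -/

section ReducedSubscheme

variable {X : Scheme}

/-- A morphism that maps a closed subset into itself restricts to its reduced subscheme. -/
theorem vanishingIdeal_le_map (f : X ⟶ X) (Z : Closeds X)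
    (h : f.base '' (Z : Set X) ⊆ Z) :
    Scheme.IdealSheafData.vanishingIdeal Z ≤
      (Scheme.IdealSheafData.vanishingIdeal Z).map f := by
  rw [Scheme.IdealSheafData.map_vanishingIdeal]
  exact Scheme.IdealSheafData.vanishingIdeal_antimono (Closeds.closure_le.mpr h)

/-- An automorphism of a scheme that stabilizes a closed subset restricts to an automorphism of its
reduced subscheme. -/
noncomputable def reducedSubschemeIso (ψ : X ≅ X) (Z : Closeds X)
    (h : ψ.hom.base '' (Z : Set X) ⊆ Z) (h' : ψ.inv.base '' (Z : Set X) ⊆ Z) :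
    (Scheme.IdealSheafData.vanishingIdeal Z).subscheme ≅
      (Scheme.IdealSheafData.vanishingIdeal Z).subscheme where
  hom := Scheme.IdealSheafData.subschemeMap _ _ ψ.hom (vanishingIdeal_le_map _ _ h)
  inv := Scheme.IdealSheafData.subschemeMap _ _ ψ.inv (vanishingIdeal_le_map _ _ h')
  hom_inv_id := by
    rw [← cancel_mono (Scheme.IdealSheafData.subschemeι _)]
    simp
  inv_hom_id := by
    rw [← cancel_mono (Scheme.IdealSheafData.subschemeι _)]
    simp

end ReducedSubscheme

namespace LooseGraph

open MvPolynomial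

variable {V E : Type*} {T : LooseGraph V E} {k : Type*} [Field k]

theorem Auto.card_ends (φ : T.Auto) (e : E) : (T.ends (φ.onEdge e)).card = (T.ends e).card := by
  have h : T.ends (φ.onEdge e) = (T.ends e).map φ.onVert.toEmbedding := by
    ext v
    obtain ⟨v, rfl⟩ := φ.onVert.surjective v
    simp [φ.mem_ends_iff]
  rw [h, Finset.card_map]

/-- An automorphism of a loose graph permutes the vertices of the completion. -/
def Auto.onComp (φ : T.Auto) : Equiv.Perm T.CompVert :=
  Equiv.sumCongr φ.onVert
    (φ.onEdge.sigmaCongr fun e => finCongr (by rw [φ.card_ends e]))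

theorem Auto.onComp_inl (φ : T.Auto) (v : V) : φ.onComp (.inl v) = .inl (φ.onVert v) := rfl

theorem Auto.adj_onComp_iff (φ : T.Auto) (a b : T.CompVert) :
    T.completion.Adj (φ.onComp a) (φ.onComp b) ↔ T.completion.Adj a b := by
  have h : ∀ a e, T.Inc (φ.onComp a) (φ.onEdge e) ↔ T.Inc a e := by
    rintro (v | ⟨e', i⟩) e
    · exact φ.mem_ends_iff v e
    · exact φ.onEdge.injective.eq_iff
  refine and_congr φ.onComp.injective.ne_iff (φ.onEdge.exists_congr fun e => ?_).symm
  rw [h, h]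

/-- The automorphism of the ambient projective space that permutes the coordinates. -/
noncomputable def Auto.projIso (φ : T.Auto) (k : Type*) [Field k] :
    projSpace T.CompVert k ≅ projSpace T.CompVert k := permIso k φ.onComp

/-- The automorphism of the ambient projective space that permutes the coordinates, on points. -/
noncomputable def Auto.ambient (φ : T.Auto) (p : T.Ambient k) : T.Ambient k :=
  (φ.projIso k).hom.base p

theorem Auto.mem_ambient_iff (φ : T.Auto) {p : T.Ambient k} {f : MvPolynomial T.CompVert k} :
    f ∈ (φ.ambient p).asHomogeneousIdeal ↔ rename φ.onComp.symm f ∈ p.asHomogeneousIdeal := Iff.rfl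

theorem Auto.X_mem_ambient_iff (φ : T.Auto) {p : T.Ambient k} {a : T.CompVert} :
    X (φ.onComp a) ∈ (φ.ambient p).asHomogeneousIdeal ↔ X a ∈ p.asHomogeneousIdeal := by
  rw [φ.mem_ambient_iff, rename_X, Equiv.symm_apply_apply]

theorem Auto.ambient_mem_points_iff (φ : T.Auto) {p : T.Ambient k} :
    φ.ambient p ∈ T.points k ↔ p ∈ T.points k := by
  rw [points, Set.mem_iUnion, Set.mem_iUnion]
  refine (φ.onVert.exists_congr fun v => ?_).symm
  refine and_congr (not_congr φ.X_mem_ambient_iff.symm) (φ.onComp.forall_congr fun a => ?_)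
  rw [φ.X_mem_ambient_iff, ← φ.onComp_inl, φ.adj_onComp_iff, φ.onComp.injective.ne_iff]

/-- The inverse of the permutation of the points of the ambient projective space. -/
noncomputable def Auto.ambientInv (φ : T.Auto) (p : T.Ambient k) : T.Ambient k :=
  (φ.projIso k).inv.base p

theorem Auto.ambient_ambientInv (φ : T.Auto) (p : T.Ambient k) : φ.ambient (φ.ambientInv p) = p :=
  congrArg (fun f : projSpace T.CompVert k ⟶ projSpace T.CompVert k => f.base p)
    (φ.projIso k).inv_hom_id

theorem Auto.ambientInv_ambient (φ : T.Auto) (p : T.Ambient k) : φ.ambientInv (φ.ambient p) = p :=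
  congrArg (fun f : projSpace T.CompVert k ⟶ projSpace T.CompVert k => f.base p)
    (φ.projIso k).hom_inv_id

theorem Auto.continuous_ambient (φ : T.Auto) : Continuous (φ.ambient (k := k)) :=
  (φ.projIso k).hom.base.hom.continuous

theorem Auto.continuous_ambientInv (φ : T.Auto) : Continuous (φ.ambientInv (k := k)) :=
  (φ.projIso k).inv.base.hom.continuous

theorem Auto.ambientInv_mem_points_iff (φ : T.Auto) {p : T.Ambient k} :
    φ.ambientInv p ∈ T.points k ↔ p ∈ T.points k := by
  rw [← φ.ambient_mem_points_iff, φ.ambient_ambientInv]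

/-- The homeomorphism of `X_k` induced by an automorphism of `T`. -/
noncomputable def Auto.topIso (φ : T.Auto) (k : Type*) [Field k] :
    TopCat.of (T.points k) ≅ TopCat.of (T.points k) where
  hom := TopCat.ofHom ⟨fun p => ⟨φ.ambient p.1, φ.ambient_mem_points_iff.mpr p.2⟩,
    (φ.continuous_ambient.comp continuous_subtype_val).subtype_mk _⟩
  inv := TopCat.ofHom ⟨fun p => ⟨φ.ambientInv p.1, φ.ambientInv_mem_points_iff.mpr p.2⟩,
    (φ.continuous_ambientInv.comp continuous_subtype_val).subtype_mk _⟩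
  hom_inv_id := by
    ext1 p
    exact Subtype.ext (φ.ambientInv_ambient p.1)
  inv_hom_id := by
    ext1 p
    exact Subtype.ext (φ.ambient_ambientInv p.1)

/-- The permutation of the points of `X_k` induced by an automorphism of `T`. -/
noncomputable def Auto.perm (φ : T.Auto) (k : Type*) [Field k] : Equiv.Perm (T.points k) :=
  (TopCat.homeoOfIso (φ.topIso k)).toEquiv

theorem Auto.perm_val (φ : T.Auto) (p : T.points k) : (φ.perm k p).1 = φ.ambient p.1 := rfl


theorem Auto.image_closure_subset (φ : T.Auto) :
    φ.ambient '' closure (T.points k) ⊆ closure (T.points k) := by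
  refine (image_closure_subset_closure_image φ.continuous_ambient).trans (closure_mono ?_)
  rintro _ ⟨p, hp, rfl⟩
  exact φ.ambient_mem_points_iff.mpr hp

theorem Auto.image_closure_subset' (φ : T.Auto) :
    φ.ambientInv '' closure (T.points k) ⊆ closure (T.points k) := by
  refine (image_closure_subset_closure_image φ.continuous_ambientInv).trans (closure_mono ?_)
  rintro _ ⟨p, hp, rfl⟩
  exact φ.ambientInv_mem_points_iff.mpr hp

/-- The automorphism of the closure of `X_k` induced by an automorphism of `T`. -/
noncomputable def Auto.closureIso (φ : T.Auto) (k : Type*) [Field k] :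
    T.closureScheme k ≅ T.closureScheme k :=
  reducedSubschemeIso (φ.projIso k) _ φ.image_closure_subset φ.image_closure_subset'

theorem Auto.closureIso_hom_closureι (φ : T.Auto) :
    (φ.closureIso k).hom ≫ T.closureι k = T.closureι k ≫ (φ.projIso k).hom :=
  Scheme.IdealSheafData.subschemeMap_subschemeι _ _ _
    (vanishingIdeal_le_map _ _ φ.image_closure_subset)

end LooseGraph

/-! ### Automorphisms of the ringed space `X_k` given by automorphisms of `T` -/

theorem TopCat.Sheaf.pushforward_comp_obj {X Y Z : TopCat} (f : X ⟶ Y) (g : Y ⟶ Z)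
    (F : X.Sheaf CommRingCat) : (TopCat.Sheaf.pushforward CommRingCat (f ≫ g)).obj F =
      (TopCat.Sheaf.pushforward CommRingCat g).obj
        ((TopCat.Sheaf.pushforward CommRingCat f).obj F) := rfl

/-- An automorphism of a scheme identifies the structure sheaf with its pushforward. -/
noncomputable def AlgebraicGeometry.Scheme.sheafIsoPushforward {Z : Scheme} (φ : Z ≅ Z) :
    Z.sheaf ≅ (TopCat.Sheaf.pushforward CommRingCat φ.hom.base).obj Z.sheaf :=
  (fullyFaithfulSheafToPresheaf _ _).preimageIso
    (PresheafedSpace.sheafIsoOfIso ((Scheme.forgetToLocallyRingedSpace ⋙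
      LocallyRingedSpace.forgetToSheafedSpace ⋙ SheafedSpace.forgetToPresheafedSpace).mapIso φ))

namespace LooseGraph

variable {V E : Type*} {T : LooseGraph V E} {k : Type*} [Field k]

/-- The homeomorphism of the ambient projective space induced by an automorphism of `T`. -/
noncomputable def Auto.projTopIso (φ : T.Auto) (k : Type*) [Field k] :
    (projSpace T.CompVert k).toTopCat ≅ (projSpace T.CompVert k).toTopCat :=
  Scheme.forgetToTop.mapIso (φ.projIso k)

/-- The structure sheaf of the closure of `X_k`, as a sheaf on projective space, is invariant under
the automorphisms of `T`. -/
noncomputable def Auto.closureSheafIso (φ : T.Auto) (k : Type*) [Field k] :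
    (TopCat.Sheaf.pushforward CommRingCat (φ.projTopIso k).hom).obj
      ((TopCat.Sheaf.pushforward CommRingCat (T.closureι k).base).obj (T.closureScheme k).sheaf) ≅
    (TopCat.Sheaf.pushforward CommRingCat (T.closureι k).base).obj (T.closureScheme k).sheaf :=
  eqToIso ((TopCat.Sheaf.pushforward_comp_obj _ _ _).symm.trans
    ((congrArg (fun f : T.closureScheme k ⟶ projSpace T.CompVert k =>
      (TopCat.Sheaf.pushforward CommRingCat f.base).obj (T.closureScheme k).sheaf)
      φ.closureIso_hom_closureι.symm).trans (TopCat.Sheaf.pushforward_comp_obj _ _ _))) ≪≫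
  (TopCat.Sheaf.pushforward CommRingCat (T.closureι k).base).mapIso
    (Scheme.sheafIsoPushforward (φ.closureIso k)).symm

/-- The automorphism of the ringed space `X_k` induced by an automorphism of `T`. -/
noncomputable def Auto.ringedSpaceIso (φ : T.Auto) (k : Type*) [Field k] :
    T.ringedSpace k ≅ T.ringedSpace k :=
  SheafedSpace.isoMk (PresheafedSpace.isoOfComponents (φ.topIso k)
    ((TopCat.Sheaf.forget _ _).mapIso
      ((TopCat.Sheaf.pullbackPushforwardIso (φ.topIso k) (φ.projTopIso k) rfl).app _ ≪≫
        (TopCat.Sheaf.pullback CommRingCat (T.incl k)).mapIso (φ.closureSheafIso k))))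

theorem Auto.isSchemeTheoretic_perm (φ : T.Auto) : T.IsSchemeTheoretic k (φ.perm k) :=
  ⟨φ.ringedSpaceIso k, fun _ => rfl⟩

end LooseGraph

/-! ### Semilinear substitutions, and the projective and combinatorial automorphisms given by `T` -/

section SemilinSubst

open MvPolynomial

variable {s k : Type*} [Field k] [Fintype s]

theorem semilinSubst_X (τ : k ≃+* k) (A : Matrix s s k) (a : s) :
    semilinSubst τ A (X a) = ∑ b, C (A a b) * X b := by
  simp [semilinSubst]

theorem semilinSubst_C (τ : k ≃+* k) (A : Matrix s s k) (c : k) :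
    semilinSubst τ A (C c) = C (τ c) := by
  simp [semilinSubst]

theorem semilinSubst_surjective [DecidableEq s] (τ : k ≃+* k) (A : GL s k) :
    Function.Surjective (semilinSubst τ A.1) := by
  have hC : ∀ c : k, C c ∈ (semilinSubst τ A.1).range := fun c =>
    ⟨C (τ.symm c), by rw [semilinSubst_C, τ.apply_symm_apply]⟩
  have hX : ∀ b, X b ∈ (semilinSubst τ A.1).range := by
    intro b
    have h1 : (X b : MvPolynomial s k) =
        ∑ a, C ((A⁻¹).1 b a) * semilinSubst τ A.1 (X a) := by
      simp_rw [semilinSubst_X, Finset.mul_sum]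
      rw [Finset.sum_comm]
      simp_rw [← mul_assoc, ← C_mul, ← Finset.sum_mul, ← map_sum]
      have h2 : ∀ c, ∑ a, (A⁻¹).1 b a * A.1 a c = (1 : Matrix s s k) b c := fun c => by
        rw [← Matrix.mul_apply, ← Units.val_mul, inv_mul_cancel, Units.val_one]
      simp_rw [h2, Matrix.one_apply]
      simp
    rw [h1]
    exact sum_mem fun a _ => mul_mem (hC _) ⟨_, rfl⟩
  intro f
  change f ∈ (semilinSubst τ A.1).range
  induction f using MvPolynomial.induction_on with
  | C c => exact hC c
  | add p q hp hq => exact add_mem hp hq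
  | mul_X p a hp => exact mul_mem hp (hX a)

theorem semilinSubst_permMatrix [DecidableEq s] (σ : Equiv.Perm s) (f : MvPolynomial s k) :
    semilinSubst (RingEquiv.refl k) (σ.permMatrix k) f = rename σ f := by
  induction f using MvPolynomial.induction_on with
  | C c => simp [semilinSubst_C]
  | add p q hp hq => rw [map_add, map_add, hp, hq]
  | mul_X p a hp =>
    rw [map_mul, map_mul, hp, semilinSubst_X, rename_X]
    simp [Equiv.Perm.permMatrix, PEquiv.toMatrix_apply]

end SemilinSubst

namespace LooseGraph

variable {V E : Type*} {T : LooseGraph V E} {k : Type*} [Field k]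

theorem IsSchemeTheoretic.isTopological {g : Equiv.Perm (T.points k)}
    (hg : T.IsSchemeTheoretic k g) : T.IsTopological k g := by
  obtain ⟨γ, hγ⟩ := hg
  have h1 : ∀ p, γ.inv.hom.base (γ.hom.hom.base p) = p := fun p =>
    congrArg (fun f : T.ringedSpace k ⟶ T.ringedSpace k => f.hom.base p) γ.hom_inv_id
  have h2 : (g : T.points k → T.points k) = γ.hom.hom.base := funext fun p => (hγ p).symm
  have h3 : (g.symm : T.points k → T.points k) = γ.inv.hom.base := by
    funext p
    obtain ⟨q, rfl⟩ := g.surjective p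
    rw [Equiv.symm_apply_apply]
    exact ((congrArg γ.inv.hom.base (hγ q)).symm.trans (h1 q)).symm
  constructor
  · rw [h2]
    exact γ.hom.hom.base.hom.continuous
  · rw [h3]
    exact γ.inv.hom.base.hom.continuous

variable [Fintype V] [Fintype E] [DecidableEq V] [DecidableEq E]

theorem IsProjective.isTopological {g : Equiv.Perm (T.points k)}
    (hg : T.IsProjective k g) : T.IsTopological k g := by
  obtain ⟨τ, A, h⟩ := hg
  have hcl : ∀ C : Set (T.points k), IsClosed C ↔
      ∃ S : Set (MvPolynomial T.CompVert k), C = {p | S ⊆ p.1.asHomogeneousIdeal} := by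
    intro C
    rw [isClosed_induced_iff]
    constructor
    · rintro ⟨D, hD, rfl⟩
      obtain ⟨S, rfl⟩ := (ProjectiveSpectrum.isClosed_iff_zeroLocus _ D).mp hD
      exact ⟨S, rfl⟩
    · rintro ⟨S, rfl⟩
      exact ⟨ProjectiveSpectrum.zeroLocus _ S, ProjectiveSpectrum.isClosed_zeroLocus _ S, rfl⟩
  constructor
  · refine continuous_iff_isClosed.mpr fun C hC => ?_
    obtain ⟨S, rfl⟩ := (hcl C).mp hC
    refine (hcl _).mpr ⟨semilinSubst τ A.1 '' S, ?_⟩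
    ext p
    rw [Set.mem_preimage, Set.mem_ofPred_eq, Set.mem_ofPred_eq, Set.image_subset_iff]
    exact forall₂_congr fun f _ => h p f
  · refine continuous_iff_isClosed.mpr fun C hC => ?_
    obtain ⟨S, rfl⟩ := (hcl C).mp hC
    refine (hcl _).mpr ⟨semilinSubst τ A.1 ⁻¹' S, ?_⟩
    ext p
    obtain ⟨q, rfl⟩ := g.surjective p
    rw [Set.mem_preimage, Equiv.symm_apply_apply, Set.mem_ofPred_eq, Set.mem_ofPred_eq]
    constructor
    · exact fun hS f hf => (h q f).mpr (hS hf)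
    · intro hS f hf
      obtain ⟨f, rfl⟩ := semilinSubst_surjective τ A f
      exact (h q f).mp (hS hf)

theorem Auto.isProjective_perm (φ : T.Auto) : T.IsProjective k (φ.perm k) := by
  have hdet : (Equiv.Perm.permMatrix k φ.onComp.symm).det ≠ 0 := by
    rw [Matrix.det_permutation]
    rcases Int.units_eq_one_or (Equiv.Perm.sign φ.onComp.symm) with h | h <;> simp [h]
  refine ⟨RingEquiv.refl k, Matrix.GeneralLinearGroup.mkOfDetNeZero _ hdet, fun p f => ?_⟩
  have h1 : semilinSubst (RingEquiv.refl k)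
      (Matrix.GeneralLinearGroup.mkOfDetNeZero _ hdet).1 f =
      MvPolynomial.rename φ.onComp.symm f := semilinSubst_permMatrix _ f
  rw [h1]
  exact φ.mem_ambient_iff

omit [Fintype V] [Fintype E] in
theorem Auto.perm_vertPoint (φ : T.Auto) (v : V) :
    φ.perm k (T.vertPoint k v) = T.vertPoint k (φ.onVert v) := by
  refine eq_vertPoint fun a ha => ?_
  obtain ⟨a, rfl⟩ := φ.onComp.surjective a
  rw [φ.perm_val, φ.X_mem_ambient_iff, X_mem_vertPoint_iff]
  rintro rfl
  exact ha rfl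

theorem Auto.perm_mem_edgeLine_iff (φ : T.Auto) {u v : V} {p : T.points k} :
    φ.perm k p ∈ T.edgeLine k (φ.onVert u) (φ.onVert v) ↔ p ∈ T.edgeLine k u v := by
  rw [mem_edgeLine_iff, mem_edgeLine_iff]
  refine (φ.onComp.forall_congr fun a => ?_).symm
  rw [φ.perm_val, φ.X_mem_ambient_iff, ← φ.onComp_inl, ← φ.onComp_inl, φ.onComp.injective.ne_iff,
    φ.onComp.injective.ne_iff]

theorem Auto.induces_perm (φ : T.Auto) {α : T.innerTree ≃g T.innerTree}
    (h : ∀ v : T.inner, φ.onVert v = α v) : Induces (φ.perm k) α := by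
  refine ⟨fun v => by rw [← h, φ.perm_vertPoint], fun u v _ => ?_⟩
  rw [← h, ← h]
  ext p
  obtain ⟨q, rfl⟩ := (φ.perm k).surjective p
  rw [(φ.perm k).injective.mem_set_image, φ.perm_mem_edgeLine_iff]

/-- The permutation of the coordinates induced by an automorphism of `T`. -/
noncomputable def Auto.linEquiv (φ : T.Auto) (k : Type*) [Field k] :
    (T.CompVert → k) ≃ₗ[k] (T.CompVert → k) := LinearEquiv.funCongrLeft k k φ.onComp.symm

omit [Fintype V] [Fintype E] [DecidableEq V] [DecidableEq E] in
theorem Auto.linEquiv_apply (φ : T.Auto) (x : T.CompVert → k) (a : T.CompVert) :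
    φ.linEquiv k x (φ.onComp a) = x a := by
  simp [linEquiv, LinearMap.funLeft_apply]

omit [Fintype V] [Fintype E] [DecidableEq V] [DecidableEq E] in
theorem Auto.linEquiv_mem_starSpace_iff (φ : T.Auto) {x : T.CompVert → k} {v : V} :
    φ.linEquiv k x ∈ T.starSpace k (φ.onVert v) ↔ x ∈ T.starSpace k v := by
  rw [mem_starSpace, mem_starSpace]
  refine (φ.onComp.forall_congr fun a => ?_).symm
  rw [φ.linEquiv_apply]
  refine imp_congr_left (not_congr ?_)
  exact or_congr φ.onComp.injective.eq_iff.symm (φ.adj_onComp_iff _ _).symm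

omit [Fintype V] [Fintype E] in
theorem Auto.linEquiv_vertVec (φ : T.Auto) (v : V) :
    φ.linEquiv k (T.vertVec k v) = T.vertVec k (φ.onVert v) := by
  funext a
  obtain ⟨a, rfl⟩ := φ.onComp.surjective a
  rw [φ.linEquiv_apply, vertVec, vertVec, ← φ.onComp_inl]
  simp only [Pi.single_apply, φ.onComp.injective.eq_iff]

/-- The permutation of the rational points of the ambient projective space induced by an
automorphism of `T`. -/
noncomputable def Auto.projPerm (φ : T.Auto) (k : Type*) [Field k] :
    Equiv.Perm (Projectivization k (T.CompVert → k)) :=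
  Equiv.ofBijective (Projectivization.map (φ.linEquiv k).toLinearMap (φ.linEquiv k).injective)
    ⟨Projectivization.map_injective _ _, fun p => by
      induction p using Projectivization.ind with
      | h x hx =>
        refine ⟨Projectivization.mk k ((φ.linEquiv k).symm x) (by simpa), ?_⟩
        refine (Projectivization.map_mk _ _ _ _).trans ?_
        simp⟩

omit [Fintype V] [Fintype E] [DecidableEq V] [DecidableEq E] in
theorem Auto.projPerm_mk (φ : T.Auto) {x : T.CompVert → k} (hx : x ≠ 0) :
    φ.projPerm k (Projectivization.mk k x hx) =
      Projectivization.mk k (φ.linEquiv k x) (by simpa) := rfl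

omit [Fintype V] [Fintype E] [DecidableEq V] [DecidableEq E] in
theorem Auto.projPerm_mem_points_iff (φ : T.Auto) (p : Projectivization k (T.CompVert → k)) :
    T.toAmbient p ∈ T.points k ↔ T.toAmbient (φ.projPerm k p) ∈ T.points k := by
  induction p using Projectivization.ind with
  | h x hx =>
    rw [φ.projPerm_mk, toAmbient_mem_points_iff, toAmbient_mem_points_iff]
    refine φ.onVert.exists_congr fun v => and_congr φ.linEquiv_mem_starSpace_iff.symm ?_
    rw [← φ.onComp_inl, φ.linEquiv_apply]

/-- The permutation of the rational points of `X_k` induced by an automorphism of `T`. -/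
noncomputable def Auto.ratPerm (φ : T.Auto) (k : Type*) [Field k] : Equiv.Perm (T.RatPoints k) :=
  (φ.projPerm k).subtypeEquiv φ.projPerm_mem_points_iff

omit [Fintype V] [Fintype E] [DecidableEq V] [DecidableEq E] in
theorem Auto.submodule_ratPerm (φ : T.Auto) (p : T.RatPoints k) :
    (φ.ratPerm k p).1.submodule = p.1.submodule.map (φ.linEquiv k).toLinearMap := by
  obtain ⟨p, hp⟩ := p
  change (φ.projPerm k p).submodule = _
  induction p using Projectivization.ind with
  | h x hx =>
    rw [φ.projPerm_mk, Projectivization.submodule_mk, Projectivization.submodule_mk,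
      Submodule.map_span, Set.image_singleton]
    rfl

/-- The permutation of the lines of `X_k` induced by an automorphism of `T`. -/
noncomputable def Auto.linePerm (φ : T.Auto) (k : Type*) [Field k] : Equiv.Perm (T.Lines k) :=
  (Submodule.orderIsoMapComap (φ.linEquiv k)).toEquiv.subtypeEquiv fun W => by
    change _ ↔ Module.finrank k (W.map (φ.linEquiv k).toLinearMap) = 2 ∧ _
    rw [LinearEquiv.finrank_map_eq]
    refine and_congr_right fun hW => ?_
    rw [isLine_iff hW]
    refine Iff.trans ?_ (isLine_iff (W := W.map (φ.linEquiv k).toLinearMap)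
      ((LinearEquiv.finrank_map_eq (φ.linEquiv k) W).trans hW)).symm
    refine φ.onVert.exists_congr fun v => ?_
    change _ ↔ W.map (φ.linEquiv k).toLinearMap ≤ _ ∧ ∃ x ∈ W.map (φ.linEquiv k).toLinearMap, _
    refine and_congr ?_ ?_
    · rw [Submodule.map_le_iff_le_comap]
      exact forall₂_congr fun x _ => φ.linEquiv_mem_starSpace_iff.symm
    · simp only [Submodule.mem_map, exists_exists_and_eq_and, LinearEquiv.coe_coe, ← φ.onComp_inl,
        φ.linEquiv_apply]

omit [DecidableEq V] [DecidableEq E] in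
theorem Auto.linePerm_val (φ : T.Auto) (l : T.Lines k) :
    (φ.linePerm k l).1 = l.1.map (φ.linEquiv k).toLinearMap := rfl

/-- The combinatorial automorphism of `X_k` induced by an automorphism of `T`. -/
noncomputable def Auto.combAuto (φ : T.Auto) (k : Type*) [Field k] : T.CombAuto k where
  onPoints := φ.ratPerm k
  onLines := φ.linePerm k
  incident_iff p l := by
    rw [φ.submodule_ratPerm, φ.linePerm_val]
    exact (Submodule.orderIsoMapComap (φ.linEquiv k)).le_iff_le

theorem Auto.induces_combAuto (φ : T.Auto) {α : T.innerTree ≃g T.innerTree}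
    (h : ∀ v : T.inner, φ.onVert v = α v) : (φ.combAuto k).Induces α := by
  constructor
  · intro v
    refine Subtype.ext ?_
    change φ.projPerm k (Projectivization.mk _ _ _) = Projectivization.mk _ _ _
    rw [φ.projPerm_mk]
    simp only [φ.linEquiv_vertVec, h]
  · intro u v huv
    have huv : T.graph.Adj u v := huv
    obtain ⟨l, hul, hl⟩ := exists_fullAt_span (k := k) huv
      (single_mem_starSpace (inl_mem_star_self (u : V)) 1) (by simp)
    have h1 := hl.eq_span hul (by simp)
    refine ⟨l, h1, ?_⟩
    change l.1.map (φ.linEquiv k).toLinearMap = _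
    rw [h1, Submodule.map_span, Set.image_pair, edgeSpan, ← h, ← h]
    simp only [LinearEquiv.coe_coe, φ.linEquiv_vertVec]

end LooseGraph

/-- **Inner Tree Theorem.** For the combinatorial, the projective, the topological and the
scheme-theoretic automorphisms of `X_k`: every automorphism stabilizes the embedded inner tree and
acts on it as an automorphism of the embedded inner tree, and all of these are induced. -/
theorem mainTheorem3 {V E : Type*} [Fintype V] [Fintype E] [DecidableEq V] [DecidableEq E]
    (T : LooseGraph V E) (hT : T.IsLooseTree) (hI : 2 ≤ T.inner.ncard)
    (k : Type*) [Field k] :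
    ((∀ g : T.CombAuto k, ∃ α ∈ T.embeddedInnerAut, g.Induces α) ∧
      ∀ α ∈ T.embeddedInnerAut, ∃ g : T.CombAuto k, g.Induces α) ∧
    ((∀ g, T.IsProjective k g → ∃ α ∈ T.embeddedInnerAut, LooseGraph.Induces g α) ∧
      ∀ α ∈ T.embeddedInnerAut, ∃ g, T.IsProjective k g ∧ LooseGraph.Induces g α) ∧
    ((∀ g, T.IsTopological k g → ∃ α ∈ T.embeddedInnerAut, LooseGraph.Induces g α) ∧
      ∀ α ∈ T.embeddedInnerAut, ∃ g, T.IsTopological k g ∧ LooseGraph.Induces g α) ∧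
    ((∀ g, T.IsSchemeTheoretic k g → ∃ α ∈ T.embeddedInnerAut, LooseGraph.Induces g α) ∧
      ∀ α ∈ T.embeddedInnerAut, ∃ g, T.IsSchemeTheoretic k g ∧ LooseGraph.Induces g α) := by
  refine ⟨⟨fun g => hT.exists_induces_of_combAuto hI g, ?_⟩,
    ⟨fun g hg => hT.exists_induces_of_isTopological hI hg.isTopological, ?_⟩,
    ⟨fun g hg => hT.exists_induces_of_isTopological hI hg, ?_⟩,
    ⟨fun g hg => hT.exists_induces_of_isTopological hI hg.isTopological, ?_⟩⟩
  · rintro α ⟨φ, hφ⟩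
    exact ⟨φ.combAuto k, φ.induces_combAuto hφ⟩
  · rintro α ⟨φ, hφ⟩
    exact ⟨φ.perm k, φ.isProjective_perm, φ.induces_perm hφ⟩
  · rintro α ⟨φ, hφ⟩
    exact ⟨φ.perm k, φ.isProjective_perm.isTopological, φ.induces_perm hφ⟩
  · rintro α ⟨φ, hφ⟩
    exact ⟨φ.perm k, φ.isSchemeTheoretic_perm, φ.induces_perm hφ⟩
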